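/- **Setting.** There are $Q$ users and $N\ge 1$ carriers, with channels $H_{qr}(k)\in\mathbb C$ (from transmitter $r$ to receiver $q$), $H_{qq}(k)\ne0$, channels $G_q(k)\in\mathbb C$ to the primary receiver, noise powers $\sigma^2_{q,k}>0$, sensing parameters $\mu_{q,k|0}<\mu_{q,k|1}$, $\sigma_{q,k|0},\sigma_{q,k|1}>0$, sampling frequencies $f_q>0$, times $0<\tau_q^{\min}<\tau_q^{\max}<T_q$, power budgets $P_q>0$, masks $p^{\max}_{q,k}>0$, interference thresholds $I_q^{\max}>0$ and $I^{\max}\in\mathbb R$, bounds $0<\alpha_{q,k}\le\frac12$, $0<\beta_q\le\frac12$, and a weight $c\ge0$. Put $|\hat H_{qr}(k)|^2=|H_{qr}(k)/H_{qq}(k)|^2$, $\hat\sigma^2_{q,k}=\sigma^2_{q,k}/|H_{qq}(k)|^2$, $\hat\sigma^4_{q,k}=(\hat\sigma^2_{q,k})^2$, $\Delta_{q,k}=\mu_{q,k|1}-\mu_{q,k|0}$, $\hat\tau_q^{\min}=\sqrt{\tau_q^{\min}f_q}$, $\hat\tau_q^{\max}=\sqrt{\tau_q^{\max}f_q}$,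 $\mathcal Q(x)=\frac1{\sqrt{2\pi}}\int_x^\infty e^{-u^2/2}du$, $\hat\alpha_{q,k}=\mathcal Q^{-1}(1-\alpha_{q,k})$. **Game.** The strategy of user $q$ is $\mathbf x_q=(\hat\tau_q,\mathbf p_q,P_q^{\rm fa})\in\mathbb R\times\mathbb R^N\times\mathbb R$. Let $\mathcal P_q=\{\mathbf p:\sum_kp_k\le P_q,\ 0\le p_k\le p^{\max}_{q,k}\}$, $$\mathcal Y_q=\Big\{\mathbf x_q:\ 0<P_q^{\rm fa}\le\beta_q,\ \tfrac{\sigma_{q,k|0}}{\sigma_{q,k|1}}\mathcal Q^{-1}(P_q^{\rm fa})-\hat\tau_q\tfrac{\Delta_{q,k}}{\sigma_{q,k|1}}\le\hat\alpha_{q,k}\ \forall k,\ \mathbf p_q\in\mathcal P_q,\ \hat\tau_q^{\min}\le\hat\tau_q\le\hat\tau_q^{\max}\Big\},$$ $P^{\rm miss}_{q,k}=1-\mathcal Q\big((\sigma_{q,k|0}\mathcal Q^{-1}(P_q^{\rm fa})-\Delta_{q,k}\hat\tau_q)/\sigma_{q,k|1}\big)$, $I_q(\mathbf x_q)=\sum_kP^{\rm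 miss}_{q,k}|G_q(k)|^2p_{q,k}-I_q^{\max}$, $I(\mathbf x)=\sum_q\sum_kP^{\rm miss}_{q,k}|G_q(k)|^2p_{q,k}-I^{\max}$, $\mathcal X_q=\{\mathbf x_q\in\mathcal Y_q: I_q(\mathbf x_q)\le0\}$, assumed nonempty, and $\mathcal Y=\prod_q\mathcal Y_q$. With $r_q(\mathbf p)=\sum_k\log\Big(1+\frac{p_{q,k}}{\hat\sigma^2_{q,k}+\sum_{r\ne q}|\hat H_{qr}(k)|^2p_{r,k}}\Big)$ let $$\theta_q(\mathbf x)=\log\Big(\big(1-\tfrac{\hat\tau_q^2}{f_qT_q}\big)(1-P_q^{\rm fa})\,r_q(\mathbf p)\Big)-\tfrac c2\Big(\tfrac{\hat\tau_q}{\sqrt{f_q}}-\tfrac1Q\sum_{r}\tfrac{\hat\tau_r}{\sqrt{f_r}}\Big)^2\qquad(\log0=-\infty).$$ In the game $\mathcal G_\pi$ with fixed price $\pi\ge0$, user $q$ maximizes $\theta_q(\mathbf x_q,\mathbf x_{-q})-\pi I(\mathbf x_q,\mathbf x_{-q})$ over $\mathbf x_q\in\mathcal X_q$. **Constants.** Fix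 $t\ge\pi$ and, for each $q$, some $\mathbf p_q^{\rm ref}\in\mathcal P_q\setminus\{0\}$ with $\sum_k|G_q(k)|^2p^{\rm ref}_{q,k}\le2I_q^{\max}$. Let - $r_q^{\min}=\min_k\frac1{p^{\max}_{q,k}}\log\Big(1+\frac{p^{\max}_{q,k}}{\hat\sigma^2_{q,k}+\sum_{r\ne q}|\hat H_{qr}(k)|^2p^{\max}_{r,k}}\Big)$, $\ r_q^{\max}=\sum_k\log(1+p^{\max}_{q,k}/\hat\sigma^2_{q,k})$, $\ \lambda^{\max}=\sum_q\frac{1/\min_r\{I_r^{\max},\min_kp^{\max}_{r,k}\}}{r_q^{\min}\,\min_k\hat\sigma^2_{q,k}}$; - $P_q^{\rm fa,ref}=\max_k\mathcal Q\Big(\frac{\sigma_{q,k|1}\hat\alpha_{q,k}+\Delta_{q,k}\hat\tau_q^{\min}}{\sigma_{q,k|0}}\Big)$, $\ \eta_q^{\rm ref}(t)=\log(1-\tfrac{\tau_q^{\min}}{T_q})+\log(1-P_q^{\rm fa,ref})+\log r_q(\mathbf p_q^{\rm ref},\mathbf p_{-q}^{\max})-\tfrac t2\sum_k|G_q(k)|^2p^{\rm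 ref}_{q,k}$; - $s_q(t)=(\min_k\hat\sigma^2_{q,k})e^{\eta_q^{\rm ref}(t)}$, $\ \hat{\mathcal Y}_q^t=\{\mathbf x_q\in\mathcal Y_q:\sum_kp_{q,k}\ge s_q(t)\}$, $\ r_q^{\rm low}(t)=s_q(t)\,r_q^{\min}$, $\ \xi_q^{\sup}(t)=\frac1{r_q^{\rm low}(t)}+\frac1{r_q^{\rm low}(t)}\frac1{r_q^{\min}}\Big(\sum_k\frac1{\hat\sigma^4_{q,k}}\Big)^{1/2}$; - $\omega^{\hat\tau}_{q,k}=\frac{\Delta_{q,k}}{\sqrt{2\pi}\,\sigma_{q,k|1}}$, $\ e_{q,k}=\exp\Big(\frac12\big(\frac{\Delta_{q,k}}{\sigma_{q,k|0}}\hat\tau_q^{\max}\big)^2\Big)$, $\ \omega^{\rm fa}_{q,k}=\frac{\sigma_{q,k|0}}{\sigma_{q,k|1}}e_{q,k}$, $\ \omega^{\hat\tau,\rm fa}_{q,k}=\frac{\Delta_{q,k}\sigma_{q,k|0}}{\sigma_{q,k|1}^2}\max\Big\{\mathcal Q^{-1}(\alpha_{q,k}),\frac{\Delta_{q,k}}{\sigma_{q,k|1}}\hat\tau_q^{\max}\Big\}e_{q,k}$;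 - $d^{\hat\tau}_q=\frac{2}{f_qT_q}\frac{1+\tau_q^{\min}/T_q}{(1-\tau_q^{\min}/T_q)^2}$, $\ d_{q,k}=\frac{1/r_q^{\max}}{(\hat\sigma^2_{q,k}+\sum_{r=1}^Q|\hat H_{qr}(k)|^2p^{\max}_{r,k})^2}$, $\ d_q^{\rm fa}=\Big(1-\min_k\mathcal Q\big(\Delta_{q,k}\hat\tau_q^{\max}/\sigma_{q,k|0}\big)\Big)^{-2}$, $\ \kappa_q(t)=2\max\{t,\lambda^{\max}\}\max_k|G_q(k)|^2$; - $\bar L_q(t)$ the symmetric $(N+1)\times(N+1)$ matrix with diagonal $(d_{q,1},\dots,d_{q,N},d_q^{\rm fa})$, entries $-2\kappa_q(t)\omega^{\rm fa}_{q,k}$ at $(k,N+1)$ and $(N+1,k)$, $k\le N$, and $0$ elsewhere; $\varsigma_q(t)=\kappa_q(t)\,\big\|\big((\omega^{\hat\tau}_{q,k})_{k},\ \sum_k\omega^{\hat\tau,\rm fa}_{q,k}p^{\max}_{q,k}\big)\big\|_2$; $\ \rho_q^{\rm low}(t)=\max\{0,\lambda_{\rm least}(B_q^{\rm low})\}$,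 where $B_q^{\rm low}=\begin{bmatrix}d^{\hat\tau}_q&-\varsigma_q(t)\\-\varsigma_q(t)&\lambda_{\rm least}(\bar L_q(t))\end{bmatrix}$ and $\lambda_{\rm least}$ is the least eigenvalue. For $\rho\ge0$ let $M_q(\rho)={\rm diag}\Big(\sqrt{\rho+c\big(\tfrac{1-1/Q}{\sqrt{f_q}}\big)^2},\sqrt{\rho}\Big)$. Assume that $\rho_q^{\rm low}(t)>0$ for all $q$ (so that the following inverses exist) and set, with the spectral norm, $$\beta_{qr}^{\rm up}(t,c)=\Big\|M_q(\rho_q^{\rm low}(t))^{-1}\,{\rm diag}\Big(c\,\tfrac{1-1/Q}{\sqrt{f_q}}\tfrac{1/Q}{\sqrt{f_r}},\ \max_k\tfrac{|\hat H_{qr}(k)|^2}{\hat\sigma_{q,k}^4}\,\xi_q^{\sup}(t)\Big)M_r(\rho_r^{\rm low}(t))^{-1}\Big\|.$$ **The matrix $\Gamma(t)$.** Let $\mathcal L_q=-\theta_q+\lambda_qI_q+\pi' I$, and let $B_q(\mathbf x,\lambda_q,\pi')$ be the $2\times2$ matrix with diagonal entries $\nabla^2_{\hat\tau_q}\mathcal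 L_q|_{c=0}$ and $\lambda_{\rm least}(\nabla^2_{(\mathbf p_q,P_q^{\rm fa})}\mathcal L_q)$ and off-diagonal entries $-\|\nabla^2_{\hat\tau_q(\mathbf p_q,P_q^{\rm fa})}\mathcal L_q\|$. Let $\rho_q(t)$ be the positive part of the minimum of $\lambda_{\rm least}(B_q(\mathbf x,\lambda_q,\pi'))$ over $\mathbf x_q\in\hat{\mathcal Y}_q^t$, $\mathbf x_{-q}\in\mathcal Y_{-q}$, $\lambda_q\in[0,\lambda^{\max}]$, $\pi'\in[0,t]$; let $D_q=M_q(\rho_q(t))$, $E_{qr}(\mathbf x)={\rm diag}(|\nabla^2_{\hat\tau_q\hat\tau_r}\theta_q|,\|\nabla^2_{\mathbf p_q\mathbf p_r}\theta_q\|)$ and $\beta_{qr}(t,c)=\max\|D_q^{-1}E_{qr}(\mathbf x)D_r^{-1}\|$ over $\mathbf x_q\in\hat{\mathcal Y}_q^t$, $\mathbf x_{-q}\in\mathcal Y_{-q}$. $\Gamma(t)$ has diagonal entries $1$ and off-diagonal entries $-\beta_{qr}(t,c)$. **Statement.** Suppose that one of the following holds: (low received MUI) $\sum_{r\ne q}\beta_{qr}^{\rm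 up}(t,c)<1$ for all $q$; or (low transmitted MUI) $\sum_{q\ne r}\beta_{qr}^{\rm up}(t,c)<1$ for all $r$. Then: 1. $|[\Gamma(t)]_{qr}|\le\beta_{qr}^{\rm up}(t,c)$ for all $q\ne r$; 2. for every $q$ and $\mathbf x_{-q}\in\mathcal Y_{-q}$, the (nonconvex) problem of user $q$ has a unique optimal solution $\bar{\mathcal B}_q(\mathbf x_{-q})$, and it is nontrivial ($\mathbf p_q\ne0$); 3. $\bar{\mathcal B}=(\bar{\mathcal B}_q)_q$ is a block-contraction on $\mathcal Y$: $\rho_q(t)>0$ for all $q$ and, for some weights $w_q>0$ and some $\kappa\in[0,1)$, $\|\bar{\mathcal B}(\mathbf x)-\bar{\mathcal B}(\mathbf y)\|\le\kappa\|\mathbf x-\mathbf y\|$ on $\mathcal Y$, where $\|\mathbf y\|=\max_q w_q^{-1}\big\|D_q\,\big(|\hat\tau_q|,\|(\mathbf p_q,P_q^{\rm fa})\|_2\big)\big\|_2$; $\bar{\mathcal B}$ has a unique fixed point $\mathbf x^\star$ in $\mathcal Y$, which is the unique Nash equilibrium of $\mathcal G_\pi$; 4. every sequence generated from a point of $\mathcal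 Y$ by the totally asynchronous algorithm based on $\bar{\mathcal B}$ (at time $n$ user $q$ either keeps his strategy or replaces it by $\bar{\mathcal B}_q$ evaluated at possibly outdated strategies $\mathbf x_r(d_{qr}(n))$, $d_{qr}(n)\le n$; every user updates infinitely often and $d_{qr}(n)\to\infty$) converges to $\mathbf x^\star$. -/

import Mathlib

open Filter Topology MeasureTheory

noncomputable section

namespace CogRadio

/-- The Gaussian tail function `Qfun x = (1 / √(2π)) ∫_x^∞ exp (-u² / 2) du`. -/
def Qfun (x : ℝ) : ℝ :=
  (1 / Real.sqrt (2 * Real.pi)) * ∫ u in Set.Ioi x, Real.exp (-u ^ 2 / 2)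

/-- The inverse of the Gaussian tail function. It is only ever used at points of `(0, 1)`. -/
def Qinv : ℝ → ℝ := Function.invFun Qfun

/-- The strategy `(τ̂, p, P_fa)` of one user: normalized sensing time, power allocation over the
`N` carriers, false alarm probability. -/
abbrev Strategy (N : ℕ) : Type := ℝ × (Fin N → ℝ) × ℝ

/-- A strategy profile of the `Q` users. -/
abbrev Profile (Q N : ℕ) : Type := Fin Q → Strategy N

/-- The parameters of a cognitive radio system with `Q` secondary users and `N` carriers.
`H q r k` is the transfer function from transmitter `r` to receiver `q` on carrier `k`, and
`G q k` the one from transmitter `q` to the primary receiver. -/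
structure System (Q N : ℕ) where
  H : Fin Q → Fin Q → Fin N → ℂ
  G : Fin Q → Fin N → ℂ
  /-- noise power spectral density at the secondary receivers -/
  noise : Fin Q → Fin N → ℝ
  /-- mean of the energy detector when no primary signal is present -/
  mu0 : Fin Q → Fin N → ℝ
  /-- mean of the energy detector when a primary signal is present -/
  mu1 : Fin Q → Fin N → ℝ
  /-- standard deviation of the energy detector when no primary signal is present -/
  sd0 : Fin Q → Fin N → ℝ
  /-- standard deviation of the energy detector when a primary signal is present -/
  sd1 : Fin Q → Fin N → ℝ
  /-- sampling frequency -/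
  f : Fin Q → ℝ
  /-- frame duration -/
  T : Fin Q → ℝ
  /-- bounds on the sensing time -/
  tauMin : Fin Q → ℝ
  tauMax : Fin Q → ℝ
  /-- power budget -/
  P : Fin Q → ℝ
  /-- spectral mask -/
  pmax : Fin Q → Fin N → ℝ
  /-- local interference threshold -/
  Imax : Fin Q → ℝ
  /-- global interference threshold -/
  Itot : ℝ
  /-- upper bound on the missed detection probability -/
  alpha : Fin Q → Fin N → ℝ
  /-- upper bound on the false alarm probability -/
  beta : Fin Q → ℝ
  H_ne : ∀ q k, H q q k ≠ 0
  noise_pos : ∀ q k, 0 < noise q k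
  mu_lt : ∀ q k, mu0 q k < mu1 q k
  sd0_pos : ∀ q k, 0 < sd0 q k
  sd1_pos : ∀ q k, 0 < sd1 q k
  f_pos : ∀ q, 0 < f q
  tauMin_pos : ∀ q, 0 < tauMin q
  tau_lt : ∀ q, tauMin q < tauMax q
  tauMax_lt : ∀ q, tauMax q < T q
  P_pos : ∀ q, 0 < P q
  pmax_pos : ∀ q k, 0 < pmax q k
  Imax_pos : ∀ q, 0 < Imax q
  alpha_pos : ∀ q k, 0 < alpha q k
  alpha_le : ∀ q k, alpha q k ≤ 1 / 2
  beta_pos : ∀ q, 0 < beta q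
  beta_le : ∀ q, beta q ≤ 1 / 2

variable {Q N : ℕ} (S : System Q N)

/-! ### The game -/

/-- The squared modulus of the normalized channel `H_qr(k) / H_qq(k)`. -/
def Hsq (q r : Fin Q) (k : Fin N) : ℝ := ‖S.H q r k / S.H q q k‖ ^ 2

/-- The normalized noise power `σ̂²_{q,k} = σ²_{q,k} / |H_qq(k)|²`. -/
def nz (q : Fin Q) (k : Fin N) : ℝ := S.noise q k / ‖S.H q q k‖ ^ 2

/-- The interference weight `w_{q,k} = |G_q(k)|²`. -/
def gw (q : Fin Q) (k : Fin N) : ℝ := ‖S.G q k‖ ^ 2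

/-- The gap `μ_{q,k|1} - μ_{q,k|0}`. -/
def dmu (q : Fin Q) (k : Fin N) : ℝ := S.mu1 q k - S.mu0 q k

/-- Bounds on the normalized sensing time `τ̂ = √(τ f)`. -/
def tauHatMin (q : Fin Q) : ℝ := Real.sqrt (S.tauMin q * S.f q)

def tauHatMax (q : Fin Q) : ℝ := Real.sqrt (S.tauMax q * S.f q)

/-- `α̂_{q,k}`, the value of the inverse tail function at `1 - α_{q,k}`. -/
def alphaHat (q : Fin Q) (k : Fin N) : ℝ := Qinv (1 - S.alpha q k)

/-- The missed detection probability (one minus the detection probability) as a function of the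
normalized sensing time and of the false alarm probability. -/
def Pmiss (q : Fin Q) (k : Fin N) (tau pfa : ℝ) : ℝ :=
  1 - Qfun ((S.sd0 q k * Qinv pfa - dmu S q k * tau) / S.sd1 q k)

/-- The rate of user `q` over carrier `k`, for the power profile `p`. -/
def rateK (q : Fin Q) (k : Fin N) (p : Fin Q → Fin N → ℝ) : ℝ :=
  Real.log (1 + p q k / (nz S q k + ∑ r ∈ Finset.univ.erase q, Hsq S q r k * p r k))

/-- The sum rate of user `q`. -/
def rate (q : Fin Q) (p : Fin Q → Fin N → ℝ) : ℝ := ∑ k, rateK S q k p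

/-- The power component of a profile. -/
def power (x : Profile Q N) : Fin Q → Fin N → ℝ := fun q => (x q).2.1

/-- The opportunistic throughput of user `q`. -/
def throughput (q : Fin Q) (x : Profile Q N) : ℝ :=
  (1 - (x q).1 ^ 2 / (S.f q * S.T q)) * ∑ k, (1 - (x q).2.2) * rateK S q k (power x)

/-- The payoff `θ_q`: logarithm of the throughput, minus the equi-sensing penalty with
weight `c`. -/
def theta (c : ℝ) (q : Fin Q) (x : Profile Q N) : ℝ :=
  Real.log (throughput S q x) -
    c / 2 * ((x q).1 / Real.sqrt (S.f q) - 1 / (Q : ℝ) * ∑ r, (x r).1 / Real.sqrt (S.f r)) ^ 2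

/-- The local interference violation of a strategy of user `q`. -/
def localI (q : Fin Q) (z : Strategy N) : ℝ :=
  ∑ k, Pmiss S q k z.1 z.2.2 * gw S q k * z.2.1 k - S.Imax q

/-- The global interference violation. -/
def globalI (x : Profile Q N) : ℝ :=
  ∑ k, ∑ q, Pmiss S q k (x q).1 (x q).2.2 * gw S q k * (x q).2.1 k - S.Itot

/-- The power constraints of user `q`. -/
def powerSet (q : Fin Q) : Set (Fin N → ℝ) :=
  {p | ∑ k, p k ≤ S.P q ∧ ∀ k, 0 ≤ p k ∧ p k ≤ S.pmax q k}

/-- The convex part `𝒴_q` of the constraints of user `q`. The inequality `0 < P_fa` is the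
condition under which the inverse of the tail function is defined at `P_fa`. -/
def Yset (q : Fin Q) : Set (Strategy N) :=
  {z | 0 < z.2.2 ∧ z.2.2 ≤ S.beta q ∧
    (∀ k, S.sd0 q k / S.sd1 q k * Qinv z.2.2 - z.1 * (dmu S q k / S.sd1 q k) ≤ alphaHat S q k) ∧
    z.2.1 ∈ powerSet S q ∧ tauHatMin S q ≤ z.1 ∧ z.1 ≤ tauHatMax S q}

/-- The feasible set `𝒳_q` of user `q`. -/
def Xset (q : Fin Q) : Set (Strategy N) := {z | z ∈ Yset S q ∧ localI S q z ≤ 0}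

/-- The joint set `𝒴`. -/
def Yjoint : Set (Profile Q N) := {x | ∀ q, x q ∈ Yset S q}

/-- The objective of user `q` in the game with fixed price `π`. The logarithm of a vanishing
throughput is `-∞`. -/
def payoff (c price : ℝ) (q : Fin Q) (x : Profile Q N) : EReal :=
  if 0 < throughput S q x then ((theta S c q x - price * globalI S x : ℝ) : EReal) else ⊥

/-- The optimal solutions of the problem of user `q`, given the strategies of the others. It does
not depend on the `q`-th component of `x`. -/
def bestResponses (c price : ℝ) (q : Fin Q) (x : Profile Q N) : Set (Strategy N) :=
  {z | z ∈ Xset S q ∧ ∀ y ∈ Xset S q,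
    payoff S c price q (Function.update x q y) ≤ payoff S c price q (Function.update x q z)}

/-- Nash equilibria of the game with fixed price. -/
def IsNash (c price : ℝ) (x : Profile Q N) : Prop := ∀ q, x q ∈ bestResponses S c price q x

/-! ### Asynchronous best-response algorithms -/

/-- A feasible schedule: `U q` is the set of times at which user `q` updates his strategy, and
`d q r n ≤ n` is the time of the strategy of user `r` that is available to user `q` at time `n`.
Every user updates infinitely often, and old information is eventually discarded. -/
def IsSchedule (U : Fin Q → Set ℕ) (d : Fin Q → Fin Q → ℕ → ℕ) : Prop :=
  (∀ q, (U q).Infinite) ∧ (∀ q r n, d q r n ≤ n) ∧ ∀ q r, Tendsto (d q r) atTop atTop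

/-- `x` is generated by the asynchronous algorithm based on the map `B`. -/
def IsAsyncRun (B : Profile Q N → Profile Q N) (U : Fin Q → Set ℕ) (d : Fin Q → Fin Q → ℕ → ℕ)
    (x : ℕ → Profile Q N) : Prop :=
  ∀ n q, (n ∈ U q → x (n + 1) q = B (fun r => x (d q r n) r) q) ∧
    (n ∉ U q → x (n + 1) q = x n q)

/-! ### Auxiliary matrix and derivative notation -/

/-- The Euclidean norm of a finite family of reals. -/
def l2 {ι : Type} [Fintype ι] (v : ι → ℝ) : ℝ := Real.sqrt (∑ i, v i ^ 2)

/-- The least eigenvalue of a symmetric matrix. -/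
def leastEig {ι : Type} [Fintype ι] [DecidableEq ι] (A : Matrix ι ι ℝ) : ℝ :=
  sInf (spectrum ℝ A)

/-- The spectral norm. -/
def specNorm {ι : Type} [Fintype ι] [DecidableEq ι] (A : Matrix ι ι ℝ) : ℝ :=
  ‖Matrix.toEuclideanCLM (n := ι) (𝕜 := ℝ) A‖

/-- The second order partial derivative of `F` in the directions `u` and `v`. -/
def pd2 (F : Profile Q N → ℝ) (u v : Profile Q N) (x : Profile Q N) : ℝ :=
  lineDeriv ℝ (fun y => lineDeriv ℝ F y v) x u

/-- The coordinate direction of `τ̂_q`. -/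
def eTau (q : Fin Q) : Profile Q N := Pi.single q (1, 0, 0)

/-- The coordinate direction of `p_{q,k}`. -/
def ePow (q : Fin Q) (k : Fin N) : Profile Q N := Pi.single q (0, Pi.single k 1, 0)

/-- The coordinate direction of the false alarm probability of user `q`. -/
def eFa (q : Fin Q) : Profile Q N := Pi.single q (0, 0, 1)

/-- The coordinate directions of `(p_q, P_fa)`. -/
def ePF (q : Fin Q) : Fin N ⊕ Unit → Profile Q N := Sum.elim (ePow q) (fun _ => eFa q)

/-! ### Constants -/

/-- The minimal rate `r_q^min` per unit of power. -/
def rMin (q : Fin Q) : ℝ :=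
  ⨅ k, Real.log (1 + S.pmax q k /
    (nz S q k + ∑ r ∈ Finset.univ.erase q, Hsq S q r k * S.pmax r k)) / S.pmax q k

/-- The upper bound `r_q^max` on the sum rate. -/
def rMax (q : Fin Q) : ℝ := ∑ k, Real.log (1 + S.pmax q k / nz S q k)

/-- The upper bound `λ^max` on the multipliers of the local interference constraints. -/
def lamMax : ℝ :=
  ∑ q, (1 / ⨅ r, min (S.Imax r) (⨅ k, S.pmax r k)) / (rMin S q * ⨅ k, nz S q k)

/-- The reference false alarm probability. -/
def pfaRef (q : Fin Q) : ℝ :=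
  ⨆ k, Qfun ((S.sd1 q k * alphaHat S q k + dmu S q k * Real.sqrt (S.f q * S.tauMin q)) / S.sd0 q k)

/-- The constant `η_q^ref(t)` for the reference power allocations `pref`. -/
def etaRef (pref : Fin Q → Fin N → ℝ) (q : Fin Q) (t : ℝ) : ℝ :=
  Real.log (1 - S.tauMin q / S.T q) + Real.log (1 - pfaRef S q) +
    Real.log (rate S q (Function.update S.pmax q (pref q))) -
    t / 2 * ∑ k, gw S q k * pref q k

/-- The lower bound on the sum power of a best response of user `q`. -/
def powLow (pref : Fin Q → Fin N → ℝ) (q : Fin Q) (t : ℝ) : ℝ :=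
  (⨅ k, nz S q k) * Real.exp (etaRef S pref q t)

/-- The restriction `𝒴̂_q^t` of `𝒴_q` to power allocations above that lower bound. -/
def YhatSet (pref : Fin Q → Fin N → ℝ) (q : Fin Q) (t : ℝ) : Set (Strategy N) :=
  {z | z ∈ Yset S q ∧ powLow S pref q t ≤ ∑ k, z.2.1 k}

/-- The lower bound `r_q^low(t)` on the sum rate. -/
def rLow (pref : Fin Q → Fin N → ℝ) (q : Fin Q) (t : ℝ) : ℝ := powLow S pref q t * rMin S q

/-- The constant `ξ_q^sup(t)`. -/
def xiSup (pref : Fin Q → Fin N → ℝ) (q : Fin Q) (t : ℝ) : ℝ :=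
  1 / rLow S pref q t + 1 / rLow S pref q t * (1 / rMin S q) * l2 (fun k => 1 / nz S q k)

/-- Bound on the modulus of the derivative of the missed detection probability with respect
to `τ̂_q`. -/
def omTau (q : Fin Q) (k : Fin N) : ℝ := 1 / Real.sqrt (2 * Real.pi) * (dmu S q k / S.sd1 q k)

/-- Bound on the modulus of the derivative of the missed detection probability with respect to the
false alarm probability. -/
def omFa (q : Fin Q) (k : Fin N) : ℝ :=
  S.sd0 q k / S.sd1 q k * Real.exp ((dmu S q k / S.sd0 q k * tauHatMax S q) ^ 2 / 2)

/-- Bound on the modulus of the mixed second derivative of the missed detection probability. -/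
def omTauFa (q : Fin Q) (k : Fin N) : ℝ :=
  dmu S q k * S.sd0 q k / S.sd1 q k ^ 2 *
    max (Qinv (S.alpha q k)) (dmu S q k / S.sd1 q k * tauHatMax S q) *
    Real.exp ((dmu S q k / S.sd0 q k * tauHatMax S q) ^ 2 / 2)

/-- Lower bound on the second derivative of `-θ_q` (without penalty) with respect to `τ̂_q`. -/
def dTau (q : Fin Q) : ℝ :=
  2 / (S.f q * S.T q) * (1 + S.tauMin q / S.T q) / (1 - S.tauMin q / S.T q) ^ 2

/-- Lower bound for the power block of the Hessian of `-θ_q`. -/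
def dRate (q : Fin Q) (k : Fin N) : ℝ :=
  1 / rMax S q / (nz S q k + ∑ r, Hsq S q r k * S.pmax r k) ^ 2

/-- Lower bound on the false alarm probability. -/
def pfaMin (q : Fin Q) : ℝ := ⨅ k, Qfun (dmu S q k * tauHatMax S q / S.sd0 q k)

/-- Lower bound on the second derivative of `-θ_q` with respect to the false alarm probability. -/
def dFa (q : Fin Q) : ℝ := 1 / (1 - pfaMin S q) ^ 2

/-- The factor `2 max{t, λ^max} max_k |G_q(k)|²`. -/
def cross (q : Fin Q) (t : ℝ) : ℝ := 2 * max t (lamMax S) * ⨆ k, gw S q k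

/-- The lower right block, for the coordinates `(p_q, P_fa)`, of the comparison matrix of the
Hessian of the Lagrangian of user `q`. -/
def LbarBlock (q : Fin Q) (t : ℝ) : Matrix (Fin N ⊕ Unit) (Fin N ⊕ Unit) ℝ :=
  Matrix.fromBlocks
    (Matrix.diagonal (dRate S q))
    (Matrix.of fun k _ => -(cross S q t * (2 * omFa S q k)))
    (Matrix.of fun _ k => -(cross S q t * (2 * omFa S q k)))
    (Matrix.of fun _ _ => dFa S q)

/-- The constant `ς_q^up(t)`. -/
def varsigmaUp (q : Fin Q) (t : ℝ) : ℝ :=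
  cross S q t *
    l2 (Sum.elim (omTau S q) (fun _ : Unit => ∑ k, omTauFa S q k * S.pmax q k))

/-- The comparison matrix `B_q^low`. -/
def Blow (q : Fin Q) (t : ℝ) : Matrix (Fin 2) (Fin 2) ℝ :=
  !![dTau S q, -varsigmaUp S q t; -varsigmaUp S q t, leastEig (LbarBlock S q t)]

/-- `ρ_q^low(t)`: the positive part of the least eigenvalue of `B_q^low`. -/
def rhoLow (q : Fin Q) (t : ℝ) : ℝ := max (leastEig (Blow S q t)) 0

/-- The diagonal matrix with squared entries `ρ + c ((1 - 1/Q) / √f_q)²` and `ρ`. -/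
def Ddiag (c : ℝ) (q : Fin Q) (rho : ℝ) : Matrix (Fin 2) (Fin 2) ℝ :=
  Matrix.diagonal
    ![Real.sqrt (rho + c * ((1 - 1 / (Q : ℝ)) / Real.sqrt (S.f q)) ^ 2), Real.sqrt rho]

/-- The upper bound `E_qr^sup` on the matrix of cross derivatives. -/
def Esup (pref : Fin Q → Fin N → ℝ) (c t : ℝ) (q r : Fin Q) : Matrix (Fin 2) (Fin 2) ℝ :=
  Matrix.diagonal
    ![c * ((1 - 1 / (Q : ℝ)) / Real.sqrt (S.f q)) * ((1 / (Q : ℝ)) / Real.sqrt (S.f r)),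
      (⨆ k, Hsq S q r k / nz S q k ^ 2) * xiSup S pref q t]

/-- The coefficients `β_qr^up(t, c)`. The inverses exist when `ρ_q^low(t)` and `ρ_r^low(t)` are
positive. -/
def betaUp (pref : Fin Q → Fin N → ℝ) (c t : ℝ) (q r : Fin Q) : ℝ :=
  specNorm ((Ddiag S c q (rhoLow S q t))⁻¹ * Esup S pref c t q r *
    (Ddiag S c r (rhoLow S r t))⁻¹)

/-! ### The matrix `Γ(t)` and the block norm -/

/-- The Lagrangian of user `q`. -/
def lagr (c price lam : ℝ) (q : Fin Q) (x : Profile Q N) : ℝ :=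
  -theta S c q x + lam * localI S q (x q) + price * globalI S x

/-- The matrix `B_q(x, λ_q, π)`. The penalty enters the Hessian of the Lagrangian with respect to
the variables of user `q` only through the second derivative in `τ̂_q`, where it is taken
with `c = 0`; so `c = 0` in all entries. -/
def Bmat (price lam : ℝ) (q : Fin Q) (x : Profile Q N) : Matrix (Fin 2) (Fin 2) ℝ :=
  !![pd2 (lagr S 0 price lam q) (eTau q) (eTau q) x,
      -l2 (fun i => pd2 (lagr S 0 price lam q) (eTau q) (ePF q i) x);
    -l2 (fun i => pd2 (lagr S 0 price lam q) (ePF q i) (eTau q) x),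
      leastEig (Matrix.of fun i j => pd2 (lagr S 0 price lam q) (ePF q i) (ePF q j) x)]

/-- `ρ_q(t)`: the positive part of the minimum of the least eigenvalues of the `B_q`. -/
def rho (pref : Fin Q → Fin N → ℝ) (q : Fin Q) (t : ℝ) : ℝ :=
  max (sInf {m | ∃ (x : Profile Q N) (lam price : ℝ), x q ∈ YhatSet S pref q t ∧
    (∀ r, r ≠ q → x r ∈ Yset S r) ∧ lam ∈ Set.Icc 0 (lamMax S) ∧ price ∈ Set.Icc 0 t ∧
    m = leastEig (Bmat S price lam q x)}) 0

/-- The matrix `D_q(t, c)`. -/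
def Dmat (pref : Fin Q → Fin N → ℝ) (c t : ℝ) (q : Fin Q) : Matrix (Fin 2) (Fin 2) ℝ :=
  Ddiag S c q (rho S pref q t)

/-- The matrix `E_qr(x)`. -/
def Emat (c : ℝ) (q r : Fin Q) (x : Profile Q N) : Matrix (Fin 2) (Fin 2) ℝ :=
  Matrix.diagonal
    ![|pd2 (theta S c q) (eTau q) (eTau r) x|,
      specNorm (Matrix.of fun i j => pd2 (theta S c q) (ePow q i) (ePow r j) x)]

/-- `β_qr(t, c)`. -/
def betaCoef (pref : Fin Q → Fin N → ℝ) (c t : ℝ) (q r : Fin Q) : ℝ :=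
  sSup {m | ∃ x : Profile Q N, x q ∈ YhatSet S pref q t ∧ (∀ s, s ≠ q → x s ∈ Yset S s) ∧
    m = specNorm ((Dmat S pref c t q)⁻¹ * Emat S c q r x * (Dmat S pref c t r)⁻¹)}

/-- The matrix `Γ(t)`. -/
def Gam (pref : Fin Q → Fin N → ℝ) (c t : ℝ) : Matrix (Fin Q) (Fin Q) ℝ :=
  Matrix.of fun q r => if r = q then 1 else -betaCoef S pref c t q r

/-- The norm `‖(|τ̂|, ‖(p, P_fa)‖)‖_{D_q(t, c)²}` on the strategies of user `q`. -/
def userNorm (pref : Fin Q → Fin N → ℝ) (c t : ℝ) (q : Fin Q) (z : Strategy N) : ℝ :=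
  l2 ((Dmat S pref c t q).mulVec
    ![|z.1|, l2 (Sum.elim z.2.1 (fun _ : Unit => z.2.2))])

/-- The block-maximum norm with weights `w`. -/
def blockNorm (pref : Fin Q → Fin N → ℝ) (c t : ℝ) (w : Fin Q → ℝ) (y : Profile Q N) : ℝ :=
  ⨆ q, userNorm S pref c t q (y q) / w q

/-- `B` is a block-contraction on `𝒴`: it contracts for a block-maximum norm whose blocks carry
the norms defined by the positive definite matrices `D_q(t, c)²`. -/
def IsBlockContraction (pref : Fin Q → Fin N → ℝ) (c t : ℝ)
    (B : Profile Q N → Profile Q N) : Prop :=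
  (∀ q, 0 < rho S pref q t) ∧
  ∃ w : Fin Q → ℝ, (∀ q, 0 < w q) ∧ ∃ κ : ℝ, 0 ≤ κ ∧ κ < 1 ∧
    ∀ x ∈ Yjoint S, ∀ y ∈ Yjoint S,
      blockNorm S pref c t w (B x - B y) ≤ κ * blockNorm S pref c t w (x - y)

/-- Low received multi-user interference. -/
def LowReceived (pref : Fin Q → Fin N → ℝ) (c t : ℝ) : Prop :=
  ∀ q, ∑ r ∈ Finset.univ.erase q, betaUp S pref c t q r < 1

/-- Low transmitted multi-user interference. -/
def LowTransmitted (pref : Fin Q → Fin N → ℝ) (c t : ℝ) : Prop :=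
  ∀ r, ∑ q ∈ Finset.univ.erase r, betaUp S pref c t q r < 1

end CogRadio

end

/-! Each user's problem is nonconvex, but every optimal solution lies in a convex set on which the
Lagrangian is strongly convex, uniformly in the relevant multipliers. This gives uniqueness and a
Lipschitz bound for the best response at the same time.

Localization. If the total power of a strategy is below `powLow`, replacing its powers by the
reference allocation, with sensing time and false alarm probability kept, strictly raises the payoff
(`payoff_lt_ref`). The rate is at most total power over least noise, while the reference rate is
bounded below whatever the others do. Best responses therefore lie in `YhatSet`, where throughput is
positive and the payoff is smooth; compactness gives existence.

Curvature. For arguments in `Yset`, the bounds `alpha ≤ 1/2` and `beta ≤ 1/2` fix the signs that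
make the missed detection probability convex in sensing time and false alarm probability. The only
uncontrolled Hessian terms are then cross terms, bounded by explicit constants. Comparison of
quadratic forms yields `rhoLow ≤ rho`, and `rho` bounds from below the Hessian of the Lagrangian in
the own variables (`leastEig_Blow_le_leastEig_Bmat`, `leastEig_Bmat_mul_le`). Adding the curvature
of the sensing penalty turns this bound into exactly `userNorm ^ 2` (`lagr_strongly_convex`).

Multipliers. A best response satisfies first order conditions with one multiplier. Testing them in
the direction that halves all powers bounds it by `lamMax` (`exists_multiplier_of_bestResponse`), so
the curvature bound applies.

Lipschitz bound. Let `z`, `z'` be best responses to `x`, `x'`. Strong convexity of each Lagrangian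
at its own solution, evaluated at the other one, gives two inequalities. In their sum the linear
terms have a sign, the multiplier terms have a sign by complementarity and feasibility, and the
price terms cancel because global interference is separable. What remains bounds `userNorm (z' - z)
^ 2` by a mixed second difference of `theta` (`userNorm_sq_le_mixed`). For `x = x'` this difference
is zero, which is uniqueness. In general the mean value theorem turns it into a cross derivative,
bounded through `betaCoef ≤ betaUp` (`userNorm_bestResponse_sub_le`).

Contraction. A nonnegative matrix with row sums or column sums below one contracts some weighted
maximum norm (`exists_weights`). Banach iteration gives the fixed point, and uniqueness of best
responses identifies it with the only Nash equilibrium. Nested boxes around it, shrinking by `κ`,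
give asynchronous convergence (`BoxContraction.tendsto_async`). -/

noncomputable section
namespace CogRadio

/-! ### The Gaussian tail function and its inverse -/

/-- The standard Gaussian density. -/
def gaussDens (x : ℝ) : ℝ := 1 / Real.sqrt (2 * Real.pi) * Real.exp (-x ^ 2 / 2)

theorem gaussDens_pos (x : ℝ) : 0 < gaussDens x := by
  unfold gaussDens; positivity

theorem contDiff_gaussDens {n : WithTop ℕ∞} : ContDiff ℝ n gaussDens := by
  unfold gaussDens; fun_prop

theorem hasDerivAt_gaussDens (x : ℝ) : HasDerivAt gaussDens (-(x * gaussDens x)) x := by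
  unfold gaussDens
  have h : HasDerivAt (fun x : ℝ => -x ^ 2 / 2) (-x) x := by
    have := ((hasDerivAt_pow 2 x).neg).div_const 2
    exact this.congr_deriv (by norm_num; ring)
  exact (h.exp.const_mul _).congr_deriv (by ring)

theorem gaussDens_le (x : ℝ) : gaussDens x ≤ 1 / Real.sqrt (2 * Real.pi) := by
  unfold gaussDens
  have h : Real.exp (-x ^ 2 / 2) ≤ 1 := Real.exp_le_one_iff.2 (by nlinarith [sq_nonneg x])
  have : (0 : ℝ) ≤ 1 / Real.sqrt (2 * Real.pi) := by positivity
  nlinarith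

theorem gaussDens_div (a b : ℝ) :
    gaussDens a / gaussDens b = Real.exp ((b ^ 2 - a ^ 2) / 2) := by
  have h : 0 < Real.sqrt (2 * Real.pi) := by positivity
  unfold gaussDens
  rw [mul_div_mul_left _ _ (by positivity), ← Real.exp_sub]
  congr 1; ring

theorem integrable_exp_neg_sq_half : Integrable fun u : ℝ => Real.exp (-u ^ 2 / 2) := by
  have := integrable_exp_neg_mul_sq (b := 1 / 2) (by norm_num)
  refine this.congr (ae_of_all _ fun u => ?_)
  simp only []
  congr 1; ring

/-- A fixed base point makes the fundamental theorem of calculus applicable, and the limit at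
infinity immediate. -/
theorem Qfun_eq : Qfun = fun y => 1 / Real.sqrt (2 * Real.pi) *
    ((∫ u in Set.Ioi (0 : ℝ), Real.exp (-u ^ 2 / 2)) -
      ∫ u in (0 : ℝ)..y, Real.exp (-u ^ 2 / 2)) := by
  have hi := integrable_exp_neg_sq_half
  funext y
  unfold Qfun
  rw [← intervalIntegral.integral_Ioi_sub_Ioi' hi.integrableOn hi.integrableOn]
  ring

theorem hasDerivAt_Qfun (x : ℝ) : HasDerivAt Qfun (-gaussDens x) x := by
  have hi := integrable_exp_neg_sq_half
  have hc : Continuous fun u : ℝ => Real.exp (-u ^ 2 / 2) := by fun_prop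
  have h1 : HasDerivAt (fun y => ∫ u in (0 : ℝ)..y, Real.exp (-u ^ 2 / 2))
      (Real.exp (-x ^ 2 / 2)) x :=
    intervalIntegral.integral_hasDerivAt_right hi.intervalIntegrable
      (hc.stronglyMeasurableAtFilter _ _) hc.continuousAt
  rw [Qfun_eq]
  exact ((h1.const_sub _).const_mul _).congr_deriv (by unfold gaussDens; ring)

theorem deriv_Qfun : deriv Qfun = fun x => -gaussDens x :=
  funext fun x => (hasDerivAt_Qfun x).deriv

theorem differentiable_Qfun : Differentiable ℝ Qfun := fun x => (hasDerivAt_Qfun x).differentiableAt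

theorem contDiff_Qfun : ContDiff ℝ 2 Qfun := by
  rw [show (2 : WithTop ℕ∞) = 1 + 1 by norm_num, contDiff_succ_iff_deriv]
  refine ⟨differentiable_Qfun, by simp, ?_⟩
  rw [deriv_Qfun]
  exact contDiff_gaussDens.neg

theorem continuous_Qfun : Continuous Qfun := differentiable_Qfun.continuous

theorem Qfun_strictAnti : StrictAnti Qfun := by
  refine strictAnti_of_deriv_neg fun x => ?_
  rw [deriv_Qfun]
  simpa using gaussDens_pos x

theorem Qfun_add_neg (x : ℝ) : Qfun x + Qfun (-x) = 1 := by
  have hi := integrable_exp_neg_sq_half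
  have h1 : (∫ u in Set.Ioi (-x), Real.exp (-u ^ 2 / 2)) =
      ∫ u in Set.Iic x, Real.exp (-u ^ 2 / 2) := by
    have := integral_comp_neg_Ioi (-x) (fun u : ℝ => Real.exp (-u ^ 2 / 2))
    simpa using this
  have h2 := intervalIntegral.integral_Iic_add_Ioi (b := x) hi.integrableOn hi.integrableOn
  have h3 : (∫ u : ℝ, Real.exp (-u ^ 2 / 2)) = Real.sqrt (2 * Real.pi) := by
    have := integral_gaussian (1 / 2)
    rw [show Real.pi / (1 / 2) = 2 * Real.pi by ring] at this
    rw [← this]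
    congr 1; funext u; congr 1; ring
  have h4 : 0 < Real.sqrt (2 * Real.pi) := by positivity
  unfold Qfun
  rw [h1, ← mul_add, add_comm, h2, h3]
  field_simp

theorem Qfun_nonneg (x : ℝ) : 0 ≤ Qfun x := by
  unfold Qfun
  exact mul_nonneg (by positivity) (integral_nonneg fun u => (Real.exp_pos _).le)

theorem Qfun_pos (x : ℝ) : 0 < Qfun x :=
  (Qfun_nonneg (x + 1)).trans_lt (Qfun_strictAnti (by linarith))

theorem Qfun_lt_one (x : ℝ) : Qfun x < 1 := by
  linarith [Qfun_add_neg x, Qfun_pos (-x)]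

theorem Qfun_zero : Qfun 0 = 1 / 2 := by
  have := Qfun_add_neg 0
  rw [neg_zero] at this
  linarith

theorem tendsto_Qfun_atTop : Tendsto Qfun atTop (𝓝 0) := by
  have hi := integrable_exp_neg_sq_half
  have h1 := intervalIntegral_tendsto_integral_Ioi 0 hi.integrableOn tendsto_id
  rw [Qfun_eq]
  have := (h1.const_sub (∫ u in Set.Ioi (0 : ℝ), Real.exp (-u ^ 2 / 2))).const_mul
    (1 / Real.sqrt (2 * Real.pi))
  simpa using this

theorem exists_Qfun_eq {y : ℝ} (h0 : 0 < y) (h1 : y < 1) : ∃ x, Qfun x = y := by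
  obtain ⟨a, ha⟩ := (tendsto_Qfun_atTop.eventually (gt_mem_nhds h0)).exists
  obtain ⟨b, hb⟩ := (tendsto_Qfun_atTop.eventually
    (gt_mem_nhds (show 0 < 1 - y by linarith))).exists
  -- By the reflection identity `Qfun_add_neg`, a tail below `1 - y` at `b` is a tail above `y` at
  -- `-b`, so no limit at minus infinity is needed.
  exact mem_range_of_exists_le_of_exists_ge continuous_Qfun ⟨a, ha.le⟩
    ⟨-b, by linarith [Qfun_add_neg b]⟩

theorem Qinv_Qfun (x : ℝ) : Qinv (Qfun x) = x :=
  Function.leftInverse_invFun Qfun_strictAnti.injective x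

theorem Qfun_Qinv {y : ℝ} (h0 : 0 < y) (h1 : y < 1) : Qfun (Qinv y) = y :=
  Function.invFun_eq (exists_Qfun_eq h0 h1)

theorem Qinv_le_iff {y x : ℝ} (h0 : 0 < y) (h1 : y < 1) : Qinv y ≤ x ↔ Qfun x ≤ y := by
  rw [← Qfun_strictAnti.le_iff_ge, Qfun_Qinv h0 h1]

theorem Qinv_nonneg {y : ℝ} (h0 : 0 < y) (h1 : y ≤ 1 / 2) : 0 ≤ Qinv y := by
  rw [← Qfun_strictAnti.le_iff_ge, Qfun_Qinv h0 (by linarith), Qfun_zero]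
  exact h1

theorem Qinv_nonpos {y : ℝ} (h0 : 1 / 2 ≤ y) (h1 : y < 1) : Qinv y ≤ 0 := by
  rw [← Qfun_strictAnti.le_iff_ge, Qfun_Qinv (by linarith) h1, Qfun_zero]
  exact h0

/-- `Qinv` is a choice function, so its smoothness is borrowed from the inverse function theorem:
the local inverse is a right inverse of `Qfun` near `y`, and `Qinv` is a global left inverse, so the
two agree there. -/
theorem Qinv_eventuallyEq {y : ℝ} (h0 : 0 < y) (h1 : y < 1) :
    ∃ g : ℝ → ℝ, Qinv =ᶠ[𝓝 y] g ∧ ContDiffAt ℝ 2 g y := by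
  have hd := hasDerivAt_Qfun (Qinv y)
  have hne : -gaussDens (Qinv y) ≠ 0 := (neg_neg_of_pos (gaussDens_pos _)).ne
  have hc : ContDiffAt ℝ 2 Qfun (Qinv y) := contDiff_Qfun.contDiffAt
  let e : ℝ ≃L[ℝ] ℝ := ContinuousLinearEquiv.unitsEquivAut ℝ (Units.mk0 _ hne)
  have hf : HasFDerivAt Qfun (e : ℝ →L[ℝ] ℝ) (Qinv y) := hd.hasFDerivAt_equiv hne
  refine ⟨hc.localInverse hf (by norm_num), ?_, ?_⟩
  · have hs := hc.hasStrictFDerivAt' hf (by norm_num)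
    have := hs.eventually_right_inverse
    rw [Qfun_Qinv h0 h1] at this
    filter_upwards [this] with z hz
    have h2 := congrArg Qinv hz
    rw [Qinv_Qfun] at h2
    exact h2.symm
  · have := hc.to_localInverse hf (by norm_num)
    rwa [Qfun_Qinv h0 h1] at this

theorem contDiffAt_Qinv {y : ℝ} (h0 : 0 < y) (h1 : y < 1) : ContDiffAt ℝ 2 Qinv y := by
  obtain ⟨g, hg, hc⟩ := Qinv_eventuallyEq h0 h1
  exact hc.congr_of_eventuallyEq hg

theorem hasDerivAt_Qinv {y : ℝ} (h0 : 0 < y) (h1 : y < 1) :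
    HasDerivAt Qinv (-(gaussDens (Qinv y))⁻¹) y := by
  have hne : -gaussDens (Qinv y) ≠ 0 := (neg_neg_of_pos (gaussDens_pos _)).ne
  have := HasDerivAt.of_local_left_inverse (f := Qfun) (g := Qinv) (a := y)
    (contDiffAt_Qinv h0 h1).continuousAt (hasDerivAt_Qfun _) hne
    (by filter_upwards [lt_mem_nhds h0, gt_mem_nhds h1] with z hz hz' using Qfun_Qinv hz hz')
  exact this.congr_deriv (inv_neg)

/-- Minus the Gaussian density increases on the positive half-line. The half-line suffices because
false alarm probabilities are at most one half; this yields convexity of `Yset`. -/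
theorem convexOn_Qfun : ConvexOn ℝ (Set.Ici 0) Qfun := by
  refine MonotoneOn.convexOn_of_deriv (convex_Ici 0) continuous_Qfun.continuousOn
    differentiable_Qfun.differentiableOn ?_
  rw [deriv_Qfun, interior_Ici]
  intro x hx y hy hxy
  have hx : 0 < x := hx
  simp only [neg_le_neg_iff]
  unfold gaussDens
  gcongr

end CogRadio
end

/-! ### Euclidean norms, least eigenvalues and spectral norms -/

noncomputable section
namespace CogRadio

section LinearAlgebra

variable {ι : Type} [Fintype ι]

theorem l2_nonneg (v : ι → ℝ) : 0 ≤ l2 v := Real.sqrt_nonneg _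

theorem l2_sq (v : ι → ℝ) : l2 v ^ 2 = ∑ i, v i ^ 2 :=
  Real.sq_sqrt (Finset.sum_nonneg fun _ _ => sq_nonneg _)

theorem l2_eq_norm (v : ι → ℝ) : l2 v = ‖(WithLp.toLp 2 v : EuclideanSpace ℝ ι)‖ := by
  simp [l2, EuclideanSpace.norm_eq]

theorem l2_mono {u v : ι → ℝ} (h : ∀ i, |u i| ≤ |v i|) : l2 u ≤ l2 v :=
  Real.sqrt_le_sqrt (Finset.sum_le_sum fun i _ => sq_le_sq.2 (h i))

theorem l2_smul (a : ℝ) (v : ι → ℝ) : l2 (fun i => a * v i) = |a| * l2 v := by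
  unfold l2
  rw [← Real.sqrt_sq_eq_abs, ← Real.sqrt_mul (sq_nonneg a), Finset.mul_sum]
  simp only [mul_pow]

theorem l2_le_sum (v : ι → ℝ) (h : ∀ i, 0 ≤ v i) : l2 v ≤ ∑ i, v i := by
  have : l2 v ^ 2 ≤ (∑ i, v i) ^ 2 := by
    rw [l2_sq]
    exact Finset.sum_sq_le_sq_sum_of_nonneg fun i _ => h i
  exact (abs_le_of_sq_le_sq' this (Finset.sum_nonneg fun i _ => h i)).2

theorem abs_sum_mul_le_l2 (u v : ι → ℝ) : |∑ i, u i * v i| ≤ l2 u * l2 v := by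
  have h := abs_real_inner_le_norm (WithLp.toLp 2 v : EuclideanSpace ℝ ι) (WithLp.toLp 2 u)
  rw [← l2_eq_norm, ← l2_eq_norm, mul_comm] at h
  simpa [PiLp.inner_apply] using h

theorem l2_sumElim_sq {κ : Type} [Fintype κ] (u : ι → ℝ) (v : κ → ℝ) :
    l2 (Sum.elim u v) ^ 2 = l2 u ^ 2 + l2 v ^ 2 := by
  simp [l2_sq]

theorem l2_unit (a : ℝ) : l2 (fun _ : Unit => a) = |a| := by
  simp [l2, Real.sqrt_sq_eq_abs]

open Matrix in
-- Subtracting `leastEig A` from the diagonal shifts the spectrum to the nonnegative half-line, so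
-- the shifted matrix is positive semidefinite. The infimum is a true lower bound because the
-- spectrum is finite.
theorem leastEig_mul_le [DecidableEq ι] {A : Matrix ι ι ℝ} (hA : A.IsHermitian) (v : ι → ℝ) :
    leastEig A * ∑ i, v i ^ 2 ≤ v ⬝ᵥ A *ᵥ v := by
  have hB : (A - algebraMap ℝ (Matrix ι ι ℝ) (leastEig A)).IsHermitian := by
    refine hA.sub ?_
    rw [Algebra.algebraMap_eq_smul_one]
    exact Matrix.isHermitian_one.smul (IsSelfAdjoint.all _)
  have hP : (A - algebraMap ℝ (Matrix ι ι ℝ) (leastEig A)).PosSemidef := by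
    rw [hB.posSemidef_iff_eigenvalues_nonneg]
    intro i
    have h1 := hB.eigenvalues_mem_spectrum_real i
    have h2 : hB.eigenvalues i + leastEig A ∈ spectrum ℝ A := by
      have := spectrum.add_mem_add_iff (r := hB.eigenvalues i)
        (a := A - algebraMap ℝ (Matrix ι ι ℝ) (leastEig A)) (s := leastEig A)
      rw [add_sub_cancel] at this
      rw [add_comm]
      rw [← this] at h1
      simpa [add_comm] using h1
    have h3 : BddBelow (spectrum ℝ A) := by
      rw [hA.spectrum_real_eq_range_eigenvalues]
      exact (Set.finite_range _).bddBelow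
    have h4 := csInf_le h3 h2
    change leastEig A ≤ _ at h4
    simp only [Pi.zero_apply]
    linarith
  have h := hP.re_dotProduct_nonneg v
  simp only [star_trivial, RCLike.re_to_real, sub_mulVec, dotProduct_sub,
    Algebra.algebraMap_eq_smul_one, smul_mulVec, one_mulVec, dotProduct_smul, smul_eq_mul] at h
  have : v ⬝ᵥ v = ∑ i, v i ^ 2 := by simp [dotProduct, sq]
  rw [this] at h
  linarith

open Matrix in
-- Each eigenvalue is the value of the form at a unit eigenvector. A nonempty index type excludes
-- the default value `sInf ∅ = 0`.
theorem le_leastEig [DecidableEq ι] [Nonempty ι] {A : Matrix ι ι ℝ} (hA : A.IsHermitian) {m : ℝ}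
    (h : ∀ v : ι → ℝ, m * ∑ i, v i ^ 2 ≤ v ⬝ᵥ A *ᵥ v) : m ≤ leastEig A := by
  unfold leastEig
  rw [hA.spectrum_real_eq_range_eigenvalues]
  refine le_csInf (Set.range_nonempty _) ?_
  rintro _ ⟨i, rfl⟩
  have h1 := h (hA.eigenvectorBasis i)
  have h2 := hA.eigenvalues_eq i
  have h3 : ∑ j, (hA.eigenvectorBasis i) j ^ 2 = 1 := by
    have := EuclideanSpace.real_norm_sq_eq (hA.eigenvectorBasis i)
    rw [hA.eigenvectorBasis.orthonormal.1 i] at this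
    simpa using this.symm
  rw [h3, mul_one] at h1
  simpa [h2] using h1

theorem specNorm_nonneg [DecidableEq ι] (A : Matrix ι ι ℝ) : 0 ≤ specNorm A := norm_nonneg _

open Matrix in
theorem l2_mulVec_le [DecidableEq ι] (A : Matrix ι ι ℝ) (v : ι → ℝ) :
    l2 (A *ᵥ v) ≤ specNorm A * l2 v := by
  simp only [l2_eq_norm, ← Matrix.toEuclideanCLM_toLp]
  exact ContinuousLinearMap.le_opNorm _ _

open Matrix in
theorem abs_bilin_le_specNorm [DecidableEq ι] (A : Matrix ι ι ℝ) (u v : ι → ℝ) :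
    |u ⬝ᵥ A *ᵥ v| ≤ specNorm A * l2 u * l2 v := by
  refine (abs_sum_mul_le_l2 _ _).trans ?_
  rw [mul_comm (specNorm A), mul_assoc]
  exact mul_le_mul_of_nonneg_left (l2_mulVec_le A v) (l2_nonneg u)

open Matrix in
theorem specNorm_le [DecidableEq ι] {A : Matrix ι ι ℝ} {C : ℝ} (hC : 0 ≤ C)
    (h : ∀ u v : ι → ℝ, |u ⬝ᵥ A *ᵥ v| ≤ C * l2 u * l2 v) : specNorm A ≤ C := by
  refine ContinuousLinearMap.opNorm_le_bound _ hC fun x => ?_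
  -- The test vector `u = A v` turns the bilinear bound into a bound on the squared norm of `A v`,
  -- and one factor is then divided out.
  have h1 := h (A *ᵥ x.ofLp) x.ofLp
  have h2 : (A *ᵥ x.ofLp) ⬝ᵥ (A *ᵥ x.ofLp) = l2 (A *ᵥ x.ofLp) ^ 2 := by
    rw [l2_sq]
    simp [dotProduct, sq]
  rw [h2, abs_of_nonneg (sq_nonneg _)] at h1
  have h3 : l2 (A *ᵥ x.ofLp) ≤ C * l2 x.ofLp := by
    rcases (l2_nonneg (A *ᵥ x.ofLp)).eq_or_lt with h0 | h0
    · rw [← h0]; exact mul_nonneg hC (l2_nonneg _)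
    · nlinarith
  rw [l2_eq_norm, l2_eq_norm] at h3
  exact h3

theorem abs_le_specNorm_diagonal [DecidableEq ι] (d : ι → ℝ) (i : ι) :
    |d i| ≤ specNorm (Matrix.diagonal d) := by
  have : specNorm (Matrix.diagonal d) = ‖d‖ := Matrix.l2_opNorm_diagonal d
  rw [this]
  exact norm_le_pi_norm d i

theorem specNorm_diagonal_le [DecidableEq ι] {d : ι → ℝ} {C : ℝ} (hC : 0 ≤ C)
    (h : ∀ i, |d i| ≤ C) : specNorm (Matrix.diagonal d) ≤ C := by
  have : specNorm (Matrix.diagonal d) = ‖d‖ := Matrix.l2_opNorm_diagonal d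
  rw [this]
  exact (pi_norm_le_iff_of_nonneg hC).2 h

end LinearAlgebra

/-- The quadratic form of a symmetric `2 × 2` matrix with nonpositive off-diagonal entries. -/
theorem quadForm_fin_two (a b d x y : ℝ) :
    dotProduct ![x, y] ((!![a, -b; -b, d] : Matrix (Fin 2) (Fin 2) ℝ).mulVec ![x, y]) =
      a * x ^ 2 - 2 * b * (x * y) + d * y ^ 2 := by
  simp [Matrix.mulVec, dotProduct, Fin.sum_univ_two]
  ring

theorem isHermitian_fin_two (a b d : ℝ) :
    (!![a, -b; -b, d] : Matrix (Fin 2) (Fin 2) ℝ).IsHermitian := by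
  ext i j
  fin_cases i <;> fin_cases j <;> simp

theorem leastEig_fin_two_mul_le (a b d x y : ℝ) :
    leastEig (!![a, -b; -b, d] : Matrix (Fin 2) (Fin 2) ℝ) * (x ^ 2 + y ^ 2) ≤
      a * x ^ 2 - 2 * b * (x * y) + d * y ^ 2 := by
  have := leastEig_mul_le (isHermitian_fin_two a b d) ![x, y]
  rw [quadForm_fin_two] at this
  simpa [Fin.sum_univ_two] using this

/-- At `(|v 0|, |v 1|)` the off-diagonal term of the first matrix takes its worst sign, so the first
form there lies below the second form at `v`. This is how entrywise estimates become eigenvalue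
estimates. -/
theorem leastEig_fin_two_mono {a b d a' b' d' : ℝ} (ha : a ≤ a') (hb : |b'| ≤ b) (hd : d ≤ d') :
    leastEig (!![a, -b; -b, d] : Matrix (Fin 2) (Fin 2) ℝ) ≤
      leastEig (!![a', -b'; -b', d'] : Matrix (Fin 2) (Fin 2) ℝ) := by
  refine le_leastEig (isHermitian_fin_two a' b' d') fun v => ?_
  have hv : v = ![v 0, v 1] := by ext i; fin_cases i <;> rfl
  rw [hv, quadForm_fin_two]
  have h := leastEig_fin_two_mul_le a b d |v 0| |v 1|
  simp only [sq_abs] at h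
  have h1 : b' * (v 0 * v 1) ≤ b * (|v 0| * |v 1|) := by
    refine (le_abs_self _).trans ?_
    rw [abs_mul, abs_mul]
    exact mul_le_mul_of_nonneg_right hb (by positivity)
  simp only [Fin.sum_univ_two, Matrix.cons_val_zero, Matrix.cons_val_one]
  nlinarith [mul_le_mul_of_nonneg_right ha (sq_nonneg (v 0)),
    mul_le_mul_of_nonneg_right hd (sq_nonneg (v 1))]

end CogRadio
end

/-! ### Second derivatives along lines, and a multiplier rule -/

noncomputable section
namespace CogRadio

section SecondDerivatives

variable {E : Type*} [NormedAddCommGroup E] [NormedSpace ℝ E]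

theorem tendsto_line (x u : E) : Tendsto (fun s : ℝ => x + s • u) (𝓝 0) (𝓝 x) := by
  have : Continuous fun s : ℝ => x + s • u := by fun_prop
  simpa using this.tendsto 0

theorem lineDeriv_congr_of_eventuallyEq {f g : E → ℝ} {x : E} (h : f =ᶠ[𝓝 x] g) (u : E) :
    lineDeriv ℝ f x u = lineDeriv ℝ g x u :=
  (h.comp_tendsto (tendsto_line x u)).deriv_eq

/-- Being of class `C²` at `x` gives differentiability on a neighbourhood, where the inner line
derivative equals the Fréchet derivative; the outer derivative depends only on that neighbourhood.
-/
theorem lineDeriv_lineDeriv_eq {F : E → ℝ} {x : E} (hF : ContDiffAt ℝ 2 F x) (u v : E) :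
    lineDeriv ℝ (fun y => lineDeriv ℝ F y v) x u = fderiv ℝ (fderiv ℝ F) x u v := by
  have h1 : (fun y => lineDeriv ℝ F y v) =ᶠ[𝓝 x] fun y => fderiv ℝ F y v := by
    filter_upwards [hF.eventually (by simp)] with y hy
    exact (hy.differentiableAt (by norm_num)).lineDeriv_eq_fderiv
  have h2 : DifferentiableAt ℝ (fderiv ℝ F) x :=
    (hF.fderiv_right (m := 1) (by norm_num)).differentiableAt (by norm_num)
  rw [lineDeriv_congr_of_eventuallyEq h1]
  have h3 : HasFDerivAt (fun y => fderiv ℝ F y v) ((fderiv ℝ (fderiv ℝ F) x).flip v) x := by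
    have := (ContinuousLinearMap.apply ℝ ℝ v).hasFDerivAt.comp x h2.hasFDerivAt
    refine this.congr_fderiv ?_
    ext; rfl
  rw [h3.differentiableAt.lineDeriv_eq_fderiv, h3.fderiv]
  rfl

theorem hasDerivAt_line {F : E → ℝ} {x u : E} {s : ℝ} (hF : DifferentiableAt ℝ F (x + s • u)) :
    HasDerivAt (fun s : ℝ => F (x + s • u)) (fderiv ℝ F (x + s • u) u) s := by
  have h : HasDerivAt (fun s : ℝ => x + s • u) u s := by
    simpa using ((hasDerivAt_id s).smul_const u).const_add x
  exact hF.hasFDerivAt.comp_hasDerivAt s h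

theorem hasDerivAt_fderiv_line {F : E → ℝ} {x u : E} {s : ℝ} (hF : ContDiffAt ℝ 2 F (x + s • u))
    (v : E) : HasDerivAt (fun s : ℝ => fderiv ℝ F (x + s • u) v)
      (fderiv ℝ (fderiv ℝ F) (x + s • u) u v) s := by
  have h2 : DifferentiableAt ℝ (fderiv ℝ F) (x + s • u) :=
    (hF.fderiv_right (m := 1) (by norm_num)).differentiableAt (by norm_num)
  have h : HasDerivAt (fun s : ℝ => x + s • u) u s := by
    simpa using ((hasDerivAt_id s).smul_const u).const_add x
  exact (ContinuousLinearMap.apply ℝ ℝ v).hasFDerivAt.comp_hasDerivAt s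
    (h2.hasFDerivAt.comp_hasDerivAt s h)

/-- Taylor's inequality on `[0, 1]`. -/
theorem taylor_lower_bound {g g' g'' : ℝ → ℝ} {m : ℝ}
    (h1 : ∀ s ∈ Set.Icc (0 : ℝ) 1, HasDerivAt g (g' s) s)
    (h2 : ∀ s ∈ Set.Icc (0 : ℝ) 1, HasDerivAt g' (g'' s) s)
    (hm : ∀ s ∈ Set.Icc (0 : ℝ) 1, m ≤ g'' s) : g 0 + g' 0 + m / 2 ≤ g 1 := by
  have key : ∀ (f f' : ℝ → ℝ), (∀ s ∈ Set.Icc (0 : ℝ) 1, HasDerivAt f (f' s) s) →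
      (∀ s ∈ Set.Icc (0 : ℝ) 1, 0 ≤ f' s) → MonotoneOn f (Set.Icc 0 1) := by
    intro f f' hf hf'
    refine monotoneOn_of_hasDerivWithinAt_nonneg (f' := f') (convex_Icc 0 1)
      (fun s hs => (hf s hs).continuousAt.continuousWithinAt)
      (fun s hs => (hf s (interior_subset hs)).hasDerivWithinAt)
      fun s hs => hf' s (interior_subset hs)
  have h0 : (0 : ℝ) ∈ Set.Icc (0 : ℝ) 1 := by simp
  -- The lower bound on `g''` is integrated twice, each time as monotonicity of a function minus its
  -- comparison polynomial.
  have h3 : ∀ s ∈ Set.Icc (0 : ℝ) 1, g' 0 + m * s ≤ g' s := by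
    intro s hs
    have := key (fun s => g' s - m * s) (fun s => g'' s - m)
      (fun s hs => ((h2 s hs).sub ((hasDerivAt_id s).const_mul m)).congr_deriv (by simp))
      (fun s hs => by linarith [hm s hs]) h0 hs hs.1
    simp only [mul_zero, sub_zero] at this
    linarith
  have := key (fun s => g s - (g' 0 * s + m / 2 * s ^ 2)) (fun s => g' s - (g' 0 + m * s))
    (fun s hs => by
      have := (h1 s hs).sub (((hasDerivAt_id s).const_mul (g' 0)).add
        ((hasDerivAt_pow 2 s).const_mul (m / 2)))
      exact this.congr_deriv (by norm_num; ring))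
    (fun s hs => by linarith [h3 s hs]) h0 (Set.right_mem_Icc.2 zero_le_one) zero_le_one
  simp only [mul_zero, mul_one] at this
  norm_num at this
  linarith

/-- The mean value theorem for mixed second differences. -/
theorem exists_mixed_difference_eq {F : E → ℝ} {x u v : E}
    (hF : ∀ s ∈ Set.Icc (0 : ℝ) 1, ∀ s' ∈ Set.Icc (0 : ℝ) 1, ContDiffAt ℝ 2 F (x + s • u + s' • v)) :
    ∃ s ∈ Set.Icc (0 : ℝ) 1, ∃ s' ∈ Set.Icc (0 : ℝ) 1,
      F (x + u + v) - F (x + u) - F (x + v) + F x =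
        fderiv ℝ (fderiv ℝ F) (x + s • u + s' • v) u v := by
  have d1 : ∀ a ∈ Set.Icc (0 : ℝ) 1, ∀ s' ∈ Set.Icc (0 : ℝ) 1,
      HasDerivAt (fun s' : ℝ => F (x + a • u + s' • v)) (fderiv ℝ F (x + a • u + s' • v) v) s' :=
    fun a ha s' hs' => hasDerivAt_line ((hF a ha s' hs').differentiableAt (by norm_num))
  have h0 : (0 : ℝ) ∈ Set.Icc (0 : ℝ) 1 := by simp
  have h1 : (1 : ℝ) ∈ Set.Icc (0 : ℝ) 1 := by simp
  -- The first mean value theorem acts in `s'` on the increment of `F` across `u`; the second acts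
  -- in `s` on the resulting derivative along `v`.
  obtain ⟨s', hs', e1⟩ := exists_hasDerivAt_eq_slope
    (fun s' : ℝ => F (x + (1 : ℝ) • u + s' • v) - F (x + (0 : ℝ) • u + s' • v))
    (fun s' => fderiv ℝ F (x + (1 : ℝ) • u + s' • v) v - fderiv ℝ F (x + (0 : ℝ) • u + s' • v) v)
    zero_lt_one
    (fun s hs => ((d1 1 h1 s hs).sub (d1 0 h0 s hs)).continuousAt.continuousWithinAt)
    (fun s hs => (d1 1 h1 s (Set.Ioo_subset_Icc_self hs)).sub
      (d1 0 h0 s (Set.Ioo_subset_Icc_self hs)))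
  have hs'' := Set.Ioo_subset_Icc_self hs'
  have d2 : ∀ s ∈ Set.Icc (0 : ℝ) 1,
      HasDerivAt (fun s : ℝ => fderiv ℝ F (x + s • u + s' • v) v)
        (fderiv ℝ (fderiv ℝ F) (x + s • u + s' • v) u v) s := by
    intro s hs
    have h := hF s hs s' hs''
    rw [add_right_comm] at h
    have := hasDerivAt_fderiv_line h v
    rw [add_right_comm] at this
    refine this.congr_of_eventuallyEq (Eventually.of_forall fun r => ?_)
    simp only [add_right_comm]
  obtain ⟨s, hs, e2⟩ := exists_hasDerivAt_eq_slope _ _ zero_lt_one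
    (fun s hs => (d2 s hs).continuousAt.continuousWithinAt)
    (fun s hs => d2 s (Set.Ioo_subset_Icc_self hs))
  refine ⟨s, Set.Ioo_subset_Icc_self hs, s', hs'', ?_⟩
  simp only [one_smul, zero_smul, add_zero, sub_zero, div_one] at e1 e2
  rw [e2, e1]
  ring

/-- Karush-Kuhn-Tucker conditions for one inequality constraint on a convex set. -/
theorem exists_multiplier {Y : Set E} (hY : Convex ℝ Y) {f g : E → ℝ} {f' g' : E →L[ℝ] ℝ} {x x₀ : E}
    (hx : x ∈ Y) (hf : HasFDerivAt f f' x) (hg : HasFDerivAt g g' x) (hgx : g x ≤ 0)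
    (hmin : ∀ y ∈ Y, g y ≤ 0 → f x ≤ f y) (hx₀ : x₀ ∈ Y)
    (hslater : g x = 0 → g' (x₀ - x) < 0) :
    ∃ l : ℝ, 0 ≤ l ∧ l * g x = 0 ∧
      (l = 0 ∨ g x = 0 ∧ l * -g' (x₀ - x) ≤ f' (x₀ - x)) ∧
      ∀ y ∈ Y, 0 ≤ f' (y - x) + l * g' (y - x) := by
  have hseg : ∀ y ∈ Y, ∀ s : ℝ, 0 ≤ s → s ≤ 1 → x + s • (y - x) ∈ Y := fun y hy s h0 h1 =>
    hY.add_smul_sub_mem hx hy ⟨h0, h1⟩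
  have hline : ∀ {h : E → ℝ} {h' : E →L[ℝ] ℝ}, HasFDerivAt h h' x → ∀ d : E,
      HasDerivAt (fun s : ℝ => h (x + s • d)) (h' d) 0 := by
    intro h h' hh d
    exact hh.hasLineDerivAt d
  -- descent directions of the constraint are not descent directions of the objective
  have hdir : ∀ y ∈ Y, (g x < 0 ∨ g' (y - x) < 0) → 0 ≤ f' (y - x) := by
    intro y hy hcase
    have hev : ∀ᶠ s in 𝓝[>] (0 : ℝ), g (x + s • (y - x)) ≤ 0 := by
      have hd := hline hg (y - x)
      rcases hcase with h | h
      · have : Tendsto (fun s : ℝ => g (x + s • (y - x))) (𝓝 0) (𝓝 (g x)) := by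
          simpa using hd.continuousAt.tendsto
        exact ((this.eventually (gt_mem_nhds h)).filter_mono nhdsWithin_le_nhds).mono
          fun s hs => hs.le
      · have hs := (hasDerivAt_iff_tendsto_slope.1 hd).mono_left
          (nhdsWithin_mono (0 : ℝ) (s := Set.Ioi 0) (fun s (hs : 0 < s) => hs.ne'))
        filter_upwards [hs.eventually (gt_mem_nhds h), self_mem_nhdsWithin] with s h1 h2
        have h2 : 0 < s := h2
        rw [slope_def_field] at h1
        simp only [zero_smul, add_zero, sub_zero] at h1
        rw [div_neg_iff] at h1
        rcases h1 with h1 | h1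
        · linarith [h1.2]
        · linarith [h1.1]
    have hs := (hasDerivAt_iff_tendsto_slope.1 (hline hf (y - x))).mono_left
      (nhdsWithin_mono (0 : ℝ) (s := Set.Ioi 0) (fun s (hs : 0 < s) => hs.ne'))
    refine ge_of_tendsto hs ?_
    have hlt : ∀ᶠ s in 𝓝[>] (0 : ℝ), s < 1 :=
      (gt_mem_nhds one_pos).filter_mono nhdsWithin_le_nhds
    filter_upwards [hev, self_mem_nhdsWithin, hlt] with s h1 h2 h3
    have h2 : 0 < s := h2
    rw [slope_def_field]
    simp only [zero_smul, add_zero, sub_zero]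
    exact div_nonneg (by linarith [hmin _ (hseg y hy s h2.le h3.le) h1]) h2.le
  rcases hgx.lt_or_eq with hlt | heq
  · exact ⟨0, le_rfl, by simp, Or.inl rfl, fun y hy => by simpa using hdir y hy (Or.inl hlt)⟩
  have h0 := hslater heq
  -- Directions with `g' < 0` require the multiplier to be at most every element of `R`, so `sInf R`
  -- is the largest candidate. The remaining work is to see that it is large enough for directions
  -- with `g' ≥ 0`.
  set R : Set ℝ := {r | ∃ y ∈ Y, g' (y - x) < 0 ∧ r = f' (y - x) / -g' (y - x)} with hR
  have hRne : R.Nonempty := ⟨_, x₀, hx₀, h0, rfl⟩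
  have hR0 : ∀ r ∈ R, 0 ≤ r := by
    rintro r ⟨y, hy, hneg, rfl⟩
    exact div_nonneg (hdir y hy (Or.inr hneg)) (by linarith)
  have hRb : BddBelow R := ⟨0, hR0⟩
  refine ⟨sInf R, le_csInf hRne hR0, by simp [heq], Or.inr ⟨heq, ?_⟩, fun y hy => ?_⟩
  -- The Slater point contributes one element of `R`, and this is the quantitative bound on the
  -- multiplier.
  · have := csInf_le hRb ⟨x₀, hx₀, h0, rfl⟩
    rwa [le_div_iff₀ (by linarith)] at this
  · rcases lt_or_ge (g' (y - x)) 0 with hneg | hpos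
    · have := csInf_le hRb ⟨y, hy, hneg, rfl⟩
      rw [le_div_iff₀ (by linarith)] at this
      linarith
    · -- combine the direction of `y` with descent directions of the constraint
      have hcomb : ∀ z ∈ Y, g' (z - x) < 0 →
          0 ≤ f' (y - x) * -g' (z - x) + f' (z - x) * g' (y - x) := by
        intro z hz hzneg
        have hall : ∀ δ > 0,
            0 ≤ f' (y - x) * -g' (z - x) + f' (z - x) * (g' (y - x) + δ) := by
          intro δ hδ
          have htot : 0 < -g' (z - x) + (g' (y - x) + δ) := by linarith
          -- With `δ = 0` these weights would make `g'` vanish in the combined direction; a positive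
          -- `δ` makes it strictly negative, so that `hdir` applies, and `δ` tends to zero
          -- afterwards.
          set a := -g' (z - x) / (-g' (z - x) + (g' (y - x) + δ)) with ha
          set b := (g' (y - x) + δ) / (-g' (z - x) + (g' (y - x) + δ)) with hb
          have hab : a + b = 1 := by rw [ha, hb, ← add_div, div_self htot.ne']
          have hw : a • y + b • z ∈ Y := hY hy hz (div_nonneg (by linarith) htot.le)
            (div_nonneg (by linarith) htot.le) hab
          have hd : a • y + b • z - x = a • (y - x) + b • (z - x) := by
            have : x = a • x + b • x := by rw [← add_smul, hab, one_smul]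
            nth_rewrite 1 [this]
            module
          have h1 : g' (a • y + b • z - x) < 0 := by
            rw [hd]
            simp only [map_add, map_smul, smul_eq_mul]
            have : a * g' (y - x) + b * g' (z - x) =
                δ * g' (z - x) / (-g' (z - x) + (g' (y - x) + δ)) := by
              rw [ha, hb]; field_simp; ring
            rw [this]
            exact div_neg_of_neg_of_pos (mul_neg_of_pos_of_neg hδ hzneg) htot
          have h2 := hdir _ hw (Or.inr h1)
          rw [hd] at h2
          simp only [map_add, map_smul, smul_eq_mul] at h2
          have h3 : a * f' (y - x) + b * f' (z - x) =
              (f' (y - x) * -g' (z - x) + f' (z - x) * (g' (y - x) + δ)) /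
                (-g' (z - x) + (g' (y - x) + δ)) := by
            rw [ha, hb]; field_simp
          rw [h3] at h2
          by_contra hcon
          exact absurd (div_neg_of_neg_of_pos (not_le.1 hcon) htot) (not_lt.2 h2)
        have hlim : Tendsto (fun δ : ℝ => f' (y - x) * -g' (z - x) +
            f' (z - x) * (g' (y - x) + δ)) (𝓝[>] 0)
            (𝓝 (f' (y - x) * -g' (z - x) + f' (z - x) * (g' (y - x) + 0))) :=
          (Continuous.tendsto (by fun_prop) 0).mono_left nhdsWithin_le_nhds
        rw [add_zero] at hlim
        exact ge_of_tendsto hlim (eventually_mem_nhdsWithin.mono fun δ hδ => hall δ hδ)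
      rcases hpos.eq_or_lt with hz | hp
      · have := hcomb x₀ hx₀ h0
        rw [← hz] at this ⊢
        have h5 : 0 ≤ f' (y - x) * -g' (x₀ - x) := by linarith
        have h6 := nonneg_of_mul_nonneg_left h5 (by linarith)
        linarith
      · have h5 : -f' (y - x) / g' (y - x) ≤ sInf R := by
          refine le_csInf hRne ?_
          rintro r ⟨z, hz, hzneg, rfl⟩
          rw [div_le_div_iff₀ hp (by linarith)]
          linarith [hcomb z hz hzneg]
        rw [div_le_iff₀ hp] at h5
        linarith

end SecondDerivatives

variable {Q N : ℕ}

theorem pd2_eq_fderiv {F : Profile Q N → ℝ} {x : Profile Q N} (hF : ContDiffAt ℝ 2 F x)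
    (u v : Profile Q N) : pd2 F u v x = fderiv ℝ (fderiv ℝ F) x u v :=
  lineDeriv_lineDeriv_eq hF u v

theorem pd2_comm {F : Profile Q N → ℝ} {x : Profile Q N} (hF : ContDiffAt ℝ 2 F x)
    (u v : Profile Q N) : pd2 F u v x = pd2 F v u x := by
  rw [pd2_eq_fderiv hF, pd2_eq_fderiv hF]
  exact (hF.isSymmSndFDerivAt (by simp)) u v

/-- This reads `pd2` off one-variable calculus. The first derivative formula is needed on a
neighbourhood of `x` because the outer derivative differentiates it. -/
theorem pd2_eq_of_hasDerivAt {F : Profile Q N → ℝ} {G : Profile Q N → ℝ} {x u v : Profile Q N}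
    {a : ℝ} (h1 : ∀ᶠ y in 𝓝 x, HasDerivAt (fun s : ℝ => F (y + s • v)) (G y) 0)
    (h2 : HasDerivAt (fun s : ℝ => G (x + s • u)) a 0) : pd2 F u v x = a := by
  have h3 : (fun y => lineDeriv ℝ F y v) =ᶠ[𝓝 x] G := h1.mono fun y hy => hy.deriv
  unfold pd2
  rw [lineDeriv_congr_of_eventuallyEq h3]
  exact h2.deriv

end CogRadio
end

/-! ### Rate estimates and the geometry of the strategy sets -/

noncomputable section
namespace CogRadio

variable {Q N : ℕ} (S : System Q N)

theorem iInf_le_of_fin {n : ℕ} (f : Fin n → ℝ) (k : Fin n) : ⨅ k, f k ≤ f k :=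
  ciInf_le (Set.finite_range f).bddBelow k

theorem le_iSup_of_fin {n : ℕ} (f : Fin n → ℝ) (k : Fin n) : f k ≤ ⨆ k, f k :=
  le_ciSup (Set.finite_range f).bddAbove k

theorem iInf_pos_of_fin {n : ℕ} [Nonempty (Fin n)] {f : Fin n → ℝ} (h : ∀ k, 0 < f k) :
    0 < ⨅ k, f k := by
  obtain ⟨k, hk⟩ := exists_eq_ciInf_of_finite (f := f)
  rw [← hk]; exact h k

theorem nz_pos (q : Fin Q) (k : Fin N) : 0 < nz S q k :=
  div_pos (S.noise_pos q k) (pow_pos (norm_pos_iff.2 (S.H_ne q k)) 2)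

theorem Hsq_nonneg (q r : Fin Q) (k : Fin N) : 0 ≤ Hsq S q r k := sq_nonneg _

theorem Hsq_self (q : Fin Q) (k : Fin N) : Hsq S q q k = 1 := by
  simp [Hsq, div_self (S.H_ne q k)]

theorem gw_nonneg (q : Fin Q) (k : Fin N) : 0 ≤ gw S q k := sq_nonneg _

theorem dmu_pos (q : Fin Q) (k : Fin N) : 0 < dmu S q k := sub_pos.2 (S.mu_lt q k)

theorem T_pos (q : Fin Q) : 0 < S.T q :=
  (S.tauMin_pos q).trans ((S.tau_lt q).trans (S.tauMax_lt q))

theorem tauHatMin_pos (q : Fin Q) : 0 < tauHatMin S q :=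
  Real.sqrt_pos.2 (mul_pos (S.tauMin_pos q) (S.f_pos q))

theorem tauHatMin_sq (q : Fin Q) : tauHatMin S q ^ 2 = S.tauMin q * S.f q :=
  Real.sq_sqrt (mul_pos (S.tauMin_pos q) (S.f_pos q)).le

theorem tauHatMax_sq (q : Fin Q) : tauHatMax S q ^ 2 = S.tauMax q * S.f q :=
  Real.sq_sqrt (mul_pos ((S.tauMin_pos q).trans (S.tau_lt q)) (S.f_pos q)).le

/-! ### Rates -/

/-- The interference received by user `q` on carrier `k`. -/
def interf (q : Fin Q) (k : Fin N) (p : Fin Q → Fin N → ℝ) : ℝ :=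
  ∑ r ∈ Finset.univ.erase q, Hsq S q r k * p r k

theorem rateK_eq (q : Fin Q) (k : Fin N) (p : Fin Q → Fin N → ℝ) :
    rateK S q k p = Real.log (1 + p q k / (nz S q k + interf S q k p)) := rfl

theorem interf_nonneg {q : Fin Q} (k : Fin N) {p : Fin Q → Fin N → ℝ}
    (hp : ∀ r, r ≠ q → ∀ k, 0 ≤ p r k) : 0 ≤ interf S q k p :=
  Finset.sum_nonneg fun r hr => mul_nonneg (Hsq_nonneg S q r k) (hp r (Finset.ne_of_mem_erase hr) k)

theorem interf_mono {q : Fin Q} (k : Fin N) {p p' : Fin Q → Fin N → ℝ}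
    (hp : ∀ r, r ≠ q → ∀ k, p r k ≤ p' r k) : interf S q k p ≤ interf S q k p' :=
  Finset.sum_le_sum fun r hr =>
    mul_le_mul_of_nonneg_left (hp r (Finset.ne_of_mem_erase hr) k) (Hsq_nonneg S q r k)

theorem rateK_anti {q : Fin Q} (k : Fin N) {p p' : Fin Q → Fin N → ℝ} (h0 : 0 ≤ p q k)
    (hq : p q k = p' q k) (hp : ∀ r, r ≠ q → ∀ k, 0 ≤ p r k)
    (hpp : ∀ r, r ≠ q → ∀ k, p r k ≤ p' r k) : rateK S q k p' ≤ rateK S q k p := by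
  have h1 := nz_pos S q k
  have h2 := interf_nonneg S k hp
  have h3 := interf_mono S k hpp
  rw [rateK_eq, rateK_eq, ← hq]
  apply Real.log_le_log
  · have : 0 ≤ p q k / (nz S q k + interf S q k p') := div_nonneg h0 (by linarith)
    linarith
  · gcongr

theorem rate_anti {q : Fin Q} {p p' : Fin Q → Fin N → ℝ} (h0 : ∀ k, 0 ≤ p q k)
    (hq : p q = p' q) (hp : ∀ r, r ≠ q → ∀ k, 0 ≤ p r k)
    (hpp : ∀ r, r ≠ q → ∀ k, p r k ≤ p' r k) : rate S q p' ≤ rate S q p :=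
  Finset.sum_le_sum fun k _ => rateK_anti S k (h0 k) (by rw [hq]) hp hpp

theorem rateK_le_div {q : Fin Q} (k : Fin N) {p : Fin Q → Fin N → ℝ} (h0 : 0 ≤ p q k)
    (hp : ∀ r, r ≠ q → ∀ k, 0 ≤ p r k) : rateK S q k p ≤ p q k / nz S q k := by
  have h1 := nz_pos S q k
  have h2 := interf_nonneg S k hp
  rw [rateK_eq]
  have h3 : 0 ≤ p q k / (nz S q k + interf S q k p) := div_nonneg h0 (by linarith)
  have h4 := Real.log_le_sub_one_of_pos (show 0 < 1 + p q k / (nz S q k + interf S q k p) by linarith)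
  have h5 : p q k / (nz S q k + interf S q k p) ≤ p q k / nz S q k := by
    gcongr; linarith
  linarith

theorem rate_le_div {q : Fin Q} [Nonempty (Fin N)] {p : Fin Q → Fin N → ℝ} (h0 : ∀ k, 0 ≤ p q k)
    (hp : ∀ r, r ≠ q → ∀ k, 0 ≤ p r k) : rate S q p ≤ (∑ k, p q k) / ⨅ k, nz S q k := by
  rw [Finset.sum_div]
  refine Finset.sum_le_sum fun k _ => (rateK_le_div S k (h0 k) hp).trans ?_
  exact div_le_div_of_nonneg_left (h0 k) (iInf_pos_of_fin (nz_pos S q)) (iInf_le_of_fin _ k)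

theorem rate_le_rMax {q : Fin Q} {p : Fin Q → Fin N → ℝ} (h0 : ∀ k, 0 ≤ p q k)
    (h1 : ∀ k, p q k ≤ S.pmax q k) (hp : ∀ r, r ≠ q → ∀ k, 0 ≤ p r k) :
    rate S q p ≤ rMax S q := by
  refine Finset.sum_le_sum fun k _ => ?_
  have h2 := nz_pos S q k
  have h3 := interf_nonneg S k hp
  rw [rateK_eq]
  apply Real.log_le_log
  · have : 0 ≤ p q k / (nz S q k + interf S q k p) := div_nonneg (h0 k) (by linarith)
    linarith
  · have : p q k / (nz S q k + interf S q k p) ≤ S.pmax q k / nz S q k := by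
      have h4 := h1 k
      have h5 := h0 k
      exact div_le_div₀ (S.pmax_pos q k).le h4 h2 (by linarith)
    linarith

/-- A concave function vanishing at zero lies above its chord on `[0, b]`. -/
theorem log_concave_bound {a b D : ℝ} (hD : 0 < D) (h0 : 0 ≤ a) (hab : a ≤ b) (hb : 0 < b) :
    Real.log (1 + b / D) / b * a ≤ Real.log (1 + a / D) := by
  have hbD : 0 < b / D := div_pos hb hD
  have h := strictConcaveOn_log_Ioi.concaveOn.2 (show (1 : ℝ) ∈ Set.Ioi 0 by simp)
    (show 1 + b / D ∈ Set.Ioi 0 from (by linarith : 0 < 1 + b / D))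
    (show 0 ≤ 1 - a / b by rw [sub_nonneg, div_le_one hb]; exact hab) (show 0 ≤ a / b from div_nonneg h0 hb.le) (by ring)
  simp only [smul_eq_mul, Real.log_one, mul_zero, zero_add] at h
  have e1 : (1 - a / b) * 1 + a / b * (1 + b / D) = 1 + a / D := by field_simp; ring
  rw [e1] at h
  calc _ = a / b * Real.log (1 + b / D) := by ring
    _ ≤ _ := h

/-- Interference is first raised to its value at the masks, then the logarithm is bounded by its
chord up to the mask. This linear lower bound is the source of positivity of rates and of the
constants `rLow`, `xiSup` and `lamMax`. -/
theorem rMin_mul_le_rate {q : Fin Q} {p : Fin Q → Fin N → ℝ} (h0 : ∀ r k, 0 ≤ p r k)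
    (h1 : ∀ r k, p r k ≤ S.pmax r k) : rMin S q * ∑ k, p q k ≤ rate S q p := by
  rw [Finset.mul_sum]
  refine Finset.sum_le_sum fun k _ => ?_
  have hnz := nz_pos S q k
  have hi : 0 ≤ interf S q k S.pmax := interf_nonneg S k fun r _ k => (S.pmax_pos r k).le
  have hmin : rMin S q ≤ Real.log (1 + S.pmax q k / (nz S q k + interf S q k S.pmax)) / S.pmax q k :=
    iInf_le_of_fin _ k
  calc rMin S q * p q k
      ≤ Real.log (1 + S.pmax q k / (nz S q k + interf S q k S.pmax)) / S.pmax q k * p q k :=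
        mul_le_mul_of_nonneg_right hmin (h0 q k)
    _ ≤ Real.log (1 + p q k / (nz S q k + interf S q k S.pmax)) :=
        log_concave_bound (by linarith) (h0 q k) (h1 q k) (S.pmax_pos q k)
    _ ≤ rateK S q k p := by
        have h2 := interf_nonneg S (q := q) k (fun r _ => h0 r)
        have h3 := interf_mono S (q := q) k (fun r _ => h1 r)
        have h4 := h0 q k
        rw [rateK_eq]
        apply Real.log_le_log
        · have : 0 ≤ p q k / (nz S q k + interf S q k S.pmax) := div_nonneg h4 (by linarith)
          linarith
        · gcongr

theorem rMin_pos (q : Fin Q) [Nonempty (Fin N)] : 0 < rMin S q := by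
  refine iInf_pos_of_fin fun k => div_pos (Real.log_pos ?_) (S.pmax_pos q k)
  have hnz := nz_pos S q k
  have hi : 0 ≤ interf S q k S.pmax := interf_nonneg S k fun r _ k => (S.pmax_pos r k).le
  have : 0 < S.pmax q k / (nz S q k + interf S q k S.pmax) :=
    div_pos (S.pmax_pos q k) (by linarith)
  exact lt_add_of_pos_right 1 this

theorem lamMax_term_pos [Nonempty (Fin N)] (q : Fin Q) :
    0 < (1 / ⨅ r, min (S.Imax r) (⨅ k, S.pmax r k)) / (rMin S q * ⨅ k, nz S q k) := by
  have : Nonempty (Fin Q) := ⟨q⟩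
  refine div_pos (one_div_pos.2 (iInf_pos_of_fin fun r => lt_min (S.Imax_pos r)
    (iInf_pos_of_fin (S.pmax_pos r)))) (mul_pos (rMin_pos S q) (iInf_pos_of_fin (nz_pos S q)))

theorem lamMax_nonneg [Nonempty (Fin N)] : 0 ≤ lamMax S :=
  Finset.sum_nonneg fun q _ => (lamMax_term_pos S q).le

theorem le_lamMax [Nonempty (Fin N)] (q : Fin Q) :
    1 / (S.Imax q * (rMin S q * ⨅ k, nz S q k)) ≤ lamMax S := by
  have : Nonempty (Fin Q) := ⟨q⟩
  have h1 : 0 < ⨅ r, min (S.Imax r) (⨅ k, S.pmax r k) :=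
    iInf_pos_of_fin fun r => lt_min (S.Imax_pos r) (iInf_pos_of_fin (S.pmax_pos r))
  have h2 : (⨅ r, min (S.Imax r) (⨅ k, S.pmax r k)) ≤ S.Imax q :=
    (iInf_le_of_fin _ q).trans (min_le_left _ _)
  have h3 := mul_pos (rMin_pos S q) (iInf_pos_of_fin (nz_pos S q))
  calc 1 / (S.Imax q * (rMin S q * ⨅ k, nz S q k))
      = (1 / S.Imax q) / (rMin S q * ⨅ k, nz S q k) := by rw [div_div]
    _ ≤ (1 / ⨅ r, min (S.Imax r) (⨅ k, S.pmax r k)) / (rMin S q * ⨅ k, nz S q k) := by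
        gcongr
    _ ≤ lamMax S := Finset.single_le_sum (f := fun q =>
        (1 / ⨅ r, min (S.Imax r) (⨅ k, S.pmax r k)) / (rMin S q * ⨅ k, nz S q k))
        (fun q _ => (lamMax_term_pos S q).le) (Finset.mem_univ q)

/-! ### The strategy sets -/

/-- The largest argument of the tail function allowed by the bound on the missed detection
probability of carrier `k`, for sensing time `tau`. -/
def faArg (q : Fin Q) (k : Fin N) (tau : ℝ) : ℝ :=
  (S.sd1 q k * alphaHat S q k + dmu S q k * tau) / S.sd0 q k

theorem detection_iff {q : Fin Q} {k : Fin N} {tau b : ℝ} :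
    S.sd0 q k / S.sd1 q k * b - tau * (dmu S q k / S.sd1 q k) ≤ alphaHat S q k ↔
      b ≤ faArg S q k tau := by
  have h0 := S.sd0_pos q k
  have h1 := S.sd1_pos q k
  rw [faArg, le_div_iff₀ h0]
  have : S.sd0 q k / S.sd1 q k * b - tau * (dmu S q k / S.sd1 q k) =
      (b * S.sd0 q k - dmu S q k * tau) / S.sd1 q k := by ring
  rw [this, div_le_iff₀ h1]
  constructor <;> intro h <;> linarith

/-- Applying the decreasing function `Qfun` removes `Qinv` from the detection constraint, leaving an
epigraph condition whose closedness and convexity can be checked directly. -/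
theorem mem_Yset_iff {q : Fin Q} {z : Strategy N} : z ∈ Yset S q ↔
    0 < z.2.2 ∧ z.2.2 ≤ S.beta q ∧ (∀ k, Qfun (faArg S q k z.1) ≤ z.2.2) ∧
      z.2.1 ∈ powerSet S q ∧ tauHatMin S q ≤ z.1 ∧ z.1 ≤ tauHatMax S q := by
  have hb := S.beta_le q
  constructor
  · rintro ⟨h1, h2, h3, h4⟩
    exact ⟨h1, h2, fun k => (Qinv_le_iff h1 (by linarith)).1 ((detection_iff S).1 (h3 k)), h4⟩
  · rintro ⟨h1, h2, h3, h4⟩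
    exact ⟨h1, h2, fun k => (detection_iff S).2 ((Qinv_le_iff h1 (by linarith)).2 (h3 k)), h4⟩

section MemYset

variable {S} {q : Fin Q} {z : Strategy N} (hz : z ∈ Yset S q)

include hz

theorem pfa_pos_of_mem : 0 < z.2.2 := hz.1

theorem pfa_le_of_mem : z.2.2 ≤ 1 / 2 := hz.2.1.trans (S.beta_le q)

theorem pow_nonneg_of_mem (k : Fin N) : 0 ≤ z.2.1 k := (hz.2.2.2.1.2 k).1

theorem pow_le_of_mem (k : Fin N) : z.2.1 k ≤ S.pmax q k := (hz.2.2.2.1.2 k).2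

theorem tau_pos_of_mem : 0 < z.1 := (tauHatMin_pos S q).trans_le hz.2.2.2.2.1

theorem tau_le_of_mem : z.1 ≤ tauHatMax S q := hz.2.2.2.2.2

theorem tauMin_mul_le_of_mem : S.tauMin q * S.f q ≤ z.1 ^ 2 := by
  rw [← tauHatMin_sq]
  exact pow_le_pow_left₀ (tauHatMin_pos S q).le hz.2.2.2.2.1 2

theorem tau_sq_lt_of_mem : z.1 ^ 2 < S.f q * S.T q := by
  have h1 : z.1 ^ 2 ≤ S.tauMax q * S.f q := by
    rw [← tauHatMax_sq]
    exact pow_le_pow_left₀ (tau_pos_of_mem hz).le hz.2.2.2.2.2 2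
  nlinarith [S.tauMax_lt q, S.f_pos q]

theorem Qinv_nonneg_of_mem : 0 ≤ Qinv z.2.2 := Qinv_nonneg hz.1 (pfa_le_of_mem hz)

theorem Qinv_le_faArg_of_mem (k : Fin N) : Qinv z.2.2 ≤ faArg S q k z.1 :=
  (detection_iff S).1 (hz.2.2.1 k)

end MemYset

theorem alphaHat_nonpos (q : Fin Q) (k : Fin N) : alphaHat S q k ≤ 0 :=
  Qinv_nonpos (by linarith [S.alpha_le q k]) (by linarith [S.alpha_pos q k])

theorem Qfun_alphaHat (q : Fin Q) (k : Fin N) : Qfun (alphaHat S q k) = 1 - S.alpha q k :=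
  Qfun_Qinv (by linarith [S.alpha_le q k]) (by linarith [S.alpha_pos q k])

theorem detArg_le_of_mem {q : Fin Q} {z : Strategy N} (hz : z ∈ Yset S q) (k : Fin N) :
    (S.sd0 q k * Qinv z.2.2 - dmu S q k * z.1) / S.sd1 q k ≤ alphaHat S q k := by
  have := hz.2.2.1 k
  have e : (S.sd0 q k * Qinv z.2.2 - dmu S q k * z.1) / S.sd1 q k =
    S.sd0 q k / S.sd1 q k * Qinv z.2.2 - z.1 * (dmu S q k / S.sd1 q k) := by ring
  rw [e]; exact this

theorem Pmiss_nonneg (q : Fin Q) (k : Fin N) (tau pfa : ℝ) : 0 ≤ Pmiss S q k tau pfa :=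
  sub_nonneg.2 (Qfun_lt_one _).le

/-- The detection constraint says that missed detection is at most `alpha`. The resulting factor one
half is what makes the reference powers feasible. -/
theorem Pmiss_le_half {q : Fin Q} {z : Strategy N} (hz : z ∈ Yset S q) (k : Fin N) :
    Pmiss S q k z.1 z.2.2 ≤ 1 / 2 := by
  have h := Qfun_strictAnti.antitone (detArg_le_of_mem S hz k)
  rw [Qfun_alphaHat] at h
  unfold Pmiss
  linarith [S.alpha_le q k]

theorem combo_le {a b x y M : ℝ} (ha : 0 ≤ a) (hb : 0 ≤ b) (hab : a + b = 1) (hx : x ≤ M)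
    (hy : y ≤ M) : a * x + b * y ≤ M := by
  have h1 := mul_le_mul_of_nonneg_left hx ha
  have h2 := mul_le_mul_of_nonneg_left hy hb
  have h3 : a * M + b * M = M := by rw [← add_mul, hab, one_mul]
  linarith

theorem le_combo {a b x y M : ℝ} (ha : 0 ≤ a) (hb : 0 ≤ b) (hab : a + b = 1) (hx : M ≤ x)
    (hy : M ≤ y) : M ≤ a * x + b * y := by
  have h1 := mul_le_mul_of_nonneg_left hx ha
  have h2 := mul_le_mul_of_nonneg_left hy hb
  have h3 : a * M + b * M = M := by rw [← add_mul, hab, one_mul]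
  linarith

theorem convex_powerSet (q : Fin Q) : Convex ℝ (powerSet S q) := by
  intro p hp p' hp' a b ha hb hab
  have := fun x y M => combo_le (x := x) (y := y) (M := M) ha hb hab
  refine ⟨?_, fun k => ⟨?_, ?_⟩⟩
  · simp only [Pi.add_apply, Pi.smul_apply, smul_eq_mul, Finset.sum_add_distrib, ← Finset.mul_sum]
    exact this _ _ _ hp.1 hp'.1
  · exact add_nonneg (mul_nonneg ha (hp.2 k).1) (mul_nonneg hb (hp'.2 k).1)
  · exact this _ _ _ (hp.2 k).2 (hp'.2 k).2

theorem convex_Yset (q : Fin Q) : Convex ℝ (Yset S q) := by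
  intro z hz z' hz' a b ha hb hab
  have hle := fun x y M => combo_le (x := x) (y := y) (M := M) ha hb hab
  have hge := fun x y M => le_combo (x := x) (y := y) (M := M) ha hb hab
  have h := (mem_Yset_iff S).1 hz
  have h' := (mem_Yset_iff S).1 hz'
  rw [mem_Yset_iff]
  simp only [Prod.fst_add, Prod.snd_add, Prod.smul_fst, Prod.smul_snd, smul_eq_mul]
  refine ⟨?_, hle _ _ _ h.2.1 h'.2.1, fun k => ?_, convex_powerSet S q h.2.2.2.1 h'.2.2.2.1 ha hb hab,
    hge _ _ _ h.2.2.2.2.1 h'.2.2.2.2.1, hle _ _ _ h.2.2.2.2.2 h'.2.2.2.2.2⟩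
  · exact (lt_min h.1 h'.1).trans_le (hge _ _ _ (min_le_left _ _) (min_le_right _ _))
  · have e : faArg S q k (a * z.1 + b * z'.1) = a • faArg S q k z.1 + b • faArg S q k z'.1 := by
      have h0 := (S.sd0_pos q k).ne'
      simp only [faArg, smul_eq_mul]
      field_simp
      linear_combination -(S.sd1 q k * alphaHat S q k) * hab
    rw [e]
    -- Both arguments dominate `Qinv` of a false alarm probability at most one half, hence lie where
    -- `Qfun` is convex; `faArg` is affine in the sensing time.
    have hc := convexOn_Qfun.2 (x := faArg S q k z.1) (y := faArg S q k z'.1)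
      ((Qinv_nonneg_of_mem hz).trans (Qinv_le_faArg_of_mem hz k))
      ((Qinv_nonneg_of_mem hz').trans (Qinv_le_faArg_of_mem hz' k)) ha hb hab
    refine hc.trans ?_
    simp only [smul_eq_mul]
    have := mul_le_mul_of_nonneg_left (h.2.2.1 k) ha
    have := mul_le_mul_of_nonneg_left (h'.2.2.1 k) hb
    linarith

theorem isClosed_powerSet (q : Fin Q) : IsClosed (powerSet S q) := by
  have h1 : IsClosed {p : Fin N → ℝ | ∑ k, p k ≤ S.P q} :=
    isClosed_le (by fun_prop) (by fun_prop)
  have h2 : IsClosed {p : Fin N → ℝ | ∀ k, 0 ≤ p k ∧ p k ≤ S.pmax q k} := by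
    simp only [Set.ofPred_forall]
    refine isClosed_iInter fun k => ?_
    exact isClosed_Icc.preimage (continuous_apply k)
  exact h1.inter h2

theorem isClosed_Yset [Nonempty (Fin N)] (q : Fin Q) : IsClosed (Yset S q) := by
  have e : Yset S q = {z : Strategy N | z.2.2 ≤ S.beta q} ∩
      ({z : Strategy N | ∀ k, Qfun (faArg S q k z.1) ≤ z.2.2} ∩
      ({z : Strategy N | z.2.1 ∈ powerSet S q} ∩
        ({z : Strategy N | tauHatMin S q ≤ z.1} ∩ {z : Strategy N | z.1 ≤ tauHatMax S q}))) := by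
    ext z
    rw [mem_Yset_iff]
    constructor
    · rintro ⟨_, h⟩
      exact h
    · rintro ⟨h1, h2, h3⟩
      -- With at least one carrier, the strict inequality `0 < P_fa` follows from the closed
      -- constraints, since the tail function is positive.
      exact ⟨(Qfun_pos _).trans_le (h2 (Classical.arbitrary _)), h1, h2, h3⟩
  rw [e]
  refine (isClosed_le (by fun_prop) (by fun_prop)).inter (IsClosed.inter ?_ (IsClosed.inter ?_
    ((isClosed_le (by fun_prop) (by fun_prop)).inter (isClosed_le (by fun_prop) (by fun_prop)))))
  · simp only [Set.ofPred_forall]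
    refine isClosed_iInter fun k => isClosed_le (continuous_Qfun.comp ?_) (by fun_prop)
    unfold faArg
    fun_prop
  · exact (isClosed_powerSet S q).preimage (by fun_prop)

theorem isCompact_Yset [Nonempty (Fin N)] (q : Fin Q) : IsCompact (Yset S q) := by
  refine IsCompact.of_isClosed_subset (s := Set.Icc (tauHatMin S q) (tauHatMax S q) ×ˢ
    (Set.pi Set.univ fun k => Set.Icc 0 (S.pmax q k)) ×ˢ Set.Icc 0 (S.beta q))
    (isCompact_Icc.prod ((isCompact_univ_pi fun k => isCompact_Icc).prod isCompact_Icc))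
    (isClosed_Yset S q) ?_
  intro z hz
  exact ⟨hz.2.2.2.2, fun k _ => hz.2.2.2.1.2 k, hz.1.le, hz.2.1⟩

/-- Profiles whose strategies satisfy the convex constraints have their powers within the masks. -/
theorem power_mem_box {x : Profile Q N} (hx : x ∈ Yjoint S) :
    (∀ r k, 0 ≤ power x r k) ∧ ∀ r k, power x r k ≤ S.pmax r k :=
  ⟨fun r k => pow_nonneg_of_mem (hx r) k, fun r k => pow_le_of_mem (hx r) k⟩

theorem throughput_eq (q : Fin Q) (x : Profile Q N) : throughput S q x =
    (1 - (x q).1 ^ 2 / (S.f q * S.T q)) * ((1 - (x q).2.2) * rate S q (power x)) := by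
  simp only [throughput, rate, Finset.mul_sum]

end CogRadio
end

/-! ### Smoothness and explicit derivatives of the payoff -/

noncomputable section
namespace CogRadio

variable {Q N : ℕ} (S : System Q N)

/-- The conditions under which the payoff of user `q` is smooth around `x`. -/
structure RegularAt (q : Fin Q) (x : Profile Q N) : Prop where
  tau : (x q).1 ^ 2 < S.f q * S.T q
  pfa_pos : 0 < (x q).2.2
  pfa_lt : (x q).2.2 < 1
  den : ∀ k, 0 < nz S q k + interf S q k (power x)
  num : ∀ k, 0 < nz S q k + interf S q k (power x) + (x q).2.1 k
  rate_pos : 0 < rate S q (power x)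

theorem interf_line (q : Fin Q) (k : Fin N) (y v : Profile Q N) (s : ℝ) :
    interf S q k (power (y + s • v)) = interf S q k (power y) + s * interf S q k (power v) := by
  simp only [interf, power, Pi.add_apply, Pi.smul_apply, Prod.snd_add, Prod.fst_add, Prod.smul_snd,
    Prod.smul_fst, smul_eq_mul, Finset.mul_sum, ← Finset.sum_add_distrib]
  exact Finset.sum_congr rfl fun r _ => by ring

theorem contDiff_interf {n : WithTop ℕ∞} (q : Fin Q) (k : Fin N) :
    ContDiff ℝ n fun y : Profile Q N => interf S q k (power y) := by
  unfold interf power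
  fun_prop

variable {S} in
theorem RegularAt.one_add_pos {q : Fin Q} {x : Profile Q N} (h : RegularAt S q x) (k : Fin N) :
    0 < 1 + power x q k / (nz S q k + interf S q k (power x)) := by
  have h1 := h.den k
  have h2 := h.num k
  have : 1 + power x q k / (nz S q k + interf S q k (power x)) =
      (nz S q k + interf S q k (power x) + (x q).2.1 k) /
        (nz S q k + interf S q k (power x)) := by
    rw [add_div, div_self h1.ne']; rfl
  rw [this]
  exact div_pos h2 h1

variable {S} in
theorem RegularAt.one_sub_pos {q : Fin Q} {x : Profile Q N} (h : RegularAt S q x) :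
    0 < 1 - (x q).1 ^ 2 / (S.f q * S.T q) := by
  have := mul_pos (S.f_pos q) (T_pos S q)
  rw [sub_pos, div_lt_one this]
  exact h.tau

variable {S} in
theorem RegularAt.throughput_pos {q : Fin Q} {x : Profile Q N} (h : RegularAt S q x) :
    0 < throughput S q x := by
  rw [throughput_eq]
  exact mul_pos h.one_sub_pos (mul_pos (sub_pos.2 h.pfa_lt) h.rate_pos)

variable {S} in
theorem RegularAt.contDiffAt_rate {q : Fin Q} {x : Profile Q N} (h : RegularAt S q x)
    {n : WithTop ℕ∞} : ContDiffAt ℝ n (fun y : Profile Q N => rate S q (power y)) x := by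
  unfold rate
  refine ContDiffAt.sum fun k _ => ?_
  simp only [rateK_eq]
  refine ContDiffAt.log (contDiffAt_const.add (ContDiffAt.div ?_
    (contDiffAt_const.add (contDiff_interf S q k).contDiffAt) (h.den k).ne')) (h.one_add_pos k).ne'
  unfold power
  fun_prop

variable {S} in
-- Derivatives at a boundary point of the strategy sets need formulas at nearby profiles that may be
-- infeasible. `RegularAt` is an open condition that is sufficient for these formulas.
theorem RegularAt.eventually {q : Fin Q} {x : Profile Q N} (h : RegularAt S q x) :
    ∀ᶠ y in 𝓝 x, RegularAt S q y := by
  have c1 : Continuous fun y : Profile Q N => (y q).1 ^ 2 := by fun_prop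
  have c2 : Continuous fun y : Profile Q N => (y q).2.2 := by fun_prop
  have c3 : ∀ k, Continuous fun y : Profile Q N => nz S q k + interf S q k (power y) := fun k =>
    continuous_const.add (contDiff_interf (n := 0) S q k).continuous
  have c4 : ∀ k, Continuous fun y : Profile Q N =>
      nz S q k + interf S q k (power y) + (y q).2.1 k := fun k => (c3 k).add (by fun_prop)
  filter_upwards [c1.continuousAt.eventually (gt_mem_nhds h.tau),
    c2.continuousAt.eventually (lt_mem_nhds h.pfa_pos),
    c2.continuousAt.eventually (gt_mem_nhds h.pfa_lt),
    eventually_all.2 fun k => (c3 k).continuousAt.eventually (lt_mem_nhds (h.den k)),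
    eventually_all.2 fun k => (c4 k).continuousAt.eventually (lt_mem_nhds (h.num k)),
    (h.contDiffAt_rate (n := 0)).continuousAt.eventually (lt_mem_nhds h.rate_pos)]
    with y h1 h2 h3 h4 h5 h6 using ⟨h1, h2, h3, h4, h5, h6⟩

/-- The deviation of the normalized sensing time of user `q` from the average. -/
def sensingGap (q : Fin Q) (x : Profile Q N) : ℝ :=
  (x q).1 / Real.sqrt (S.f q) - 1 / (Q : ℝ) * ∑ r, (x r).1 / Real.sqrt (S.f r)

theorem theta_eq (c : ℝ) (q : Fin Q) (x : Profile Q N) :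
    theta S c q x = Real.log (throughput S q x) - c / 2 * sensingGap S q x ^ 2 := rfl

theorem sensingGap_line (q : Fin Q) (y v : Profile Q N) (s : ℝ) :
    sensingGap S q (y + s • v) = sensingGap S q y + s * sensingGap S q v := by
  simp only [sensingGap, Pi.add_apply, Pi.smul_apply, Prod.fst_add, Prod.smul_fst, smul_eq_mul,
    add_div, Finset.sum_add_distrib, mul_div_assoc, ← Finset.mul_sum]
  ring

theorem contDiff_sensingGap {n : WithTop ℕ∞} (q : Fin Q) :
    ContDiff ℝ n fun y : Profile Q N => sensingGap S q y := by
  unfold sensingGap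
  fun_prop

variable {S} in
theorem RegularAt.contDiffAt_theta {q : Fin Q} {x : Profile Q N} (h : RegularAt S q x) (c : ℝ)
    {n : WithTop ℕ∞} : ContDiffAt ℝ n (theta S c q) x := by
  have h1 : ContDiffAt ℝ n (fun y => throughput S q y) x := by
    simp only [throughput_eq]
    refine ContDiffAt.mul (by fun_prop) (ContDiffAt.mul (by fun_prop) h.contDiffAt_rate)
  exact (h1.log h.throughput_pos.ne').sub
    (contDiffAt_const.mul ((contDiff_sensingGap S q).contDiffAt.pow 2))

/-! ### Derivatives of the payoff -/

/-- Directional derivative of the sum rate. -/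
def rateDeriv (q : Fin Q) (v y : Profile Q N) : ℝ :=
  ∑ k, (((v q).2.1 k + interf S q k (power v)) / (nz S q k + interf S q k (power y) + (y q).2.1 k) -
    interf S q k (power v) / (nz S q k + interf S q k (power y)))

/-- Second directional derivative of the sum rate. -/
def rateDeriv2 (q : Fin Q) (u v y : Profile Q N) : ℝ :=
  ∑ k, (interf S q k (power u) * interf S q k (power v) / (nz S q k + interf S q k (power y)) ^ 2 -
    ((u q).2.1 k + interf S q k (power u)) * ((v q).2.1 k + interf S q k (power v)) /
      (nz S q k + interf S q k (power y) + (y q).2.1 k) ^ 2)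

theorem hasDerivAt_affine (a b : ℝ) : HasDerivAt (fun s : ℝ => a + s * b) b 0 := by
  simpa using ((hasDerivAt_id (0 : ℝ)).mul_const b).const_add a

variable {S} in
theorem RegularAt.hasDerivAt_rate {q : Fin Q} {y : Profile Q N} (h : RegularAt S q y)
    (v : Profile Q N) : HasDerivAt (fun s : ℝ => rate S q (power (y + s • v)))
      (rateDeriv S q v y) 0 := by
  unfold rate rateDeriv
  refine HasDerivAt.fun_sum fun k _ => ?_
  have hB := h.den k
  have hA := h.num k
  have e : (fun s : ℝ => rateK S q k (power (y + s • v))) = fun s : ℝ =>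
      Real.log (1 + ((y q).2.1 k + s * (v q).2.1 k) /
        ((nz S q k + interf S q k (power y)) + s * interf S q k (power v))) := by
    funext s
    rw [rateK_eq, interf_line, add_assoc (nz S q k)]
    rfl
  rw [e]
  have d1 := hasDerivAt_affine ((y q).2.1 k) ((v q).2.1 k)
  have d2 := hasDerivAt_affine (nz S q k + interf S q k (power y)) (interf S q k (power v))
  have h1 := h.one_add_pos k
  have d3 := ((d1.div d2 (by simpa using hB.ne')).const_add 1).log (by simpa [power] using h1.ne')
  refine d3.congr_deriv ?_
  simp only [Pi.div_apply, zero_mul, add_zero]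
  have h2 : (1 + (y q).2.1 k / (nz S q k + interf S q k (power y))) =
      (nz S q k + interf S q k (power y) + (y q).2.1 k) /
        (nz S q k + interf S q k (power y)) := by
    field_simp
  rw [h2]
  field_simp
  ring

variable {S} in
theorem RegularAt.hasDerivAt_rateDeriv {q : Fin Q} {y : Profile Q N} (h : RegularAt S q y)
    (u v : Profile Q N) : HasDerivAt (fun s : ℝ => rateDeriv S q v (y + s • u))
      (rateDeriv2 S q u v y) 0 := by
  unfold rateDeriv rateDeriv2
  refine HasDerivAt.fun_sum fun k _ => ?_
  have hB := h.den k
  have hA := h.num k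
  have d1 := hasDerivAt_affine (nz S q k + interf S q k (power y) + (y q).2.1 k)
    ((u q).2.1 k + interf S q k (power u))
  have d2 := hasDerivAt_affine (nz S q k + interf S q k (power y)) (interf S q k (power u))
  have d3 := (((hasDerivAt_const (0 : ℝ) ((v q).2.1 k + interf S q k (power v))).div d1
    (by simpa using hA.ne')).sub ((hasDerivAt_const (0 : ℝ) (interf S q k (power v))).div d2
    (by simpa using hB.ne')))
  refine (d3.congr_of_eventuallyEq (Eventually.of_forall fun s => ?_)).congr_deriv ?_
  · simp only [Pi.sub_apply, Pi.div_apply, interf_line, Pi.add_apply, Pi.smul_apply, Prod.snd_add,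
      Prod.fst_add, Prod.smul_snd, Prod.smul_fst, smul_eq_mul]
    congr 2 <;> ring
  · simp only [zero_mul, add_zero]
    ring

/-- Directional derivative of the payoff. -/
def thetaDeriv (c : ℝ) (q : Fin Q) (v y : Profile Q N) : ℝ :=
  -(2 * (y q).1 * (v q).1 / (S.f q * S.T q)) / (1 - (y q).1 ^ 2 / (S.f q * S.T q)) -
    (v q).2.2 / (1 - (y q).2.2) + rateDeriv S q v y / rate S q (power y) -
    c * sensingGap S q y * sensingGap S q v

/-- Second directional derivative of the payoff. -/
def thetaDeriv2 (c : ℝ) (q : Fin Q) (u v y : Profile Q N) : ℝ :=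
  -(2 / (S.f q * S.T q) * (1 + (y q).1 ^ 2 / (S.f q * S.T q)) /
      (1 - (y q).1 ^ 2 / (S.f q * S.T q)) ^ 2 * ((u q).1 * (v q).1)) -
    (u q).2.2 * (v q).2.2 / (1 - (y q).2.2) ^ 2 +
    (rateDeriv2 S q u v y / rate S q (power y) -
      rateDeriv S q u y * rateDeriv S q v y / rate S q (power y) ^ 2) -
    c * sensingGap S q u * sensingGap S q v

variable {S} in
theorem RegularAt.hasDerivAt_theta {q : Fin Q} {y : Profile Q N} (h : RegularAt S q y) (c : ℝ)
    (v : Profile Q N) :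
    HasDerivAt (fun s : ℝ => theta S c q (y + s • v)) (thetaDeriv S c q v y) 0 := by
  have h1 := h.one_sub_pos
  have h2 := sub_pos.2 h.pfa_lt
  have h3 := h.rate_pos
  have d1 := ((hasDerivAt_affine (y q).1 (v q).1).pow 2).div_const (S.f q * S.T q) |>.const_sub 1
  have d2 := (hasDerivAt_affine (y q).2.2 (v q).2.2).const_sub 1
  have d4 := (d1.mul (d2.mul (h.hasDerivAt_rate v))).log (by
    have := h.throughput_pos
    rw [throughput_eq] at this
    simpa using this.ne')
  have d5 := ((hasDerivAt_affine (sensingGap S q y) (sensingGap S q v)).pow 2).const_mul (c / 2)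
  refine ((d4.sub d5).congr_of_eventuallyEq (Eventually.of_forall fun s => ?_)).congr_deriv ?_
  · simp only [theta_eq, throughput_eq, sensingGap_line]
    rfl
  · simp only [thetaDeriv, zero_mul, zero_smul, add_zero, Pi.mul_apply, Pi.pow_apply,
      Nat.cast_ofNat, Nat.add_one_sub_one, pow_one]
    have h1' := h1.ne'
    have h2' := h2.ne'
    have h3' := h3.ne'
    set w := (1 - (y q).1 ^ 2 / (S.f q * S.T q))
    set e := 1 - (y q).2.2
    set R := rate S q (power y)
    field_simp
    ring

variable {S} in
theorem RegularAt.hasDerivAt_thetaDeriv {q : Fin Q} {y : Profile Q N} (h : RegularAt S q y) (c : ℝ)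
    (u v : Profile Q N) :
    HasDerivAt (fun s : ℝ => thetaDeriv S c q v (y + s • u)) (thetaDeriv2 S c q u v y) 0 := by
  have hfT := mul_pos (S.f_pos q) (T_pos S q)
  have h1 := h.one_sub_pos
  have h2 := sub_pos.2 h.pfa_lt
  have h3 := h.rate_pos
  have d0 := hasDerivAt_affine (y q).1 (u q).1
  have d1 := (d0.pow 2).div_const (S.f q * S.T q) |>.const_sub 1
  have d2 := (hasDerivAt_affine (y q).2.2 (u q).2.2).const_sub 1
  have d3 := ((d0.const_mul 2).mul_const (v q).1).div_const (S.f q * S.T q) |>.neg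
  have d4 := d3.div d1 (by simpa using h1.ne')
  have d5 := (hasDerivAt_const (0 : ℝ) (v q).2.2).div d2 (by simpa using h2.ne')
  have d6 := (h.hasDerivAt_rateDeriv u v).div (h.hasDerivAt_rate u) (by simpa using h3.ne')
  have d7 := ((hasDerivAt_affine (sensingGap S q y) (sensingGap S q u)).const_mul c).mul_const
    (sensingGap S q v)
  refine ((((d4.sub d5).add d6).sub d7).congr_of_eventuallyEq
    (Eventually.of_forall fun s => ?_)).congr_deriv ?_
  · simp only [thetaDeriv, sensingGap_line]
    rfl
  · simp only [thetaDeriv2, zero_mul, zero_smul, add_zero, Pi.pow_apply, Pi.neg_apply,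
      Nat.cast_ofNat, Nat.add_one_sub_one, pow_one]
    have h1' := h1.ne'
    have h2' := h2.ne'
    have h3' := h3.ne'
    have hfT' := hfT.ne'
    set g := S.f q * S.T q
    -- This is the quotient rule for the sensing time term, simplified through `1 + t ^ 2 / g = w +
    -- 2 * (t ^ 2 / g)`.
    have e1 : ∀ w a b t : ℝ, w ≠ 0 → w = 1 - t ^ 2 / g →
        (-(2 * a * b / g) * w - -(2 * t * b / g) * -(2 * t * a / g)) / w ^ 2 =
        -(2 / g * (1 + t ^ 2 / g) / w ^ 2 * (a * b)) := by
      intro w a b t hw hwe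
      have : (1 + t ^ 2 / g) = w + 2 * (t ^ 2 / g) := by rw [hwe]; ring
      rw [this]
      field_simp
      ring
    rw [e1 _ _ _ _ h1' rfl]
    field_simp
    ring

variable {S} in
theorem RegularAt.pd2_theta {q : Fin Q} {x : Profile Q N} (h : RegularAt S q x) (c : ℝ)
    (u v : Profile Q N) : pd2 (theta S c q) u v x = thetaDeriv2 S c q u v x :=
  pd2_eq_of_hasDerivAt (h.eventually.mono fun _ hy => hy.hasDerivAt_theta c v)
    (h.hasDerivAt_thetaDeriv c u v)

end CogRadio
end

/-! ### Interference derivatives and the Lagrangian -/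

noncomputable section
namespace CogRadio

variable {Q N : ℕ} (S : System Q N)

/-! ### Derivatives of the interference constraint -/

/-- The argument of the tail function in the detection probability. -/
def detArg (q : Fin Q) (k : Fin N) (z : Strategy N) : ℝ :=
  (S.sd0 q k * Qinv z.2.2 - dmu S q k * z.1) / S.sd1 q k

/-- Directional derivative of `detArg`. -/
def detArgDeriv (q : Fin Q) (k : Fin N) (v z : Strategy N) : ℝ :=
  (-(S.sd0 q k * v.2.2 / gaussDens (Qinv z.2.2)) - dmu S q k * v.1) / S.sd1 q k

/-- Directional derivative of the missed detection probability. -/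
def pmissDeriv (q : Fin Q) (k : Fin N) (v z : Strategy N) : ℝ :=
  gaussDens (detArg S q k z) * detArgDeriv S q k v z

/-- Second directional derivative of the missed detection probability. -/
def pmissDeriv2 (q : Fin Q) (k : Fin N) (u v z : Strategy N) : ℝ :=
  -(detArg S q k z * gaussDens (detArg S q k z)) * detArgDeriv S q k u z * detArgDeriv S q k v z +
    gaussDens (detArg S q k z) *
      (S.sd0 q k / S.sd1 q k * (Qinv z.2.2 / gaussDens (Qinv z.2.2) ^ 2) * (u.2.2 * v.2.2))

/-- Directional derivative of the local interference. -/
def localDeriv (q : Fin Q) (v z : Strategy N) : ℝ :=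
  ∑ k, gw S q k * (pmissDeriv S q k v z * z.2.1 k + Pmiss S q k z.1 z.2.2 * v.2.1 k)

/-- Second directional derivative of the local interference. -/
def localDeriv2 (q : Fin Q) (u v z : Strategy N) : ℝ :=
  ∑ k, gw S q k * (pmissDeriv2 S q k u v z * z.2.1 k + pmissDeriv S q k v z * u.2.1 k +
    pmissDeriv S q k u z * v.2.1 k)

variable {z : Strategy N} (h0 : 0 < z.2.2) (h1 : z.2.2 < 1)

include h0 h1

theorem hasDerivAt_Qinv_line (v : Strategy N) :
    HasDerivAt (fun s : ℝ => Qinv (z + s • v).2.2) (-(v.2.2 / gaussDens (Qinv z.2.2))) 0 := by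
  have d := hasDerivAt_affine z.2.2 v.2.2
  have d2 := (show HasDerivAt Qinv (-(gaussDens (Qinv z.2.2))⁻¹) (z.2.2 + 0 * v.2.2) by
    simpa using hasDerivAt_Qinv h0 h1).comp 0 d
  exact d2.congr_deriv (by ring)

theorem hasDerivAt_detArg (q : Fin Q) (k : Fin N) (v : Strategy N) :
    HasDerivAt (fun s : ℝ => detArg S q k (z + s • v)) (detArgDeriv S q k v z) 0 := by
  have d := (((hasDerivAt_Qinv_line h0 h1 v).const_mul (S.sd0 q k)).sub
    ((hasDerivAt_affine z.1 v.1).const_mul (dmu S q k))).div_const (S.sd1 q k)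
  refine d.congr_deriv ?_
  unfold detArgDeriv
  ring

theorem hasDerivAt_Pmiss (q : Fin Q) (k : Fin N) (v : Strategy N) :
    HasDerivAt (fun s : ℝ => Pmiss S q k (z + s • v).1 (z + s • v).2.2)
      (pmissDeriv S q k v z) 0 := by
  have d := (show HasDerivAt Qfun (-gaussDens (detArg S q k z)) (detArg S q k (z + (0 : ℝ) • v)) by
    simpa using hasDerivAt_Qfun (detArg S q k z)).comp 0 (hasDerivAt_detArg S h0 h1 q k v)
  exact (d.const_sub 1).congr_deriv (by unfold pmissDeriv; ring)

theorem hasDerivAt_pmissDeriv (q : Fin Q) (k : Fin N) (u v : Strategy N) :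
    HasDerivAt (fun s : ℝ => pmissDeriv S q k v (z + s • u)) (pmissDeriv2 S q k u v z) 0 := by
  have hb := gaussDens_pos (Qinv z.2.2)
  have d1 := (show HasDerivAt gaussDens (-(detArg S q k z * gaussDens (detArg S q k z)))
    (detArg S q k (z + (0 : ℝ) • u)) by
    simpa using hasDerivAt_gaussDens (detArg S q k z)).comp 0 (hasDerivAt_detArg S h0 h1 q k u)
  have d2 := (show HasDerivAt gaussDens (-(Qinv z.2.2 * gaussDens (Qinv z.2.2)))
    (Qinv (z + (0 : ℝ) • u).2.2) by
    simpa using hasDerivAt_gaussDens (Qinv z.2.2)).comp 0 (hasDerivAt_Qinv_line h0 h1 u)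
  have d3 := (((hasDerivAt_const (0 : ℝ) (S.sd0 q k * v.2.2)).div d2
    (by simpa using hb.ne')).neg.sub_const (dmu S q k * v.1)).div_const (S.sd1 q k)
  refine (d1.mul d3).congr_deriv ?_
  simp only [Function.comp_apply, Pi.neg_apply, Pi.div_apply, zero_smul, add_zero, pmissDeriv2,
    detArgDeriv]
  have := (S.sd1_pos q k).ne'
  field_simp
  ring

theorem hasDerivAt_localI (q : Fin Q) (v : Strategy N) :
    HasDerivAt (fun s : ℝ => localI S q (z + s • v)) (localDeriv S q v z) 0 := by
  unfold localI localDeriv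
  refine HasDerivAt.sub_const _ (HasDerivAt.fun_sum fun k _ => ?_)
  have d := ((hasDerivAt_Pmiss S h0 h1 q k v).mul_const (gw S q k)).mul
    (hasDerivAt_affine (z.2.1 k) (v.2.1 k))
  refine d.congr_deriv ?_
  simp only [zero_smul, zero_mul, add_zero]
  ring

theorem hasDerivAt_localDeriv (q : Fin Q) (u v : Strategy N) :
    HasDerivAt (fun s : ℝ => localDeriv S q v (z + s • u)) (localDeriv2 S q u v z) 0 := by
  unfold localDeriv localDeriv2
  refine HasDerivAt.fun_sum fun k _ => ?_
  have d := (((hasDerivAt_pmissDeriv S h0 h1 q k u v).mul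
    (hasDerivAt_affine (z.2.1 k) (u.2.1 k))).add
      ((hasDerivAt_Pmiss S h0 h1 q k u).mul_const (v.2.1 k))).const_mul (gw S q k)
  refine d.congr_deriv ?_
  simp only [zero_smul, zero_mul, add_zero]

theorem contDiffAt_Pmiss (q : Fin Q) (k : Fin N) :
    ContDiffAt ℝ 2 (fun z : Strategy N => Pmiss S q k z.1 z.2.2) z := by
  unfold Pmiss
  have h2 : ContDiffAt ℝ 2 (fun z : Strategy N => Qinv z.2.2) z :=
    (contDiffAt_Qinv h0 h1).comp z (by fun_prop)
  exact contDiffAt_const.sub (contDiff_Qfun.contDiffAt.comp z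
    (((contDiffAt_const.mul h2).sub (by fun_prop)).div_const _))

theorem contDiffAt_localI (q : Fin Q) : ContDiffAt ℝ 2 (localI S q) z := by
  unfold localI
  exact (ContDiffAt.sum fun k _ => ((contDiffAt_Pmiss S h0 h1 q k).mul contDiffAt_const).mul
    (by fun_prop)).sub contDiffAt_const

omit h0 h1

/-! ### The Lagrangian -/

theorem globalI_eq_sum (x : Profile Q N) :
    globalI S x = ∑ r, (localI S r (x r) + S.Imax r) - S.Itot := by
  unfold globalI localI
  rw [Finset.sum_comm]
  simp

/-- Global interference is separable over users. Hence in the own variables the Lagrangian depends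
on `lam` and `price` only through their sum, and price terms drop out of all comparisons between
users. -/
theorem globalI_sub (q : Fin Q) {x y : Profile Q N} (h : ∀ r, r ≠ q → x r = y r) :
    globalI S x - globalI S y = localI S q (x q) - localI S q (y q) := by
  rw [globalI_eq_sum, globalI_eq_sum, ← Finset.add_sum_erase _ _ (Finset.mem_univ q),
    ← Finset.add_sum_erase (Finset.univ) (fun r => localI S r (y r) + S.Imax r)
      (Finset.mem_univ q)]
  have : ∑ r ∈ Finset.univ.erase q, (localI S r (x r) + S.Imax r) =
      ∑ r ∈ Finset.univ.erase q, (localI S r (y r) + S.Imax r) :=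
    Finset.sum_congr rfl fun r hr => by rw [h r (Finset.ne_of_mem_erase hr)]
  rw [this]
  ring

theorem contDiffAt_globalI {x : Profile Q N} (h0 : ∀ r, 0 < (x r).2.2) (h1 : ∀ r, (x r).2.2 < 1) :
    ContDiffAt ℝ 2 (globalI S) x := by
  have : globalI S = fun x => ∑ r, (localI S r (x r) + S.Imax r) - S.Itot :=
    funext (globalI_eq_sum S)
  rw [this]
  refine (ContDiffAt.sum fun r _ => ContDiffAt.add ?_ contDiffAt_const).sub contDiffAt_const
  exact ContDiffAt.comp (f := fun x : Profile Q N => x r) (g := localI S r) x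
    (contDiffAt_localI S (h0 r) (h1 r) r) (by fun_prop)

theorem contDiffAt_lagr {q : Fin Q} {x : Profile Q N} (h : RegularAt S q x)
    (h0 : ∀ r, 0 < (x r).2.2) (h1 : ∀ r, (x r).2.2 < 1) (c price lam : ℝ) :
    ContDiffAt ℝ 2 (lagr S c price lam q) x := by
  have h2 : ContDiffAt ℝ 2 (fun x : Profile Q N => localI S q (x q)) x :=
    ContDiffAt.comp (f := fun x : Profile Q N => x q) (g := localI S q) x
      (contDiffAt_localI S (h0 q) (h1 q) q) (by fun_prop)
  exact ((h.contDiffAt_theta c).neg.add (contDiffAt_const.mul h2)).add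
    (contDiffAt_const.mul (contDiffAt_globalI S h0 h1))

theorem line_single_same (q : Fin Q) (y : Profile Q N) (v : Strategy N) (s : ℝ) :
    (y + s • (Pi.single q v : Profile Q N)) q = y q + s • v := by
  simp

theorem line_single_ne {q r : Fin Q} (hr : r ≠ q) (y : Profile Q N) (v : Strategy N) (s : ℝ) :
    (y + s • (Pi.single q v : Profile Q N)) r = y r := by
  simp [hr]

/-- Directional derivative of the Lagrangian of user `q` in the direction of his own variables. -/
def lagrDeriv (c price lam : ℝ) (q : Fin Q) (v : Strategy N) (y : Profile Q N) : ℝ :=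
  -thetaDeriv S c q (Pi.single q v) y + (lam + price) * localDeriv S q v (y q)

variable {S}

theorem RegularAt.hasDerivAt_lagr {q : Fin Q} {y : Profile Q N} (h : RegularAt S q y)
    (c price lam : ℝ) (v : Strategy N) :
    HasDerivAt (fun s : ℝ => lagr S c price lam q (y + s • (Pi.single q v : Profile Q N)))
      (lagrDeriv S c price lam q v y) 0 := by
  have d1 := h.hasDerivAt_theta c (Pi.single q v)
  have d2 := hasDerivAt_localI S h.pfa_pos h.pfa_lt q v
  have e : (fun s : ℝ => lagr S c price lam q
      (y + s • (Pi.single q v : Profile Q N))) = fun s : ℝ =>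
      -theta S c q (y + s • (Pi.single q v : Profile Q N)) + (lam + price) * localI S q (y q + s • v) +
        price * (globalI S y - localI S q (y q)) := by
    funext s
    have := globalI_sub S q (x := y + s • (Pi.single q v : Profile Q N)) (y := y)
      fun r hr => line_single_ne hr y v s
    rw [line_single_same] at this
    rw [lagr, line_single_same, eq_add_of_sub_eq this]
    ring
  rw [e]
  exact (d1.neg.add (d2.const_mul (lam + price))).add_const _

theorem RegularAt.pd2_lagr {q : Fin Q} {x : Profile Q N} (h : RegularAt S q x)
    (c price lam : ℝ) (u v : Strategy N) :
    pd2 (lagr S c price lam q) (Pi.single q u) (Pi.single q v) x =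
      -thetaDeriv2 S c q (Pi.single q u) (Pi.single q v) x +
        (lam + price) * localDeriv2 S q u v (x q) := by
  refine pd2_eq_of_hasDerivAt (h.eventually.mono fun _ hy => hy.hasDerivAt_lagr c price lam v) ?_
  have d1 := h.hasDerivAt_thetaDeriv c (Pi.single q u) (Pi.single q v)
  have d2 := hasDerivAt_localDeriv S h.pfa_pos h.pfa_lt q u v
  refine (d1.neg.add (d2.const_mul (lam + price))).congr_of_eventuallyEq
    (Eventually.of_forall fun s => ?_)
  simp only [lagrDeriv, line_single_same]
  rfl

end CogRadio
end

/-! ### Lower bounds for the Hessian of the Lagrangian -/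

noncomputable section
namespace CogRadio

variable {Q N : ℕ} {S : System Q N}

theorem regularAt_of_mem [Nonempty (Fin N)] {q : Fin Q} {x : Profile Q N} (hx : x ∈ Yjoint S)
    (hp : 0 < ∑ k, (x q).2.1 k) : RegularAt S q x := by
  have hbox := power_mem_box S hx
  have hi : ∀ k, 0 ≤ interf S q k (power x) := fun k => interf_nonneg S k fun r _ => hbox.1 r
  have hz := hx q
  refine ⟨tau_sq_lt_of_mem hz, pfa_pos_of_mem hz, by linarith [pfa_le_of_mem hz], fun k => ?_,
    fun k => ?_, ?_⟩
  · linarith [nz_pos S q k, hi k]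
  · linarith [nz_pos S q k, hi k, pow_nonneg_of_mem hz k]
  · exact (mul_pos (rMin_pos S q) hp).trans_le (rMin_mul_le_rate S hbox.1 hbox.2)

theorem interf_single_self (q : Fin Q) (k : Fin N) (v : Strategy N) :
    interf S q k (power (Pi.single q v)) = 0 :=
  Finset.sum_eq_zero fun r hr => by simp [power, Finset.ne_of_mem_erase hr]

theorem pd2_sum_sum {F : Profile Q N → ℝ} {x : Profile Q N} (hF : ContDiffAt ℝ 2 F x)
    {ι κ : Type} [Fintype ι] [Fintype κ] (a : ι → ℝ) (b : κ → ℝ) (U : ι → Profile Q N)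
    (V : κ → Profile Q N) :
    pd2 F (∑ i, a i • U i) (∑ j, b j • V j) x = ∑ i, a i * ∑ j, pd2 F (U i) (V j) x * b j := by
  simp only [pd2_eq_fderiv hF, map_sum, map_smul, sum_apply, smul_apply, smul_eq_mul,
    Finset.mul_sum]
  rw [Finset.sum_comm]
  exact Finset.sum_congr rfl fun i _ => Finset.sum_congr rfl fun j _ => by ring

theorem pd2_add_add {F : Profile Q N → ℝ} {x : Profile Q N} (hF : ContDiffAt ℝ 2 F x)
    (u v : Profile Q N) :
    pd2 F (u + v) (u + v) x = pd2 F u u x + 2 * pd2 F u v x + pd2 F v v x := by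
  have := pd2_comm hF u v
  simp only [pd2_eq_fderiv hF, map_add, add_apply] at this ⊢
  linarith

theorem sum_smul_ePF (q : Fin Q) (v : Fin N ⊕ Unit → ℝ) :
    ∑ i, v i • (ePF q i : Profile Q N) =
      Pi.single q (0, fun k => v (Sum.inl k), v (Sum.inr ())) := by
  funext r
  by_cases hr : r = q
  · subst hr
    simp only [Fintype.sum_sum_type, ePF, ePow, eFa, Sum.elim_inl, Sum.elim_inr,
      Finset.univ_unique, Finset.sum_singleton, Finset.sum_apply, Pi.smul_apply,
      Pi.single_eq_same]
    ext k
    · simp [Prod.fst_sum]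
    · simp [Prod.snd_sum, Prod.fst_sum, Pi.single_apply]
    · simp [Prod.snd_sum]
  · simp [ePF, ePow, eFa, Fintype.sum_sum_type, Pi.single_eq_of_ne hr]

/-! ### Bounds on the second derivatives of the Lagrangian -/

section Bounds

variable {q : Fin Q} {z : Strategy N} (hz : z ∈ Yset S q)

include hz

theorem Qinv_le_of_mem (k : Fin N) : Qinv z.2.2 ≤ dmu S q k / S.sd0 q k * tauHatMax S q := by
  have h0 := S.sd0_pos q k
  have h1 := Qinv_le_faArg_of_mem hz k
  have h2 : faArg S q k z.1 ≤ dmu S q k / S.sd0 q k * tauHatMax S q := by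
    rw [faArg, div_mul_eq_mul_div]
    apply div_le_div_of_nonneg_right _ h0.le
    have h3 := mul_nonpos_of_nonneg_of_nonpos (S.sd1_pos q k).le (alphaHat_nonpos S q k)
    have h4 := mul_le_mul_of_nonneg_left (tau_le_of_mem hz) (dmu_pos S q k).le
    linarith
  exact h1.trans h2

theorem detArg_nonpos (k : Fin N) : detArg S q k z ≤ 0 :=
  (detArg_le_of_mem S hz k).trans (alphaHat_nonpos S q k)

theorem neg_detArg_le (k : Fin N) :
    -detArg S q k z ≤ dmu S q k / S.sd1 q k * tauHatMax S q := by
  rw [detArg, ← neg_div, div_mul_eq_mul_div]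
  apply div_le_div_of_nonneg_right _ (S.sd1_pos q k).le
  have h3 := mul_nonneg (S.sd0_pos q k).le (Qinv_nonneg_of_mem hz)
  have h4 := mul_le_mul_of_nonneg_left (tau_le_of_mem hz) (dmu_pos S q k).le
  linarith

/-- The exponent of the ratio is half the difference of squares; the square of `detArg` is discarded
and `Qinv` is bounded above. -/
theorem gaussDens_ratio_le (k : Fin N) : gaussDens (detArg S q k z) / gaussDens (Qinv z.2.2) ≤
    Real.exp ((dmu S q k / S.sd0 q k * tauHatMax S q) ^ 2 / 2) := by
  rw [gaussDens_div, Real.exp_le_exp]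
  have := pow_le_pow_left₀ (Qinv_nonneg_of_mem hz) (Qinv_le_of_mem hz k) 2
  nlinarith [sq_nonneg (detArg S q k z)]

/-- Both summands have a sign because `detArg ≤ 0` (from `alpha ≤ 1/2`) and `Qinv ≥ 0` (from `beta ≤
1/2`). Only the products of powers with missed detection probabilities remain as a source of
nonconvexity. -/
theorem pmissDeriv2_self_nonneg (k : Fin N) (v : Strategy N) : 0 ≤ pmissDeriv2 S q k v v z := by
  have h1 := detArg_nonpos hz k
  have h2 := gaussDens_pos (detArg S q k z)
  have h3 := Qinv_nonneg_of_mem hz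
  have h0 := S.sd0_pos q k
  have h4 := S.sd1_pos q k
  unfold pmissDeriv2
  have h5 : 0 ≤ -(detArg S q k z * gaussDens (detArg S q k z)) := by nlinarith
  rw [mul_assoc (-(detArg S q k z * gaussDens (detArg S q k z)))]
  exact add_nonneg (mul_nonneg h5 (mul_self_nonneg _))
    (mul_nonneg h2.le (mul_nonneg (by positivity) (mul_self_nonneg _)))

omit hz in
theorem abs_pmissDeriv_tau_le (k : Fin N) : |pmissDeriv S q k (1, 0, 0) z| ≤ omTau S q k := by
  have h2 := gaussDens_pos (detArg S q k z)
  have h4 := S.sd1_pos q k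
  have h5 := dmu_pos S q k
  have e : pmissDeriv S q k (1, 0, 0) z =
      -(gaussDens (detArg S q k z) * (dmu S q k / S.sd1 q k)) := by
    simp only [pmissDeriv, detArgDeriv]; ring
  rw [e, abs_neg, abs_of_pos (by positivity), omTau]
  exact mul_le_mul_of_nonneg_right (gaussDens_le _) (by positivity)

theorem abs_pmissDeriv_pf_le (k : Fin N) (p : Fin N → ℝ) (w : ℝ) :
    |pmissDeriv S q k (0, p, w) z| ≤ omFa S q k * |w| := by
  have h2 := gaussDens_pos (detArg S q k z)
  have h3 := gaussDens_pos (Qinv z.2.2)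
  have h4 := S.sd1_pos q k
  have h5 := S.sd0_pos q k
  have e : pmissDeriv S q k (0, p, w) z = -(S.sd0 q k / S.sd1 q k *
      (gaussDens (detArg S q k z) / gaussDens (Qinv z.2.2)) * w) := by
    simp only [pmissDeriv, detArgDeriv]; ring
  rw [e, abs_neg, abs_mul, abs_of_pos (by positivity), omFa]
  gcongr
  exact gaussDens_ratio_le hz k

theorem abs_pmissDeriv2_tau_fa_le (k : Fin N) (p p' : Fin N → ℝ) :
    |pmissDeriv2 S q k (1, p, 0) (0, p', 1) z| ≤ omTauFa S q k := by
  have h2 := gaussDens_pos (detArg S q k z)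
  have h3 := gaussDens_pos (Qinv z.2.2)
  have h4 := S.sd1_pos q k
  have h5 := S.sd0_pos q k
  have h6 := dmu_pos S q k
  have h7 := detArg_nonpos hz k
  have e : pmissDeriv2 S q k (1, p, 0) (0, p', 1) z = dmu S q k * S.sd0 q k / S.sd1 q k ^ 2 *
      -detArg S q k z * (gaussDens (detArg S q k z) / gaussDens (Qinv z.2.2)) := by
    simp only [pmissDeriv2, detArgDeriv]
    field_simp
    ring
  have h8 : 0 ≤ -detArg S q k z := by linarith
  rw [e, abs_of_nonneg (by positivity), omTauFa]
  have h9 := (neg_detArg_le hz k).trans (le_max_right (Qinv (S.alpha q k)) _)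
  have h10 := gaussDens_ratio_le hz k
  have h11 := h8.trans h9
  gcongr

theorem pfaMin_le_of_mem [Nonempty (Fin N)] : pfaMin S q ≤ z.2.2 := by
  let k : Fin N := Classical.arbitrary _
  refine (iInf_le_of_fin _ k).trans ?_
  rw [← Qinv_le_iff (pfa_pos_of_mem hz) (by linarith [pfa_le_of_mem hz])]
  have := Qinv_le_of_mem hz k
  rwa [div_mul_eq_mul_div] at this

theorem dFa_le_of_mem [Nonempty (Fin N)] : dFa S q ≤ 1 / (1 - z.2.2) ^ 2 := by
  have h1 := pfaMin_le_of_mem hz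
  have h2 := pfa_le_of_mem hz
  unfold dFa
  apply one_div_le_one_div_of_le (by nlinarith)
  exact pow_le_pow_left₀ (by linarith) (by linarith) 2

theorem dTau_le_of_mem : dTau S q ≤ 2 / (S.f q * S.T q) * (1 + z.1 ^ 2 / (S.f q * S.T q)) /
    (1 - z.1 ^ 2 / (S.f q * S.T q)) ^ 2 := by
  have hf := S.f_pos q
  have hT := T_pos S q
  have h1 : S.tauMin q / S.T q ≤ z.1 ^ 2 / (S.f q * S.T q) := by
    rw [div_le_div_iff₀ hT (by positivity)]
    have := tauMin_mul_le_of_mem hz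
    nlinarith
  have h2 : 0 < 1 - z.1 ^ 2 / (S.f q * S.T q) := by
    rw [sub_pos, div_lt_one (by positivity)]
    exact tau_sq_lt_of_mem hz
  have h3 : 0 < S.tauMin q / S.T q := div_pos (S.tauMin_pos q) hT
  unfold dTau
  have h4 : 0 ≤ z.1 ^ 2 / (S.f q * S.T q) := by positivity
  gcongr

end Bounds

theorem gw_mul_le_cross {q : Fin Q} {t lam price : ℝ} (hlam : lam ∈ Set.Icc 0 (lamMax S))
    (hprice : price ∈ Set.Icc 0 t) (k : Fin N) : (lam + price) * gw S q k ≤ cross S q t := by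
  have h1 : lam + price ≤ 2 * max t (lamMax S) := by
    linarith [hlam.2, hprice.2, le_max_left t (lamMax S), le_max_right t (lamMax S)]
  have h2 := le_iSup_of_fin (fun k => gw S q k) k
  have h3 := gw_nonneg S q k
  have h4 : 0 ≤ lam + price := add_nonneg hlam.1 hprice.1
  exact mul_le_mul h1 h2 h3 (h4.trans h1)

theorem dRate_le [Nonempty (Fin N)] {q : Fin Q} {x : Profile Q N} (hx : x ∈ Yjoint S)
    (h : RegularAt S q x) (k : Fin N) : dRate S q k ≤ 1 / rate S q (power x) /
      (nz S q k + interf S q k (power x) + (x q).2.1 k) ^ 2 := by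
  have hbox := power_mem_box S hx
  have h1 : rate S q (power x) ≤ rMax S q :=
    rate_le_rMax S (hbox.1 q) (hbox.2 q) fun r _ => hbox.1 r
  have h2 : nz S q k + interf S q k (power x) + (x q).2.1 k ≤
      nz S q k + ∑ r, Hsq S q r k * S.pmax r k := by
    rw [← Finset.add_sum_erase _ _ (Finset.mem_univ q), Hsq_self, one_mul]
    have h3 : interf S q k (power x) ≤ interf S q k S.pmax := interf_mono S k fun r _ => hbox.2 r
    have h4 : (x q).2.1 k ≤ S.pmax q k := hbox.2 q k
    unfold interf at h3 ⊢
    linarith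
  have h5 := h.num k
  have h6 := h.rate_pos
  unfold dRate
  gcongr

section Hessian

variable [Nonempty (Fin N)] {q : Fin Q} {x : Profile Q N} (hx : x ∈ Yjoint S)
  (h : RegularAt S q x) {t lam price : ℝ} (hlam : lam ∈ Set.Icc 0 (lamMax S))
  (hprice : price ∈ Set.Icc 0 t)

include hx h hlam hprice

omit [Nonempty (Fin N)] in
theorem dTau_le_pd2 : dTau S q ≤ pd2 (lagr S 0 price lam q) (eTau q) (eTau q) x := by
  rw [eTau, h.pd2_lagr]
  have h1 := dTau_le_of_mem (hx q)
  have h2 : 0 ≤ localDeriv2 S q (1, 0, 0) (1, 0, 0) (x q) := by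
    refine Finset.sum_nonneg fun k _ => mul_nonneg (gw_nonneg S q k) ?_
    have := mul_nonneg (pmissDeriv2_self_nonneg (hx q) k (1, 0, 0)) (pow_nonneg_of_mem (hx q) k)
    simpa using this
  have h3 := mul_nonneg (add_nonneg hlam.1 hprice.1) h2
  simp only [thetaDeriv2, rateDeriv, rateDeriv2, interf_single_self, Pi.single_eq_same,
    Pi.zero_apply]
  simp
  linarith

omit [Nonempty (Fin N)] hx in
theorem abs_pd2_tau_pow_le (k : Fin N) :
    |pd2 (lagr S 0 price lam q) (eTau q) (ePow q k) x| ≤ cross S q t * omTau S q k := by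
  have e : pd2 (lagr S 0 price lam q) (eTau q) (ePow q k) x =
      (lam + price) * gw S q k * pmissDeriv S q k (1, 0, 0) (x q) := by
    rw [eTau, ePow, h.pd2_lagr]
    simp only [thetaDeriv2, rateDeriv, rateDeriv2, interf_single_self, Pi.single_eq_same,
      Pi.zero_apply, localDeriv2, pmissDeriv2, pmissDeriv, detArgDeriv]
    simp [Pi.single_apply]
    ring
  have h1 := mul_nonneg (add_nonneg hlam.1 hprice.1) (gw_nonneg S q k)
  rw [e, abs_mul, abs_of_nonneg h1]
  exact mul_le_mul (gw_mul_le_cross hlam hprice k) (abs_pmissDeriv_tau_le k)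
    (abs_nonneg _) (h1.trans (gw_mul_le_cross hlam hprice k))

omit [Nonempty (Fin N)] in
theorem abs_pd2_tau_fa_le : |pd2 (lagr S 0 price lam q) (eTau q) (eFa q) x| ≤
    cross S q t * ∑ k, omTauFa S q k * S.pmax q k := by
  have e : pd2 (lagr S 0 price lam q) (eTau q) (eFa q) x =
      ∑ k, (lam + price) * gw S q k *
        (pmissDeriv2 S q k (1, 0, 0) (0, 0, 1) (x q) * (x q).2.1 k) := by
    rw [eTau, eFa, h.pd2_lagr]
    simp only [thetaDeriv2, rateDeriv, rateDeriv2, interf_single_self, Pi.single_eq_same,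
      Pi.zero_apply, localDeriv2]
    simp [Finset.mul_sum, mul_assoc]
  rw [e, Finset.mul_sum]
  refine (Finset.abs_sum_le_sum_abs _ _).trans (Finset.sum_le_sum fun k _ => ?_)
  have h1 := mul_nonneg (add_nonneg hlam.1 hprice.1) (gw_nonneg S q k)
  have h2 := pow_nonneg_of_mem (hx q) k
  have h3 := abs_pmissDeriv2_tau_fa_le (hx q) k 0 0
  rw [abs_mul, abs_of_nonneg h1, abs_mul, abs_of_nonneg h2]
  exact mul_le_mul (gw_mul_le_cross hlam hprice k)
    (mul_le_mul h3 (pow_le_of_mem (hx q) k) h2 ((abs_nonneg _).trans h3))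
    (by positivity) (h1.trans (gw_mul_le_cross hlam hprice k))

theorem l2_pd2_le_varsigmaUp :
    l2 (fun i => pd2 (lagr S 0 price lam q) (eTau q) (ePF q i) x) ≤ varsigmaUp S q t := by
  have hc : 0 ≤ cross S q t :=
    (mul_nonneg (add_nonneg hlam.1 hprice.1) (gw_nonneg S q _)).trans
      (gw_mul_le_cross hlam hprice (Classical.arbitrary _))
  rw [varsigmaUp, ← abs_of_nonneg hc, ← l2_smul]
  refine l2_mono fun i => ?_
  rcases i with k | _
  · exact (abs_pd2_tau_pow_le h hlam hprice k).trans (le_abs_self _)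
  · exact (abs_pd2_tau_fa_le hx h hlam hprice).trans (le_abs_self _)

/-- The square of the logarithmic derivative of the rate and the second derivatives of missed
detection are nonnegative and are dropped. The rate and false alarm terms provide the diagonal, and
the cross terms between `p` and `w` are taken with their worst sign. -/
theorem pd2_pf_ge (p : Fin N → ℝ) (w : ℝ) :
    ∑ k, dRate S q k * p k ^ 2 - 4 * (∑ k, cross S q t * omFa S q k * |p k|) * |w| +
      dFa S q * w ^ 2 ≤
    pd2 (lagr S 0 price lam q) (Pi.single q (0, p, w)) (Pi.single q (0, p, w)) x := by
  have hR := h.rate_pos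
  have e : pd2 (lagr S 0 price lam q) (Pi.single q (0, p, w)) (Pi.single q (0, p, w)) x =
      1 / (1 - (x q).2.2) ^ 2 * w ^ 2 +
      (∑ k, 1 / rate S q (power x) /
        (nz S q k + interf S q k (power x) + (x q).2.1 k) ^ 2 * p k ^ 2 +
        (rateDeriv S q (Pi.single q (0, p, w)) x / rate S q (power x)) ^ 2) +
      ∑ k, ((lam + price) * gw S q k *
        (pmissDeriv2 S q k (0, p, w) (0, p, w) (x q) * (x q).2.1 k) +
        2 * ((lam + price) * gw S q k * (pmissDeriv S q k (0, p, w) (x q) * p k))) := by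
    rw [h.pd2_lagr]
    have e1 : rateDeriv2 S q (Pi.single q (0, p, w)) (Pi.single q (0, p, w)) x /
        rate S q (power x) = -∑ k, 1 / rate S q (power x) /
        (nz S q k + interf S q k (power x) + (x q).2.1 k) ^ 2 * p k ^ 2 := by
      simp only [rateDeriv2, interf_single_self, Pi.single_eq_same, Finset.sum_div]
      rw [← Finset.sum_neg_distrib]
      refine Finset.sum_congr rfl fun k _ => ?_
      ring
    have e2 : (lam + price) * localDeriv2 S q (0, p, w) (0, p, w) (x q) =
        ∑ k, ((lam + price) * gw S q k *
        (pmissDeriv2 S q k (0, p, w) (0, p, w) (x q) * (x q).2.1 k) +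
        2 * ((lam + price) * gw S q k * (pmissDeriv S q k (0, p, w) (x q) * p k))) := by
      rw [localDeriv2, Finset.mul_sum]
      refine Finset.sum_congr rfl fun k _ => ?_
      ring
    rw [e2, thetaDeriv2, e1]
    simp only [Pi.single_eq_same]
    ring
  rw [e]
  have h1 : ∑ k, dRate S q k * p k ^ 2 ≤ ∑ k, 1 / rate S q (power x) /
        (nz S q k + interf S q k (power x) + (x q).2.1 k) ^ 2 * p k ^ 2 :=
    Finset.sum_le_sum fun k _ => mul_le_mul_of_nonneg_right (dRate_le hx h k) (sq_nonneg _)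
  have h2 := mul_le_mul_of_nonneg_right (dFa_le_of_mem (hx q)) (sq_nonneg w)
  have h3 := sq_nonneg (rateDeriv S q (Pi.single q (0, p, w)) x / rate S q (power x))
  -- A factor 2 would be enough for these cross terms; 4 is the factor occurring in the quadratic
  -- form of `LbarBlock`.
  have h4 : -(4 * (∑ k, cross S q t * omFa S q k * |p k|) * |w|) ≤
      ∑ k, ((lam + price) * gw S q k *
        (pmissDeriv2 S q k (0, p, w) (0, p, w) (x q) * (x q).2.1 k) +
        2 * ((lam + price) * gw S q k * (pmissDeriv S q k (0, p, w) (x q) * p k))) := by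
    rw [Finset.mul_sum, Finset.sum_mul, ← Finset.sum_neg_distrib]
    refine Finset.sum_le_sum fun k _ => ?_
    have g0 := mul_nonneg (add_nonneg hlam.1 hprice.1) (gw_nonneg S q k)
    have g1 := gw_mul_le_cross (q := q) hlam hprice k
    have g2 := mul_nonneg g0 (mul_nonneg (pmissDeriv2_self_nonneg (hx q) k (0, p, w))
      (pow_nonneg_of_mem (hx q) k))
    have g3 := abs_pmissDeriv_pf_le (hx q) k p w
    have g4 : |(lam + price) * gw S q k * (pmissDeriv S q k (0, p, w) (x q) * p k)| ≤
        cross S q t * (omFa S q k * |w| * |p k|) := by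
      rw [abs_mul, abs_mul (pmissDeriv S q k (0, p, w) (x q)), abs_of_nonneg g0]
      exact mul_le_mul g1 (mul_le_mul_of_nonneg_right g3 (abs_nonneg _)) (by positivity)
        (g0.trans g1)
    have g5 := neg_abs_le ((lam + price) * gw S q k * (pmissDeriv S q k (0, p, w) (x q) * p k))
    have g6 := (abs_nonneg _).trans g4
    nlinarith
  linarith

end Hessian

theorem isHermitian_LbarBlock (q : Fin Q) (t : ℝ) : (LbarBlock S q t).IsHermitian := by
  refine Matrix.IsHermitian.ext fun i j => ?_
  rcases i with i | i <;> rcases j with j | j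
  · simp [LbarBlock, Matrix.diagonal_apply]
    by_cases hij : i = j
    · simp [hij]
    · simp [hij, Ne.symm hij]
  all_goals simp [LbarBlock]

theorem quadForm_LbarBlock (q : Fin Q) (t : ℝ) (v : Fin N ⊕ Unit → ℝ) :
    dotProduct v ((LbarBlock S q t).mulVec v) =
      ∑ k, dRate S q k * v (Sum.inl k) ^ 2 -
        4 * (∑ k, cross S q t * omFa S q k * v (Sum.inl k)) * v (Sum.inr ()) +
        dFa S q * v (Sum.inr ()) ^ 2 := by
  simp only [dotProduct, Matrix.mulVec, LbarBlock, Fintype.sum_sum_type,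
    Matrix.fromBlocks_apply₁₁, Matrix.fromBlocks_apply₁₂, Matrix.fromBlocks_apply₂₁,
    Matrix.fromBlocks_apply₂₂, Matrix.of_apply, Finset.univ_unique, Finset.sum_singleton,
    Matrix.diagonal_apply, ite_mul, zero_mul, Finset.sum_ite_eq, Finset.mem_univ, if_true]
  have e1 : ∑ k, v (Sum.inl k) * (dRate S q k * v (Sum.inl k) +
      -(cross S q t * (2 * omFa S q k)) * v (Sum.inr default)) =
      ∑ k, dRate S q k * v (Sum.inl k) ^ 2 -
        2 * (∑ k, cross S q t * omFa S q k * v (Sum.inl k)) * v (Sum.inr ()) := by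
    rw [Finset.mul_sum, Finset.sum_mul, ← Finset.sum_sub_distrib]
    exact Finset.sum_congr rfl fun k _ => by ring
  have e2 : ∑ k, -(cross S q t * (2 * omFa S q k)) * v (Sum.inl k) =
      -(2 * ∑ k, cross S q t * omFa S q k * v (Sum.inl k)) := by
    rw [Finset.mul_sum, ← Finset.sum_neg_distrib]
    exact Finset.sum_congr rfl fun k _ => by ring
  rw [e1, e2]
  ring

/-- The Hessian block of the Lagrangian in the directions `(p_q, P_fa)`. -/
def pfHessian (S : System Q N) (price lam : ℝ) (q : Fin Q) (x : Profile Q N) :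
    Matrix (Fin N ⊕ Unit) (Fin N ⊕ Unit) ℝ :=
  Matrix.of fun i j => pd2 (lagr S 0 price lam q) (ePF q i) (ePF q j) x

section LeastEig

variable {q : Fin Q} {x : Profile Q N} {t lam price : ℝ}
  (hC : ContDiffAt ℝ 2 (lagr S 0 price lam q) x)

include hC

theorem isHermitian_pfHessian : (pfHessian S price lam q x).IsHermitian :=
  Matrix.IsHermitian.ext fun _ _ => pd2_comm hC _ _

theorem quadForm_pfHessian (v : Fin N ⊕ Unit → ℝ) :
    dotProduct v ((pfHessian S price lam q x).mulVec v) =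
      pd2 (lagr S 0 price lam q) (Pi.single q (0, fun k => v (Sum.inl k), v (Sum.inr ())))
        (Pi.single q (0, fun k => v (Sum.inl k), v (Sum.inr ()))) x := by
  rw [← sum_smul_ePF, pd2_sum_sum hC]
  rfl

theorem Bmat_eq : Bmat S price lam q x =
    !![pd2 (lagr S 0 price lam q) (eTau q) (eTau q) x,
      -l2 (fun i => pd2 (lagr S 0 price lam q) (eTau q) (ePF q i) x);
    -l2 (fun i => pd2 (lagr S 0 price lam q) (eTau q) (ePF q i) x),
      leastEig (pfHessian S price lam q x)] := by
  have : (fun i => pd2 (lagr S 0 price lam q) (ePF q i) (eTau q) x) =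
      fun i => pd2 (lagr S 0 price lam q) (eTau q) (ePF q i) x :=
    funext fun i => pd2_comm hC _ _
  rw [Bmat, this]
  rfl

/-- The direction splits into its sensing time part and its `(p, P_fa)` part. Cauchy-Schwarz on the
mixed term reduces the Hessian form to the two by two form of `Bmat` at the pair of block lengths.
-/
theorem leastEig_Bmat_mul_le (d : Strategy N) :
    leastEig (Bmat S price lam q x) * (d.1 ^ 2 + (∑ k, d.2.1 k ^ 2 + d.2.2 ^ 2)) ≤
      pd2 (lagr S 0 price lam q) (Pi.single q d) (Pi.single q d) x := by
  set v : Fin N ⊕ Unit → ℝ := Sum.elim d.2.1 fun _ => d.2.2 with hv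
  have e1 : (Pi.single q d : Profile Q N) = d.1 • eTau q + ∑ i, v i • ePF q i := by
    rw [sum_smul_ePF, eTau]
    funext r
    by_cases hr : r = q
    · subst hr
      ext <;> simp [hv]
    · simp [hr]
  have hs : ∑ k, d.2.1 k ^ 2 + d.2.2 ^ 2 = l2 v ^ 2 := by simp [l2_sq, hv]
  have e2 : pd2 (lagr S 0 price lam q) (d.1 • eTau q) (∑ i, v i • ePF q i) x =
      d.1 * ∑ i, pd2 (lagr S 0 price lam q) (eTau q) (ePF q i) x * v i := by
    have := pd2_sum_sum hC (fun _ : Unit => d.1) v (fun _ => eTau q) (ePF q)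
    simpa using this
  have e3 : pd2 (lagr S 0 price lam q) (d.1 • eTau q) (d.1 • eTau q) x =
      pd2 (lagr S 0 price lam q) (eTau q) (eTau q) x * d.1 ^ 2 := by
    simp only [pd2_eq_fderiv hC, map_smul, smul_apply, smul_eq_mul]
    ring
  have h1 := leastEig_mul_le (isHermitian_pfHessian hC) v
  rw [quadForm_pfHessian hC, ← sum_smul_ePF, ← l2_sq] at h1
  have h2 := abs_sum_mul_le_l2 (fun i => pd2 (lagr S 0 price lam q) (eTau q) (ePF q i) x) v
  have h3 := leastEig_fin_two_mul_le (pd2 (lagr S 0 price lam q) (eTau q) (eTau q) x)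
    (l2 fun i => pd2 (lagr S 0 price lam q) (eTau q) (ePF q i) x)
    (leastEig (pfHessian S price lam q x)) |d.1| (l2 v)
  rw [sq_abs, ← Bmat_eq hC] at h3
  have h4 : -(|d.1| * (l2 (fun i => pd2 (lagr S 0 price lam q) (eTau q) (ePF q i) x) * l2 v)) ≤
      d.1 * ∑ i, pd2 (lagr S 0 price lam q) (eTau q) (ePF q i) x * v i := by
    refine le_trans ?_ (neg_abs_le _)
    rw [abs_mul]
    exact neg_le_neg (mul_le_mul_of_nonneg_left h2 (abs_nonneg _))
  rw [hs, e1, pd2_add_add hC, e2, e3]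
  linarith

theorem leastEig_Blow_le_leastEig_Bmat [Nonempty (Fin N)] (hx : x ∈ Yjoint S)
    (h : RegularAt S q x) (hlam : lam ∈ Set.Icc 0 (lamMax S)) (hprice : price ∈ Set.Icc 0 t) :
    leastEig (Blow S q t) ≤ leastEig (Bmat S price lam q x) := by
  rw [Bmat_eq hC, Blow]
  refine leastEig_fin_two_mono (dTau_le_pd2 hx h hlam hprice) ?_ ?_
  · rw [abs_of_nonneg (l2_nonneg _)]
    exact l2_pd2_le_varsigmaUp hx h hlam hprice
  · refine le_leastEig (isHermitian_pfHessian hC) fun v => ?_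
    -- The form of `LbarBlock` is tested at absolute values, which leave the squares unchanged and
    -- produce exactly the cross terms of `pd2_pf_ge`.
    have h1 := leastEig_mul_le (isHermitian_LbarBlock (S := S) q t) fun i => |v i|
    rw [quadForm_LbarBlock] at h1
    simp only [sq_abs] at h1
    rw [quadForm_pfHessian hC]
    exact h1.trans (pd2_pf_ge hx h hlam hprice _ _)

end LeastEig

end CogRadio
end

/-! ### Strong convexity constants and coupling coefficients -/

noncomputable section
namespace CogRadio

variable {Q N : ℕ} {S : System Q N}

theorem powLow_pos [Nonempty (Fin N)] (pref : Fin Q → Fin N → ℝ) (q : Fin Q) (t : ℝ) :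
    0 < powLow S pref q t :=
  mul_pos (iInf_pos_of_fin (nz_pos S q)) (Real.exp_pos _)

theorem regularAt_of_mem_Yhat [Nonempty (Fin N)] {pref : Fin Q → Fin N → ℝ} {t : ℝ} {q : Fin Q}
    {x : Profile Q N} (hx : x ∈ Yjoint S) (hq : x q ∈ YhatSet S pref q t) : RegularAt S q x :=
  regularAt_of_mem hx ((powLow_pos pref q t).trans_le hq.2)

theorem mem_Yjoint_of {q : Fin Q} {x : Profile Q N} (hq : x q ∈ Yset S q)
    (hx : ∀ r, r ≠ q → x r ∈ Yset S r) : x ∈ Yjoint S := fun r => by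
  by_cases hr : r = q
  · subst hr; exact hq
  · exact hx r hr

theorem convex_YhatSet (pref : Fin Q → Fin N → ℝ) (q : Fin Q) (t : ℝ) :
    Convex ℝ (YhatSet S pref q t) := by
  intro z hz z' hz' a b ha hb hab
  refine ⟨convex_Yset S q hz.1 hz'.1 ha hb hab, ?_⟩
  simp only [Prod.fst_add, Prod.snd_add, Prod.smul_fst, Prod.smul_snd, Pi.add_apply, Pi.smul_apply,
    smul_eq_mul, Finset.sum_add_distrib, ← Finset.mul_sum]
  exact le_combo ha hb hab hz.2 hz'.2

theorem contDiffAt_lagr_of_mem [Nonempty (Fin N)] {q : Fin Q} {x : Profile Q N}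
    (hx : x ∈ Yjoint S) (h : RegularAt S q x) (c price lam : ℝ) :
    ContDiffAt ℝ 2 (lagr S c price lam q) x :=
  contDiffAt_lagr S h (fun r => pfa_pos_of_mem (hx r))
    (fun r => by linarith [pfa_le_of_mem (hx r)]) c price lam

/-! ### The constants `ρ_q(t)` -/

section Rho

variable [Nonempty (Fin N)] {pref : Fin Q → Fin N → ℝ} {q : Fin Q} {t : ℝ}

omit [Nonempty (Fin N)] in
theorem leastEig_Blow_eq (h : 0 < rhoLow S q t) : leastEig (Blow S q t) = rhoLow S q t := by
  unfold rhoLow at *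
  rcases lt_max_iff.1 h with h | h
  · exact (max_eq_left h.le).symm
  · exact absurd h (lt_irrefl _)

theorem rhoLow_le_leastEig_Bmat (h : 0 < rhoLow S q t) {x : Profile Q N} (hx : x ∈ Yjoint S)
    (hq : x q ∈ YhatSet S pref q t) {lam price : ℝ} (hlam : lam ∈ Set.Icc 0 (lamMax S))
    (hprice : price ∈ Set.Icc 0 t) : rhoLow S q t ≤ leastEig (Bmat S price lam q x) := by
  have hr := regularAt_of_mem_Yhat hx hq
  rw [← leastEig_Blow_eq h]
  exact leastEig_Blow_le_leastEig_Bmat (contDiffAt_lagr_of_mem hx hr 0 price lam) hx hr hlam hprice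

theorem rhoLow_le_rho (h : 0 < rhoLow S q t) (ht : 0 ≤ t) {x : Profile Q N} (hx : x ∈ Yjoint S)
    (hq : x q ∈ YhatSet S pref q t) : rhoLow S q t ≤ rho S pref q t := by
  refine le_trans ?_ (le_max_left _ _)
  -- A point of the set is required: over the empty set the infimum would be 0 and the bound would
  -- fail.
  refine le_csInf ⟨_, x, 0, 0, hq, fun r _ => hx r, ⟨le_rfl, lamMax_nonneg S⟩, ⟨le_rfl, ht⟩, rfl⟩ ?_
  rintro m ⟨y, lam, price, hyq, hy, hlam, hprice, rfl⟩
  exact rhoLow_le_leastEig_Bmat h (mem_Yjoint_of hyq.1 hy) hyq hlam hprice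

/-- The uniform bound `rhoLow` makes the set bounded below, so its infimum really bounds its
elements; its positivity handles the case where the positive part is 0. -/
theorem rho_le_leastEig_Bmat (h : 0 < rhoLow S q t) {x : Profile Q N} (hx : x ∈ Yjoint S)
    (hq : x q ∈ YhatSet S pref q t) {lam price : ℝ} (hlam : lam ∈ Set.Icc 0 (lamMax S))
    (hprice : price ∈ Set.Icc 0 t) : rho S pref q t ≤ leastEig (Bmat S price lam q x) := by
  refine max_le (csInf_le ⟨rhoLow S q t, ?_⟩
    ⟨x, lam, price, hq, fun r _ => hx r, hlam, hprice, rfl⟩)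
    (h.le.trans (rhoLow_le_leastEig_Bmat h hx hq hlam hprice))
  rintro m ⟨y, lam, price, hyq, hy, hlam, hprice, rfl⟩
  exact rhoLow_le_leastEig_Bmat h (mem_Yjoint_of hyq.1 hy) hyq hlam hprice

end Rho

theorem rho_nonneg (pref : Fin Q → Fin N → ℝ) (q : Fin Q) (t : ℝ) : 0 ≤ rho S pref q t :=
  le_max_right _ _

/-- The diagonal entries of `Ddiag`. -/
def dEntry (S : System Q N) (c : ℝ) (q : Fin Q) (rho : ℝ) : Fin 2 → ℝ :=
  ![Real.sqrt (rho + c * ((1 - 1 / (Q : ℝ)) / Real.sqrt (S.f q)) ^ 2), Real.sqrt rho]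

theorem Ddiag_eq (c : ℝ) (q : Fin Q) (rho : ℝ) :
    Ddiag S c q rho = Matrix.diagonal (dEntry S c q rho) := rfl

theorem dEntry_pos {c : ℝ} (hc : 0 ≤ c) (q : Fin Q) {rho : ℝ} (h : 0 < rho) (i : Fin 2) :
    0 < dEntry S c q rho i := by
  fin_cases i
  · exact Real.sqrt_pos.2 (by positivity)
  · exact Real.sqrt_pos.2 h

theorem dEntry_mono (c : ℝ) (q : Fin Q) {rho rho' : ℝ} (h : rho ≤ rho') (i : Fin 2) :
    dEntry S c q rho i ≤ dEntry S c q rho' i := by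
  fin_cases i
  · exact Real.sqrt_le_sqrt (by linarith)
  · exact Real.sqrt_le_sqrt h

theorem userNorm_eq (pref : Fin Q → Fin N → ℝ) (c t : ℝ) (q : Fin Q) (z : Strategy N) :
    userNorm S pref c t q z = l2 (fun i => dEntry S c q (rho S pref q t) i *
      ![|z.1|, l2 (Sum.elim z.2.1 (fun _ : Unit => z.2.2))] i) := by
  unfold userNorm Dmat
  rw [Ddiag_eq]
  congr 1
  funext i
  exact Matrix.mulVec_diagonal _ _ i

theorem userNorm_nonneg (pref : Fin Q → Fin N → ℝ) (c t : ℝ) (q : Fin Q) (z : Strategy N) :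
    0 ≤ userNorm S pref c t q z := l2_nonneg _

theorem userNorm_sq (pref : Fin Q → Fin N → ℝ) {c : ℝ} (hc : 0 ≤ c) (t : ℝ) (q : Fin Q)
    (z : Strategy N) : userNorm S pref c t q z ^ 2 =
      rho S pref q t * (z.1 ^ 2 + (∑ k, z.2.1 k ^ 2 + z.2.2 ^ 2)) +
        c * ((1 - 1 / (Q : ℝ)) / Real.sqrt (S.f q) * z.1) ^ 2 := by
  have h := rho_nonneg (S := S) pref q t
  rw [userNorm_eq, l2_sq, Fin.sum_univ_two]
  simp only [dEntry, Matrix.cons_val_zero, Matrix.cons_val_one, mul_pow]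
  rw [Real.sq_sqrt (by positivity), Real.sq_sqrt h, l2_sumElim_sq, l2_sq, l2_unit, sq_abs, sq_abs]
  ring

theorem sensingGap_single_self (q : Fin Q) (v : Strategy N) :
    sensingGap S q (Pi.single q v) = (1 - 1 / (Q : ℝ)) / Real.sqrt (S.f q) * v.1 := by
  unfold sensingGap
  rw [Finset.sum_eq_single q (fun r _ hr => by simp [hr]) (by simp)]
  simp only [Pi.single_eq_same]
  ring

theorem sensingGap_single_ne {q r : Fin Q} (hr : r ≠ q) (v : Strategy N) :
    sensingGap S q (Pi.single r v) = -((1 / (Q : ℝ)) / Real.sqrt (S.f r) * v.1) := by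
  unfold sensingGap
  rw [Finset.sum_eq_single r (fun s _ hs => by simp [hs]) (by simp)]
  simp only [Pi.single_eq_same, Pi.single_eq_of_ne hr.symm]
  simp
  ring

/-! ### Strong convexity of the Lagrangian -/

theorem update_eq_add_single (x : Profile Q N) (q : Fin Q) (z : Strategy N) :
    Function.update x q z = x + (1 : ℝ) • (Pi.single q (z - x q) : Profile Q N) := by
  funext r
  by_cases hr : r = q
  · subst hr; simp
  · simp [hr]

/-- Along the segment, which stays in the convex set `YhatSet`, the Hessian with `c = 0` contributes
at least `rho` times the squared length. The penalty contributes exactly `c` times the squared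
sensing gap of the direction. Together these are `userNorm ^ 2`, so Taylor's inequality applies. -/
theorem lagr_strongly_convex [Nonempty (Fin N)] {pref : Fin Q → Fin N → ℝ} {q : Fin Q} {c t : ℝ}
    (hc : 0 ≤ c) (hrho : 0 < rhoLow S q t) {x : Profile Q N} (hx : x ∈ Yjoint S)
    (hq : x q ∈ YhatSet S pref q t) {z : Strategy N} (hz : z ∈ YhatSet S pref q t)
    {lam price : ℝ} (hlam : lam ∈ Set.Icc 0 (lamMax S)) (hprice : price ∈ Set.Icc 0 t) :
    lagr S c price lam q x + lagrDeriv S c price lam q (z - x q) x +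
        userNorm S pref c t q (z - x q) ^ 2 / 2 ≤
      lagr S c price lam q (Function.update x q z) := by
  set u : Profile Q N := Pi.single q (z - x q) with hu
  have hmem : ∀ s ∈ Set.Icc (0 : ℝ) 1, x + s • u ∈ Yjoint S ∧
      (x + s • u) q ∈ YhatSet S pref q t := by
    intro s hs
    have h1 : (x + s • u) q ∈ YhatSet S pref q t := by
      rw [hu, line_single_same]
      exact (convex_YhatSet pref q t).add_smul_sub_mem hq hz hs
    refine ⟨mem_Yjoint_of h1.1 fun r hr => ?_, h1⟩
    rw [hu, line_single_ne hr]
    exact hx r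
  have hreg := fun s hs => regularAt_of_mem_Yhat (hmem s hs).1 (hmem s hs).2
  have hC := fun s hs => contDiffAt_lagr_of_mem (hmem s hs).1 (hreg s hs) c price lam
  have key := taylor_lower_bound (m := userNorm S pref c t q (z - x q) ^ 2)
    (fun s hs => hasDerivAt_line ((hC s hs).differentiableAt (by norm_num)))
    (fun s hs => hasDerivAt_fderiv_line (hC s hs) u) (fun s hs => by
      rw [← pd2_eq_fderiv (hC s hs), hu, (hreg s hs).pd2_lagr]
      have h1 := rho_le_leastEig_Bmat hrho (hmem s hs).1 (hmem s hs).2 hlam hprice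
      have h2 := leastEig_Bmat_mul_le (contDiffAt_lagr_of_mem (hmem s hs).1 (hreg s hs) 0 price lam)
        (z - x q)
      rw [(hreg s hs).pd2_lagr] at h2
      have h3 : 0 ≤ (z - x q).1 ^ 2 + (∑ k, (z - x q).2.1 k ^ 2 + (z - x q).2.2 ^ 2) :=
        add_nonneg (sq_nonneg _) (add_nonneg (Finset.sum_nonneg fun k _ => sq_nonneg _)
          (sq_nonneg _))
      have h4 := mul_le_mul_of_nonneg_right h1 h3
      rw [userNorm_sq pref hc, ← sensingGap_single_self]
      simp only [thetaDeriv2, ← hu] at h2 ⊢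
      linarith)
  have h0 : (0 : ℝ) ∈ Set.Icc (0 : ℝ) 1 := by simp
  have hx0 : x + (0 : ℝ) • u = x := by simp
  have e0 : fderiv ℝ (lagr S c price lam q) (x + (0 : ℝ) • u) u =
      lagrDeriv S c price lam q (z - x q) x := by
    have d1 := hasDerivAt_line ((hC 0 h0).differentiableAt (by norm_num))
    have d2 := (regularAt_of_mem_Yhat hx hq).hasDerivAt_lagr c price lam (z - x q)
    exact d1.unique d2
  rw [e0, hx0, hu, ← update_eq_add_single] at key
  exact key

/-! ### Cross derivatives of the payoffs -/

theorem interf_single_ne {q r : Fin Q} (hr : r ≠ q) (k : Fin N) (v : Strategy N) :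
    interf S q k (power (Pi.single r v)) = Hsq S q r k * v.2.1 k := by
  unfold interf power
  rw [Finset.sum_eq_single r (fun s _ hs => by simp [hs])
    (fun h => absurd (Finset.mem_erase.2 ⟨hr, Finset.mem_univ r⟩) h)]
  simp

/-- The mixed second derivative of the logarithm of the sum rate of user `q` with respect to his
powers and those of user `r`. -/
def logRateCross (S : System Q N) (q r : Fin Q) (x : Profile Q N) (u v : Fin N → ℝ) : ℝ :=
  rateDeriv2 S q (Pi.single q (0, u, 0)) (Pi.single r (0, v, 0)) x / rate S q (power x) -
    rateDeriv S q (Pi.single q (0, u, 0)) x * rateDeriv S q (Pi.single r (0, v, 0)) x /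
      rate S q (power x) ^ 2

/-- Two users interact only through the sensing penalty and through interference in the rate, so
sensing times couple with sensing times and powers with powers. This is why `Emat` can be diagonal.
-/
theorem thetaDeriv2_cross {q r : Fin Q} (hr : r ≠ q) (c : ℝ) (x : Profile Q N) (u v : Strategy N) :
    thetaDeriv2 S c q (Pi.single q u) (Pi.single r v) x =
      c * ((1 - 1 / (Q : ℝ)) / Real.sqrt (S.f q)) * ((1 / (Q : ℝ)) / Real.sqrt (S.f r)) *
        (u.1 * v.1) + logRateCross S q r x u.2.1 v.2.1 := by
  simp only [thetaDeriv2, logRateCross, rateDeriv, rateDeriv2, interf_single_self,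
    interf_single_ne hr, sensingGap_single_self, sensingGap_single_ne hr, Pi.single_eq_same,
    Pi.single_eq_of_ne hr.symm]
  simp only [Prod.fst_zero, Prod.snd_zero, Pi.zero_apply]
  ring

theorem abs_logRateCross_le [Nonempty (Fin N)] {pref : Fin Q → Fin N → ℝ} {q r : Fin Q} {t : ℝ}
    (hr : r ≠ q) {x : Profile Q N} (hx : x ∈ Yjoint S) (hq : x q ∈ YhatSet S pref q t)
    (u v : Fin N → ℝ) : |logRateCross S q r x u v| ≤
      (⨆ k, Hsq S q r k / nz S q k ^ 2) * xiSup S pref q t * l2 u * l2 v := by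
  have hbox := power_mem_box S hx
  have hR := (regularAt_of_mem_Yhat hx hq).rate_pos
  have hi : ∀ k, 0 ≤ interf S q k (power x) := fun k => interf_nonneg S k fun r _ => hbox.1 r
  have hp : ∀ k, 0 ≤ (x q).2.1 k := hbox.1 q
  have hnz := nz_pos S q
  set M := ⨆ k, Hsq S q r k / nz S q k ^ 2 with hM
  have hMk : ∀ k, Hsq S q r k / nz S q k ^ 2 ≤ M := le_iSup_of_fin _
  have hM0 : 0 ≤ M := (div_nonneg (Hsq_nonneg S q r (Classical.arbitrary _)) (sq_nonneg _)).trans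
    (hMk (Classical.arbitrary _))
  set A : Fin N → ℝ := fun k => nz S q k + interf S q k (power x) + (x q).2.1 k with hA
  set B : Fin N → ℝ := fun k => nz S q k + interf S q k (power x) with hB
  have hnA : ∀ k, nz S q k ≤ A k := fun k => by simp only [hA]; linarith [hi k, hp k]
  have hnB : ∀ k, nz S q k ≤ B k := fun k => by simp only [hB]; linarith [hi k]
  have hA0 : ∀ k, 0 < A k := fun k => (hnz k).trans_le (hnA k)
  have hB0 : ∀ k, 0 < B k := fun k => (hnz k).trans_le (hnB k)
  have e1 : rateDeriv2 S q (Pi.single q (0, u, 0)) (Pi.single r (0, v, 0)) x =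
      -∑ k, u k * (Hsq S q r k / A k ^ 2 * v k) := by
    simp only [rateDeriv2, interf_single_self, interf_single_ne hr, Pi.single_eq_same,
      Pi.single_eq_of_ne hr.symm, ← Finset.sum_neg_distrib]
    refine Finset.sum_congr rfl fun k _ => ?_
    simp only [Prod.snd_zero, Prod.fst_zero, Pi.zero_apply, hA]
    ring
  have e2 : rateDeriv S q (Pi.single q (0, u, 0)) x = ∑ k, u k * (1 / A k) := by
    simp only [rateDeriv, interf_single_self, Pi.single_eq_same]
    refine Finset.sum_congr rfl fun k _ => ?_
    simp only [hA]
    ring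
  -- The two fractions combine through `1 / B - 1 / A = p / (A * B)`. The extra factor `p` is
  -- essential for the estimate `c2`.
  have e3 : rateDeriv S q (Pi.single r (0, v, 0)) x =
      -∑ k, v k * (Hsq S q r k / (A k * B k) * (x q).2.1 k) := by
    simp only [rateDeriv, interf_single_ne hr, Pi.single_eq_of_ne hr.symm,
      ← Finset.sum_neg_distrib]
    refine Finset.sum_congr rfl fun k _ => ?_
    have hAB : A k = B k + (x q).2.1 k := rfl
    have h1 := (hA0 k).ne'
    have h2 := (hB0 k).ne'
    simp only [Prod.snd_zero, Prod.fst_zero, Pi.zero_apply]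
    change (0 + Hsq S q r k * v k) / A k - Hsq S q r k * v k / B k = _
    field_simp
    rw [hAB]
    ring
  have hsum := l2_le_sum (x q).2.1 hp
  have hsum0 : 0 ≤ ∑ k, (x q).2.1 k := Finset.sum_nonneg fun k _ => hp k
  have b1 : |rateDeriv2 S q (Pi.single q (0, u, 0)) (Pi.single r (0, v, 0)) x| ≤
      M * (l2 u * l2 v) := by
    rw [e1, abs_neg]
    refine (abs_sum_mul_le_l2 _ _).trans ?_
    have : l2 (fun k => Hsq S q r k / A k ^ 2 * v k) ≤ l2 (fun k => M * v k) := by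
      refine l2_mono fun k => ?_
      have h1 : Hsq S q r k / A k ^ 2 ≤ M := (div_le_div_of_nonneg_left (Hsq_nonneg S q r k)
        (pow_pos (hnz k) 2) (pow_le_pow_left₀ (hnz k).le (hnA k) 2)).trans (hMk k)
      rw [abs_mul, abs_mul, abs_of_nonneg hM0,
        abs_of_nonneg (div_nonneg (Hsq_nonneg S q r k) (sq_nonneg (A k)))]
      exact mul_le_mul_of_nonneg_right h1 (abs_nonneg _)
    rw [l2_smul, abs_of_nonneg hM0] at this
    have := mul_le_mul_of_nonneg_left this (l2_nonneg u)
    linarith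
  have b2 : |rateDeriv S q (Pi.single q (0, u, 0)) x| ≤ l2 u * l2 (fun k => 1 / nz S q k) := by
    rw [e2]
    refine (abs_sum_mul_le_l2 _ _).trans (mul_le_mul_of_nonneg_left (l2_mono fun k => ?_)
      (l2_nonneg u))
    rw [abs_of_pos (one_div_pos.2 (hA0 k)), abs_of_pos (one_div_pos.2 (hnz k))]
    exact one_div_le_one_div_of_le (hnz k) (hnA k)
  have b3 : |rateDeriv S q (Pi.single r (0, v, 0)) x| ≤ l2 v * (M * ∑ k, (x q).2.1 k) := by
    rw [e3, abs_neg]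
    refine (abs_sum_mul_le_l2 _ _).trans (mul_le_mul_of_nonneg_left ?_ (l2_nonneg v))
    have : l2 (fun k => Hsq S q r k / (A k * B k) * (x q).2.1 k) ≤
        l2 (fun k => M * (x q).2.1 k) := by
      refine l2_mono fun k => ?_
      have h1 : Hsq S q r k / (A k * B k) ≤ M := by
        refine (div_le_div_of_nonneg_left (Hsq_nonneg S q r k) (pow_pos (hnz k) 2) ?_).trans (hMk k)
        rw [sq]
        exact mul_le_mul (hnA k) (hnB k) (hnz k).le (hA0 k).le
      rw [abs_mul, abs_mul, abs_of_nonneg hM0,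
        abs_of_nonneg (div_nonneg (Hsq_nonneg S q r k) (mul_pos (hA0 k) (hB0 k)).le)]
      exact mul_le_mul_of_nonneg_right h1 (abs_nonneg _)
    rw [l2_smul, abs_of_nonneg hM0] at this
    exact this.trans (mul_le_mul_of_nonneg_left hsum hM0)
  set R := rate S q (power x) with hRdef
  have hrm := rMin_pos S q
  have hlow : 0 < rLow S pref q t := mul_pos (powLow_pos pref q t) hrm
  have hRs : rMin S q * ∑ k, (x q).2.1 k ≤ R := rMin_mul_le_rate S hbox.1 hbox.2
  have hRl : rLow S pref q t ≤ R := by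
    refine le_trans ?_ hRs
    rw [rLow, mul_comm]
    exact mul_le_mul_of_nonneg_left hq.2 hrm.le
  have c1 : 1 / R ≤ 1 / rLow S pref q t := one_div_le_one_div_of_le hlow hRl
  -- One of the two factors `1 / R` is absorbed by the total power, so only one factor `1 / rLow`
  -- enters `xiSup`.
  have c2 : (∑ k, (x q).2.1 k) / R ≤ 1 / rMin S q := by
    rw [div_le_div_iff₀ hR hrm]
    linarith
  have hnn : 0 ≤ M * (l2 u * l2 v) := mul_nonneg hM0 (mul_nonneg (l2_nonneg _) (l2_nonneg _))
  have f1 : |rateDeriv2 S q (Pi.single q (0, u, 0)) (Pi.single r (0, v, 0)) x / R| ≤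
      M * (l2 u * l2 v) * (1 / rLow S pref q t) := by
    rw [abs_div, abs_of_pos hR, div_eq_mul_one_div]
    exact mul_le_mul b1 c1 (one_div_pos.2 hR).le hnn
  have f2 : |rateDeriv S q (Pi.single q (0, u, 0)) x * rateDeriv S q (Pi.single r (0, v, 0)) x /
      R ^ 2| ≤ M * (l2 u * l2 v) * l2 (fun k => 1 / nz S q k) *
        (1 / rLow S pref q t * (1 / rMin S q)) := by
    rw [abs_div, abs_mul, abs_of_pos (pow_pos hR 2)]
    calc _ ≤ (l2 u * l2 (fun k => 1 / nz S q k)) * (l2 v * (M * ∑ k, (x q).2.1 k)) / R ^ 2 := by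
          apply div_le_div_of_nonneg_right _ (sq_nonneg _)
          exact mul_le_mul b2 b3 (abs_nonneg _) (mul_nonneg (l2_nonneg _) (l2_nonneg _))
      _ = M * (l2 u * l2 v) * l2 (fun k => 1 / nz S q k) *
          (1 / R * ((∑ k, (x q).2.1 k) / R)) := by field_simp
      _ ≤ _ := by
          refine mul_le_mul_of_nonneg_left ?_ (mul_nonneg hnn (l2_nonneg _))
          exact mul_le_mul c1 c2 (div_nonneg hsum0 hR.le) (one_div_pos.2 hlow).le
  refine (abs_sub _ _).trans ?_
  unfold xiSup
  have := add_le_add f1 f2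
  linarith

theorem pd2_theta_cross {q r : Fin Q} (hr : r ≠ q) (c : ℝ) {x : Profile Q N}
    (h : RegularAt S q x) (u v : Strategy N) :
    pd2 (theta S c q) (Pi.single q u) (Pi.single r v) x =
      c * ((1 - 1 / (Q : ℝ)) / Real.sqrt (S.f q)) * ((1 / (Q : ℝ)) / Real.sqrt (S.f r)) *
        (u.1 * v.1) + logRateCross S q r x u.2.1 v.2.1 := by
  rw [h.pd2_theta, thetaDeriv2_cross hr]

/-- The block of cross derivatives with respect to the powers of users `q` and `r`. -/
def powerCross (S : System Q N) (c : ℝ) (q r : Fin Q) (x : Profile Q N) :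
    Matrix (Fin N) (Fin N) ℝ :=
  Matrix.of fun i j => pd2 (theta S c q) (ePow q i) (ePow r j) x

theorem sum_smul_ePow (q : Fin Q) (v : Fin N → ℝ) :
    ∑ i, v i • (ePow q i : Profile Q N) = Pi.single q (0, v, 0) := by
  have := sum_smul_ePF q (Sum.elim v fun _ => 0)
  simpa [Fintype.sum_sum_type, ePF] using this

theorem bilin_powerCross {q r : Fin Q} (hr : r ≠ q) (c : ℝ) {x : Profile Q N}
    (h : RegularAt S q x) (u v : Fin N → ℝ) :
    dotProduct u ((powerCross S c q r x).mulVec v) = logRateCross S q r x u v := by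
  have h1 := pd2_sum_sum (h.contDiffAt_theta c) u v (ePow q) (ePow r)
  rw [sum_smul_ePow, sum_smul_ePow, pd2_theta_cross hr c h] at h1
  simp only [mul_zero, zero_add] at h1
  exact h1.symm

/-- The diagonal entries of `Emat`. -/
def eEntry (S : System Q N) (c : ℝ) (q r : Fin Q) (x : Profile Q N) : Fin 2 → ℝ :=
  ![|pd2 (theta S c q) (eTau q) (eTau r) x|, specNorm (powerCross S c q r x)]

theorem abs_pd2_theta_cross_le {q r : Fin Q} (hr : r ≠ q) (c : ℝ) {x : Profile Q N}
    (h : RegularAt S q x) (u v : Strategy N) :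
    |pd2 (theta S c q) (Pi.single q u) (Pi.single r v) x| ≤
      eEntry S c q r x 0 * (|u.1| * |v.1|) + eEntry S c q r x 1 * (l2 u.2.1 * l2 v.2.1) := by
  have e1 : pd2 (theta S c q) (eTau q) (eTau r) x =
      c * ((1 - 1 / (Q : ℝ)) / Real.sqrt (S.f q)) * ((1 / (Q : ℝ)) / Real.sqrt (S.f r)) := by
    -- Evaluation at zero vectors shows that `logRateCross` vanishes there, leaving only the penalty
    -- term.
    have h1 := bilin_powerCross hr c h 0 0
    simp only [zero_dotProduct] at h1
    rw [eTau, eTau, pd2_theta_cross hr c h, ← h1]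
    ring
  have h2 := abs_bilin_le_specNorm (powerCross S c q r x) u.2.1 v.2.1
  rw [bilin_powerCross hr c h] at h2
  rw [pd2_theta_cross hr c h, ← e1]
  refine (abs_add_le _ _).trans (add_le_add ?_ ?_)
  · rw [abs_mul, abs_mul]; rfl
  · rw [← mul_assoc]; exact h2

theorem one_sub_one_div_nonneg (q : Fin Q) : 0 ≤ 1 - 1 / (Q : ℝ) := by
  have hQ : (1 : ℝ) ≤ Q := by exact_mod_cast Fin.pos q
  rw [sub_nonneg, div_le_one (by linarith)]
  exact hQ

theorem eEntry_le [Nonempty (Fin N)] {pref : Fin Q → Fin N → ℝ} {q r : Fin Q} {c t : ℝ}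
    (hc : 0 ≤ c) (hr : r ≠ q) {x : Profile Q N} (hx : x ∈ Yjoint S)
    (hq : x q ∈ YhatSet S pref q t) (i : Fin 2) : 0 ≤ eEntry S c q r x i ∧
      eEntry S c q r x i ≤ ![c * ((1 - 1 / (Q : ℝ)) / Real.sqrt (S.f q)) *
        ((1 / (Q : ℝ)) / Real.sqrt (S.f r)),
      (⨆ k, Hsq S q r k / nz S q k ^ 2) * xiSup S pref q t] i := by
  have h := regularAt_of_mem_Yhat hx hq
  fin_cases i
  · refine ⟨abs_nonneg _, le_of_eq ?_⟩
    have h1 := bilin_powerCross hr c h 0 0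
    simp only [zero_dotProduct] at h1
    have h2 := one_sub_one_div_nonneg q
    change |pd2 (theta S c q) (eTau q) (eTau r) x| = _ * _
    rw [eTau, eTau, pd2_theta_cross hr c h, ← h1, add_zero, mul_one, mul_one,
      abs_of_nonneg (by positivity)]
  · refine ⟨specNorm_nonneg _, specNorm_le ?_ fun u v => ?_⟩
    · have hrm := rMin_pos S q
      have hl : 0 < rLow S pref q t := mul_pos (powLow_pos pref q t) hrm
      refine mul_nonneg (Real.iSup_nonneg fun k => div_nonneg (Hsq_nonneg S q r k) (sq_nonneg _)) ?_
      have := l2_nonneg fun k => 1 / nz S q k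
      unfold xiSup
      positivity
    · rw [bilin_powerCross hr c h]
      exact abs_logRateCross_le hr hx hq u v

theorem inv_diagonal_of_pos {d : Fin 2 → ℝ} (hd : ∀ i, 0 < d i) :
    (Matrix.diagonal d)⁻¹ = Matrix.diagonal fun i => (d i)⁻¹ := by
  refine Matrix.inv_eq_right_inv ?_
  rw [Matrix.diagonal_mul_diagonal, ← Matrix.diagonal_one]
  congr 1
  funext i
  exact mul_inv_cancel₀ (hd i).ne'

theorem inv_mul_mul_inv_diagonal {d e d' : Fin 2 → ℝ} (hd : ∀ i, 0 < d i) (hd' : ∀ i, 0 < d' i) :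
    (Matrix.diagonal d)⁻¹ * Matrix.diagonal e * (Matrix.diagonal d')⁻¹ =
      Matrix.diagonal fun i => e i / (d i * d' i) := by
  rw [inv_diagonal_of_pos hd, inv_diagonal_of_pos hd', Matrix.diagonal_mul_diagonal,
    Matrix.diagonal_mul_diagonal]
  congr 1
  funext i
  rw [div_eq_mul_inv, mul_inv]
  ring

theorem specNorm_triple_eq (pref : Fin Q → Fin N → ℝ) {c t : ℝ} (hc : 0 ≤ c) (q r : Fin Q)
    (hq : 0 < rho S pref q t) (hr : 0 < rho S pref r t) (x : Profile Q N) :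
    specNorm ((Dmat S pref c t q)⁻¹ * Emat S c q r x * (Dmat S pref c t r)⁻¹) =
      specNorm (Matrix.diagonal fun i => eEntry S c q r x i /
        (dEntry S c q (rho S pref q t) i * dEntry S c r (rho S pref r t) i)) := by
  rw [← inv_mul_mul_inv_diagonal (dEntry_pos hc q hq) (dEntry_pos hc r hr)]
  rfl

section Beta

variable [Nonempty (Fin N)] {pref : Fin Q → Fin N → ℝ} {c t : ℝ} (hc : 0 ≤ c) {q r : Fin Q}
  (hrq : r ≠ q) (hlowq : 0 < rhoLow S q t) (hlowr : 0 < rhoLow S r t)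
  (hq : rhoLow S q t ≤ rho S pref q t) (hr : rhoLow S r t ≤ rho S pref r t)

include hc hrq hlowq hlowr hq hr

/-- All matrices are diagonal. Passing from `rho` to the smaller `rhoLow` lowers the denominators,
and passing from `Emat` to `Esup` raises the numerators. -/
theorem specNorm_triple_le_betaUp {x : Profile Q N} (hx : x ∈ Yjoint S)
    (hxq : x q ∈ YhatSet S pref q t) :
    specNorm ((Dmat S pref c t q)⁻¹ * Emat S c q r x * (Dmat S pref c t r)⁻¹) ≤
      betaUp S pref c t q r := by
  rw [specNorm_triple_eq pref hc q r (hlowq.trans_le hq) (hlowr.trans_le hr)]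
  refine specNorm_diagonal_le (specNorm_nonneg _) fun i => ?_
  have h1 := dEntry_pos (S := S) hc q hlowq i
  have h2 := dEntry_pos (S := S) hc r hlowr i
  have h3 := dEntry_mono (S := S) c q hq i
  have h4 := dEntry_mono (S := S) c r hr i
  have h5 := eEntry_le hc hrq hx hxq i
  unfold betaUp
  rw [Ddiag_eq, Ddiag_eq, Esup, inv_mul_mul_inv_diagonal (dEntry_pos hc q hlowq)
    (dEntry_pos hc r hlowr)]
  refine le_trans ?_ (abs_le_specNorm_diagonal _ i)
  refine le_trans ?_ (le_abs_self _)
  rw [abs_of_nonneg (div_nonneg h5.1 (mul_pos (h1.trans_le h3) (h2.trans_le h4)).le)]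
  exact div_le_div₀ (h5.1.trans h5.2) h5.2 (mul_pos h1 h2)
    (mul_le_mul h3 h4 h2.le (h1.trans_le h3).le)

theorem bddAbove_beta : BddAbove {m | ∃ x : Profile Q N, x q ∈ YhatSet S pref q t ∧
    (∀ s, s ≠ q → x s ∈ Yset S s) ∧
    m = specNorm ((Dmat S pref c t q)⁻¹ * Emat S c q r x * (Dmat S pref c t r)⁻¹)} := by
  refine ⟨betaUp S pref c t q r, ?_⟩
  rintro m ⟨x, hxq, hx, rfl⟩
  exact specNorm_triple_le_betaUp hc hrq hlowq hlowr hq hr (mem_Yjoint_of hxq.1 hx) hxq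

theorem betaCoef_le_betaUp : betaCoef S pref c t q r ≤ betaUp S pref c t q r := by
  refine Real.sSup_le ?_ (specNorm_nonneg _)
  rintro m ⟨x, hxq, hx, rfl⟩
  exact specNorm_triple_le_betaUp hc hrq hlowq hlowr hq hr (mem_Yjoint_of hxq.1 hx) hxq

/-- The spectral norm bounds each diagonal quotient, so the entries of `Emat` are at most a multiple
of the products of weights; Cauchy-Schwarz in the plane assembles the two blocks into the product of
the gauges. -/
theorem abs_pd2_theta_le_betaCoef {x : Profile Q N} (hx : x ∈ Yjoint S)
    (hxq : x q ∈ YhatSet S pref q t) (u v : Strategy N) :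
    |pd2 (theta S c q) (Pi.single q u) (Pi.single r v) x| ≤
      betaCoef S pref c t q r * (userNorm S pref c t q u * userNorm S pref c t r v) := by
  have hreg := regularAt_of_mem_Yhat hx hxq
  set m := specNorm ((Dmat S pref c t q)⁻¹ * Emat S c q r x * (Dmat S pref c t r)⁻¹) with hm
  have hmb : m ≤ betaCoef S pref c t q r :=
    le_csSup (bddAbove_beta hc hrq hlowq hlowr hq hr) ⟨x, hxq, fun s _ => hx s, rfl⟩
  have hm0 : 0 ≤ m := specNorm_nonneg _
  set a := dEntry S c q (rho S pref q t) with ha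
  set b := dEntry S c r (rho S pref r t) with hb
  have ha0 := dEntry_pos (S := S) hc q (hlowq.trans_le hq)
  have hb0 := dEntry_pos (S := S) hc r (hlowr.trans_le hr)
  have hE : ∀ i, eEntry S c q r x i ≤ m * (a i * b i) := by
    intro i
    rw [hm, specNorm_triple_eq pref hc q r (hlowq.trans_le hq) (hlowr.trans_le hr),
      ← div_le_iff₀ (mul_pos (ha0 i) (hb0 i))]
    exact (le_abs_self _).trans (abs_le_specNorm_diagonal (fun i => eEntry S c q r x i /
      (dEntry S c q (rho S pref q t) i * dEntry S c r (rho S pref r t) i)) i)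
  have hl : ∀ w : Strategy N, l2 w.2.1 ≤ l2 (Sum.elim w.2.1 fun _ : Unit => w.2.2) := by
    intro w
    refine abs_le_of_sq_le_sq' ?_ (l2_nonneg _) |>.2
    rw [l2_sumElim_sq]
    linarith [sq_nonneg (l2 fun _ : Unit => w.2.2)]
  set u' : Fin 2 → ℝ := ![|u.1|, l2 (Sum.elim u.2.1 fun _ : Unit => u.2.2)] with hu'
  set v' : Fin 2 → ℝ := ![|v.1|, l2 (Sum.elim v.2.1 fun _ : Unit => v.2.2)] with hv'
  have h1 := (le_abs_self _).trans (abs_sum_mul_le_l2 (fun i => a i * u' i) fun i => b i * v' i)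
  rw [← userNorm_eq, ← userNorm_eq, Fin.sum_univ_two] at h1
  have h2 := abs_pd2_theta_cross_le hrq c hreg u v
  have h3 : eEntry S c q r x 0 * (|u.1| * |v.1|) ≤ m * (a 0 * b 0) * (u' 0 * v' 0) :=
    mul_le_mul_of_nonneg_right (hE 0) (by positivity)
  have h4 : eEntry S c q r x 1 * (l2 u.2.1 * l2 v.2.1) ≤ m * (a 1 * b 1) * (u' 1 * v' 1) :=
    mul_le_mul (hE 1) (mul_le_mul (hl u) (hl v) (l2_nonneg _) (l2_nonneg _))
      (mul_nonneg (l2_nonneg _) (l2_nonneg _)) (mul_nonneg hm0 (mul_pos (ha0 1) (hb0 1)).le)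
  have h5 := mul_le_mul_of_nonneg_left h1 hm0
  have h6 := mul_le_mul_of_nonneg_right hmb (mul_nonneg (userNorm_nonneg (S := S) pref c t q u)
    (userNorm_nonneg (S := S) pref c t r v))
  linarith

end Beta

end CogRadio
end

/-! ### Localization, existence and first order conditions for best responses -/

noncomputable section
namespace CogRadio

variable {Q N : ℕ} {S : System Q N}

theorem update_mem_Yjoint {q : Fin Q} {x : Profile Q N} (hx : ∀ r, r ≠ q → x r ∈ Yset S r)
    {z : Strategy N} (hz : z ∈ Yset S q) : Function.update x q z ∈ Yjoint S := by
  refine mem_Yjoint_of (q := q) (by simpa using hz) fun r hr => ?_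
  simpa [hr] using hx r hr

/-- The real-valued objective of user `q`. -/
def objective (S : System Q N) (c price : ℝ) (q : Fin Q) (x : Profile Q N) (z : Strategy N) : ℝ :=
  theta S c q (Function.update x q z) - price * globalI S (Function.update x q z)

section Payoff

variable [Nonempty (Fin N)] {q : Fin Q} {x : Profile Q N} (hx : ∀ r, r ≠ q → x r ∈ Yset S r)
  {z : Strategy N} (hz : z ∈ Yset S q)

include hx hz

theorem regularAt_update (hp : 0 < ∑ k, z.2.1 k) : RegularAt S q (Function.update x q z) :=
  regularAt_of_mem (update_mem_Yjoint hx hz) (by simpa using hp)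

theorem payoff_of_pos (c price : ℝ) (hp : 0 < ∑ k, z.2.1 k) :
    payoff S c price q (Function.update x q z) = (objective S c price q x z : EReal) := by
  rw [payoff, if_pos (regularAt_update hx hz hp).throughput_pos]
  rfl

omit [Nonempty (Fin N)] hx in
theorem payoff_of_not_pos (c price : ℝ) (hp : ¬ 0 < ∑ k, z.2.1 k) :
    payoff S c price q (Function.update x q z) = ⊥ := by
  have h0 : ∀ k, z.2.1 k = 0 := by
    have hnn : ∀ k ∈ Finset.univ, 0 ≤ z.2.1 k := fun k _ => pow_nonneg_of_mem hz k
    have h1 : ∑ k, z.2.1 k = 0 := le_antisymm (not_lt.1 hp) (Finset.sum_nonneg hnn)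
    exact fun k => (Finset.sum_eq_zero_iff_of_nonneg hnn).1 h1 k (Finset.mem_univ k)
  have h1 : rate S q (power (Function.update x q z)) = 0 := by
    refine Finset.sum_eq_zero fun k _ => ?_
    rw [rateK_eq]
    simp [power, h0 k]
  rw [payoff, if_neg]
  rw [throughput_eq, h1]
  simp

end Payoff

theorem log_throughput {q : Fin Q} {x : Profile Q N} (h : RegularAt S q x) :
    Real.log (throughput S q x) = Real.log (1 - (x q).1 ^ 2 / (S.f q * S.T q)) +
      Real.log (1 - (x q).2.2) + Real.log (rate S q (power x)) := by
  have h1 := h.one_sub_pos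
  have h2 := sub_pos.2 h.pfa_lt
  rw [throughput_eq, Real.log_mul h1.ne' (mul_pos h2 h.rate_pos).ne',
    Real.log_mul h2.ne' h.rate_pos.ne']
  ring

section Reference

variable [Nonempty (Fin N)] {pref : Fin Q → Fin N → ℝ} (hpref : ∀ q, pref q ∈ powerSet S q)
  (hpref0 : ∀ q, pref q ≠ 0)

theorem pfaRef_mem (q : Fin Q) : 0 ≤ pfaRef S q ∧ pfaRef S q ≤ 1 := by
  refine ⟨(Qfun_nonneg _).trans (le_iSup_of_fin (fun k => Qfun ((S.sd1 q k * alphaHat S q k +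
    dmu S q k * Real.sqrt (S.f q * S.tauMin q)) / S.sd0 q k)) (Classical.arbitrary _)),
    ciSup_le fun k => (Qfun_lt_one _).le⟩

/-- The logarithms of the sensing and false alarm factors are nonpositive and can be dropped: the
comparison strategy keeps the sensing time and false alarm probability it is compared with, so these
terms cancel there. -/
theorem etaRef_le (pref : Fin Q → Fin N → ℝ) (q : Fin Q) (t : ℝ) :
    etaRef S pref q t ≤ Real.log (rate S q (Function.update S.pmax q (pref q))) -
      t / 2 * ∑ k, gw S q k * pref q k := by
  have hT := T_pos S q
  have h1 : Real.log (1 - S.tauMin q / S.T q) ≤ 0 := by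
    apply Real.log_nonpos
    · rw [sub_nonneg, div_le_one hT]
      exact ((S.tau_lt q).trans (S.tauMax_lt q)).le
    · have := div_pos (S.tauMin_pos q) hT
      linarith
  have h2 : Real.log (1 - pfaRef S q) ≤ 0 :=
    Real.log_nonpos (by linarith [(pfaRef_mem (S := S) q).2]) (by linarith [(pfaRef_mem (S := S) q).1])
  unfold etaRef
  linarith

include hpref in
omit [Nonempty (Fin N)] in
theorem update_pref_mem_box (q : Fin Q) :
    (∀ r k, 0 ≤ Function.update S.pmax q (pref q) r k) ∧
      ∀ r k, Function.update S.pmax q (pref q) r k ≤ S.pmax r k := by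
  constructor <;> intro r k <;> by_cases hr : r = q
  · subst hr; simpa using ((hpref r).2 k).1
  · simpa [hr] using (S.pmax_pos r k).le
  · subst hr; simpa using ((hpref r).2 k).2
  · simp [hr]

include hpref hpref0 in
omit [Nonempty (Fin N)] in
theorem sum_pref_pos (q : Fin Q) : 0 < ∑ k, pref q k := by
  have hnn : ∀ k ∈ Finset.univ, 0 ≤ pref q k := fun k _ => ((hpref q).2 k).1
  refine (Finset.sum_nonneg hnn).lt_of_ne fun h => hpref0 q (funext fun k => ?_)
  exact (Finset.sum_eq_zero_iff_of_nonneg hnn).1 h.symm k (Finset.mem_univ k)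

include hpref hpref0

theorem rate_pref_pos (q : Fin Q) : 0 < rate S q (Function.update S.pmax q (pref q)) := by
  have hbox := update_pref_mem_box hpref q
  refine lt_of_lt_of_le ?_ (rMin_mul_le_rate S hbox.1 hbox.2)
  rw [Function.update_self]
  exact mul_pos (rMin_pos S q) (sum_pref_pos hpref hpref0 q)

/-- `exp etaRef` is at most a rate of the reference allocation, which is at most its total power
over the least noise. -/
theorem powLow_le_sum_pref (q : Fin Q) {t : ℝ} (ht : 0 ≤ t) :
    powLow S pref q t ≤ ∑ k, pref q k := by
  have hbox := update_pref_mem_box hpref q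
  have hr := rate_pref_pos hpref hpref0 q
  have hn := iInf_pos_of_fin (nz_pos S q)
  have h1 : Real.exp (etaRef S pref q t) ≤ rate S q (Function.update S.pmax q (pref q)) := by
    rw [← Real.le_log_iff_exp_le hr]
    refine (etaRef_le pref q t).trans (sub_le_self _ ?_)
    exact mul_nonneg (by linarith) (Finset.sum_nonneg fun k _ =>
      mul_nonneg (gw_nonneg S q k) ((hpref q).2 k).1)
  have h2 := h1.trans (rate_le_div S (hbox.1 q) fun r _ => hbox.1 r)
  rw [Function.update_self, le_div_iff₀ hn] at h2
  rw [powLow, mul_comm]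
  exact h2

variable (hprefI : ∀ q, ∑ k, gw S q k * pref q k ≤ 2 * S.Imax q)

omit [Nonempty (Fin N)] hpref0 in
theorem sum_Pmiss_pref_le {q : Fin Q} {z : Strategy N} (hz : z ∈ Yset S q) :
    ∑ k, Pmiss S q k z.1 z.2.2 * gw S q k * pref q k ≤ (∑ k, gw S q k * pref q k) / 2 := by
  rw [Finset.sum_div]
  refine Finset.sum_le_sum fun k _ => ?_
  have h1 := mul_le_mul_of_nonneg_right (Pmiss_le_half S hz k)
    (mul_nonneg (gw_nonneg S q k) ((hpref q).2 k).1)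
  linarith

include hprefI

theorem ref_mem {q : Fin Q} {t : ℝ} (ht : 0 ≤ t) {z : Strategy N} (hz : z ∈ Yset S q) :
    (z.1, pref q, z.2.2) ∈ Xset S q ∧ (z.1, pref q, z.2.2) ∈ YhatSet S pref q t := by
  have h1 : (z.1, pref q, z.2.2) ∈ Yset S q := ⟨hz.1, hz.2.1, hz.2.2.1, hpref q, hz.2.2.2.2⟩
  refine ⟨⟨h1, ?_⟩, h1, powLow_le_sum_pref hpref hpref0 q ht⟩
  have := sum_Pmiss_pref_le hpref hz
  simp only [localI]
  linarith [hprefI q]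

omit hprefI in
-- Only powers change, so the sensing, false alarm and penalty terms cancel. The interference cost
-- of the reference is at most the term in `t / 2` of `etaRef`, its rate is at least the one against
-- the masks, and too small a total power forces the logarithm of the rate below `etaRef`.
theorem payoff_lt_ref {q : Fin Q} {c price t : ℝ} (hprice : 0 ≤ price) (ht : price ≤ t)
    {x : Profile Q N} (hx : ∀ r, r ≠ q → x r ∈ Yset S r) {z : Strategy N} (hz : z ∈ Yset S q)
    (hlt : ∑ k, z.2.1 k < powLow S pref q t) :
    payoff S c price q (Function.update x q z) <
      payoff S c price q (Function.update x q (z.1, pref q, z.2.2)) := by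
  have hz' : (z.1, pref q, z.2.2) ∈ Yset S q := ⟨hz.1, hz.2.1, hz.2.2.1, hpref q, hz.2.2.2.2⟩
  have hp' := sum_pref_pos hpref hpref0 q
  rw [payoff_of_pos hx hz' c price hp']
  by_cases hp : 0 < ∑ k, z.2.1 k
  swap
  · rw [payoff_of_not_pos hz c price hp]
    exact EReal.bot_lt_coe _
  rw [payoff_of_pos hx hz c price hp, EReal.coe_lt_coe_iff]
  have hr := regularAt_update hx hz hp
  have hr' := regularAt_update hx hz' hp'
  have hbox := power_mem_box S (update_mem_Yjoint hx hz)
  have hbox' := power_mem_box S (update_mem_Yjoint hx hz')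
  have hn := iInf_pos_of_fin (nz_pos S q)
  have hgap : sensingGap S q (Function.update x q (z.1, pref q, z.2.2)) =
      sensingGap S q (Function.update x q z) := by
    have : ∀ r, (Function.update x q (z.1, pref q, z.2.2) r).1 = (Function.update x q z r).1 := by
      intro r
      by_cases hrq : r = q
      · subst hrq; simp
      · simp [hrq]
    simp only [sensingGap, this]
  have hI := globalI_sub S q (x := Function.update x q (z.1, pref q, z.2.2))
    (y := Function.update x q z) fun r hrq => by simp [hrq]
  simp only [Function.update_self, localI] at hI
  have hI1 := sum_Pmiss_pref_le hpref hz
  have hI0 : 0 ≤ ∑ k, Pmiss S q k z.1 z.2.2 * gw S q k * z.2.1 k :=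
    Finset.sum_nonneg fun k _ => mul_nonneg (mul_nonneg (Pmiss_nonneg S q k _ _)
      (gw_nonneg S q k)) (pow_nonneg_of_mem hz k)
  have hG : 0 ≤ ∑ k, gw S q k * pref q k :=
    Finset.sum_nonneg fun k _ => mul_nonneg (gw_nonneg S q k) ((hpref q).2 k).1
  have hIle : price * (globalI S (Function.update x q (z.1, pref q, z.2.2)) -
      globalI S (Function.update x q z)) ≤ t / 2 * ∑ k, gw S q k * pref q k := by
    calc _ ≤ price * ((∑ k, gw S q k * pref q k) / 2) :=
          mul_le_mul_of_nonneg_left (by linarith) hprice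
      _ ≤ t * ((∑ k, gw S q k * pref q k) / 2) := mul_le_mul_of_nonneg_right ht (by linarith)
      _ = _ := by ring
  have hrate' : Real.log (rate S q (Function.update S.pmax q (pref q))) ≤
      Real.log (rate S q (power (Function.update x q (z.1, pref q, z.2.2)))) := by
    refine Real.log_le_log (rate_pref_pos hpref hpref0 q) ?_
    refine rate_anti S (hbox'.1 q) (by simp [power]) (fun r _ => hbox'.1 r) fun r hrq k => ?_
    rw [Function.update_of_ne hrq]
    exact hbox'.2 r k
  have hrate : Real.log (rate S q (power (Function.update x q z))) < etaRef S pref q t := by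
    rw [Real.log_lt_iff_lt_exp hr.rate_pos]
    refine (rate_le_div S (hbox.1 q) fun r _ => hbox.1 r).trans_lt ?_
    rw [div_lt_iff₀ hn, mul_comm]
    simpa [power, powLow] using hlt
  have heta := etaRef_le (S := S) pref q t
  simp only [objective, theta_eq, log_throughput hr, log_throughput hr', hgap,
    Function.update_self]
  linarith

end Reference

/-! ### Existence of best responses -/

section Existence

variable [Nonempty (Fin N)] {pref : Fin Q → Fin N → ℝ} (hpref : ∀ q, pref q ∈ powerSet S q)
  (hpref0 : ∀ q, pref q ≠ 0) (hprefI : ∀ q, ∑ k, gw S q k * pref q k ≤ 2 * S.Imax q)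
  {q : Fin Q} {c price t : ℝ} (hprice : 0 ≤ price) (ht : price ≤ t)
  {x : Profile Q N} (hx : ∀ r, r ≠ q → x r ∈ Yset S r)

omit [Nonempty (Fin N)] in
theorem continuousOn_localI (q : Fin Q) : ContinuousOn (localI S q) (Yset S q) := fun _ hz =>
  (contDiffAt_localI S (pfa_pos_of_mem hz)
    (by linarith [pfa_le_of_mem hz]) q).continuousAt.continuousWithinAt

theorem isCompact_Xset_inter (q : Fin Q) (m : ℝ) :
    IsCompact (Xset S q ∩ {z | m ≤ ∑ k, z.2.1 k}) := by
  have h1 : IsClosed (Xset S q) :=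
    (continuousOn_localI q).preimage_isClosed_of_isClosed (isClosed_Yset S q) isClosed_Iic
  have h2 : IsClosed {z : Strategy N | m ≤ ∑ k, z.2.1 k} :=
    isClosed_le (by fun_prop) (by fun_prop)
  exact (isCompact_Yset S q).of_isClosed_subset (h1.inter h2) fun z hz => hz.1.1

include hx in
theorem contDiffAt_objective {z : Strategy N} (hz : z ∈ Yset S q) (hp : 0 < ∑ k, z.2.1 k)
    (c price : ℝ) : ContDiffAt ℝ 2 (objective S c price q x) z := by
  have hmem := update_mem_Yjoint hx hz
  have h1 := (regularAt_update hx hz hp).contDiffAt_theta (n := 2) c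
  have h2 := contDiffAt_globalI S (fun r => pfa_pos_of_mem (hmem r))
    (fun r => by linarith [pfa_le_of_mem (hmem r)])
  have hu : ContDiff ℝ 2 (Function.update x q) := contDiff_update 2 x q
  exact (h1.sub (contDiffAt_const.mul h2)).comp z hu.contDiffAt

include hpref hpref0 hprefI hprice ht hx

/-- The objective is continuous on the compact feasible part with total power at least `powLow`. A
feasible strategy outside it is beaten by its reference version, which lies inside. -/
theorem bestResponses_nonempty (hfeas : (Xset S q).Nonempty) :
    (bestResponses S c price q x).Nonempty := by
  have ht0 := hprice.trans ht
  obtain ⟨z₀, hz₀⟩ := hfeas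
  have hlow := powLow_pos (S := S) pref q t
  obtain ⟨z, hz, hmax⟩ := (isCompact_Xset_inter q (powLow S pref q t)).exists_isMaxOn
    ⟨(z₀.1, pref q, z₀.2.2), (ref_mem hpref hpref0 hprefI ht0 hz₀.1).1,
      (ref_mem hpref hpref0 hprefI ht0 hz₀.1).2.2⟩
    (f := objective S c price q x) fun z hz =>
      (contDiffAt_objective hx hz.1.1 (hlow.trans_le hz.2) c price).continuousAt.continuousWithinAt
  have hmax' : ∀ y ∈ Xset S q, powLow S pref q t ≤ ∑ k, y.2.1 k →
      payoff S c price q (Function.update x q y) ≤ payoff S c price q (Function.update x q z) := by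
    intro y hy hy'
    rw [payoff_of_pos hx hy.1 c price (hlow.trans_le hy'),
      payoff_of_pos hx hz.1.1 c price (hlow.trans_le hz.2), EReal.coe_le_coe_iff]
    exact hmax ⟨hy, hy'⟩
  refine ⟨z, hz.1, fun y hy => ?_⟩
  rcases le_or_gt (powLow S pref q t) (∑ k, y.2.1 k) with h | h
  · exact hmax' y hy h
  · have h1 := ref_mem hpref hpref0 hprefI ht0 hy.1
    exact (payoff_lt_ref hpref hpref0 hprice ht hx hy.1 h).le.trans (hmax' _ h1.1 h1.2.2)

theorem bestResponses_subset_Yhat {z : Strategy N} (hz : z ∈ bestResponses S c price q x) :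
    z ∈ YhatSet S pref q t := by
  refine ⟨hz.1.1, not_lt.1 fun h => ?_⟩
  exact absurd (hz.2 _ (ref_mem hpref hpref0 hprefI (hprice.trans ht) hz.1.1).1)
    (not_le.2 (payoff_lt_ref hpref hpref0 hprice ht hx hz.1.1 h))

/-- First order conditions for best responses, with a bounded multiplier. -/
theorem exists_multiplier_of_bestResponse {z : Strategy N}
    (hz : z ∈ bestResponses S c price q x) :
    ∃ lam ∈ Set.Icc 0 (lamMax S), lam * localI S q z = 0 ∧ ∀ y ∈ YhatSet S pref q t,
      0 ≤ lagrDeriv S c price lam q (y - z) (Function.update x q z) := by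
  have hlow := powLow_pos (S := S) pref q t
  have hhat := bestResponses_subset_Yhat hpref hpref0 hprefI hprice ht hx hz
  have hzY := hz.1.1
  have hp : 0 < ∑ k, z.2.1 k := hlow.trans_le hhat.2
  have hreg := regularAt_update hx hzY hp
  have hC := contDiffAt_localI S (pfa_pos_of_mem hzY) (by linarith [pfa_le_of_mem hzY]) q
  have hf := ((contDiffAt_objective hx hzY hp c price).differentiableAt (by norm_num)).neg.hasFDerivAt
  have hg := (hC.differentiableAt (by norm_num)).hasFDerivAt
  -- Positive total power keeps the payoff finite, so optimality of `z` can be stated for the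
  -- real-valued objective.
  set Y : Set (Strategy N) := Yset S q ∩ {y | 0 < ∑ k, y.2.1 k} with hY
  have hYc : Convex ℝ Y := by
    refine (convex_Yset S q).inter ?_
    intro y hy y' hy' a b ha hb hab
    simp only [Set.mem_ofPred_eq, Prod.fst_add, Prod.snd_add, Prod.smul_fst, Prod.smul_snd,
      Pi.add_apply, Pi.smul_apply, smul_eq_mul, Finset.sum_add_distrib, ← Finset.mul_sum] at *
    exact (lt_min hy hy').trans_le (le_combo ha hb hab (min_le_left _ _) (min_le_right _ _))
  have hgd : ∀ d, fderiv ℝ (localI S q) z d = localDeriv S q d z := fun d =>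
    (hg.hasLineDerivAt d).unique
      (hasDerivAt_localI S (pfa_pos_of_mem hzY) (by linarith [pfa_le_of_mem hzY]) q d)
  have hfd : ∀ d, fderiv ℝ (-objective S c price q x) z d =
      lagrDeriv S c price 0 q d (Function.update x q z) := by
    intro d
    refine (hf.hasLineDerivAt d).unique ?_
    refine (hreg.hasDerivAt_lagr c price 0 d).congr_of_eventuallyEq
      (Eventually.of_forall fun s => ?_)
    have e : Function.update x q (z + s • d) =
        Function.update x q z + s • (Pi.single q d : Profile Q N) := by
      funext r
      by_cases hr : r = q
      · subst hr; simp
      · simp [hr]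
    simp only [Pi.neg_apply, objective, e, lagr]
    ring
  -- Halving all powers gives the Slater point. Since `localI + Imax` is linear in the powers, the
  -- constraint, when active, decreases in this direction at rate `Imax / 2`.
  set z₀ : Strategy N := (z.1, (1 / 2 : ℝ) • z.2.1, z.2.2) with hz₀
  have hz₀Y : z₀ ∈ Y := by
    refine ⟨⟨hzY.1, hzY.2.1, hzY.2.2.1, ⟨?_, fun k => ?_⟩, hzY.2.2.2.2⟩, ?_⟩
    · have := hzY.2.2.2.1.1
      simp only [hz₀, Pi.smul_apply, smul_eq_mul, ← Finset.mul_sum]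
      linarith
    · have h1 := pow_nonneg_of_mem hzY k
      have h2 := pow_le_of_mem hzY k
      simp only [hz₀, Pi.smul_apply, smul_eq_mul]
      constructor <;> linarith
    · simp only [hz₀, Set.mem_ofPred_eq, Pi.smul_apply, smul_eq_mul, ← Finset.mul_sum]
      linarith
  have hd₀ : z₀ - z = (0, (-(1 / 2) : ℝ) • z.2.1, 0) := by
    ext
    · simp [hz₀]
    · simp [hz₀]; ring
    · simp [hz₀]
  have hgd₀ : localDeriv S q (z₀ - z) z = -(1 / 2) * (localI S q z + S.Imax q) := by
    rw [hd₀]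
    simp only [localDeriv, localI, pmissDeriv, detArgDeriv, sub_add_cancel, Finset.mul_sum]
    refine Finset.sum_congr rfl fun k _ => ?_
    simp
    ring
  obtain ⟨lam, h0, hcomp, hbd, hvi⟩ := exists_multiplier hYc (x := z) ⟨hzY, hp⟩ hf hg hz.1.2
    (fun y hy hgy => by
      have h1 := hz.2 y ⟨hy.1, hgy⟩
      rw [payoff_of_pos hx hy.1 c price hy.2, payoff_of_pos hx hzY c price hp,
        EReal.coe_le_coe_iff] at h1
      exact neg_le_neg h1) hz₀Y (fun h => by
      rw [hgd, hgd₀, h]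
      linarith [S.Imax_pos q])
  refine ⟨lam, ⟨h0, ?_⟩, hcomp, fun y hy => ?_⟩
  · rcases hbd with h | ⟨h, hb⟩
    · rw [h]; exact lamMax_nonneg S
    · rw [hgd, hgd₀, h, hfd] at hb
      have hbox := power_mem_box S (update_mem_Yjoint hx hzY)
      have hR := hreg.rate_pos
      have hRs := rMin_mul_le_rate S (q := q) hbox.1 hbox.2
      set R := rate S q (power (Function.update x q z)) with hRdef
      have hn := iInf_pos_of_fin (nz_pos S q)
      have e1 : lagrDeriv S c price 0 q (z₀ - z) (Function.update x q z) =
          1 / 2 * ((∑ k, z.2.1 k / (nz S q k + interf S q k (power (Function.update x q z)) +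
            z.2.1 k)) / R) - 1 / 2 * (price * (localI S q z + S.Imax q)) := by
        have e2 : rateDeriv S q (Pi.single q (z₀ - z)) (Function.update x q z) =
            -(1 / 2) * ∑ k, z.2.1 k / (nz S q k + interf S q k (power (Function.update x q z)) +
              z.2.1 k) := by
          rw [hd₀, rateDeriv, Finset.mul_sum]
          refine Finset.sum_congr rfl fun k _ => ?_
          simp only [interf_single_self, Pi.single_eq_same, Function.update_self, Pi.smul_apply,
            smul_eq_mul]
          ring
        have e3 : (z₀ - z).1 = 0 := by rw [hd₀]
        have e4 : (z₀ - z).2.2 = 0 := by rw [hd₀]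
        rw [lagrDeriv, Function.update_self, hgd₀, thetaDeriv, e2, sensingGap_single_self]
        simp only [Pi.single_eq_same, e3, e4, ← hRdef]
        ring
      have h5 : (∑ k, z.2.1 k / (nz S q k + interf S q k (power (Function.update x q z)) +
            z.2.1 k)) ≤ (∑ k, z.2.1 k) / ⨅ k, nz S q k := by
        rw [Finset.sum_div]
        refine Finset.sum_le_sum fun k _ => ?_
        have h6 := pow_nonneg_of_mem hzY k
        have h7 := interf_nonneg S (q := q) k fun r _ => hbox.1 r
        have h8 := iInf_le_of_fin (nz S q) k
        exact div_le_div_of_nonneg_left h6 hn (by linarith)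
      -- The total power bounds the numerator from above and the rate from below, so it cancels and
      -- the multiplier bound does not depend on it.
      have h6 : (∑ k, z.2.1 k / (nz S q k + interf S q k (power (Function.update x q z)) +
            z.2.1 k)) / R ≤ 1 / (rMin S q * ⨅ k, nz S q k) := by
        rw [div_le_div_iff₀ hR (mul_pos (rMin_pos S q) hn)]
        rw [le_div_iff₀ hn] at h5
        have h7 : power (Function.update x q z) q = z.2.1 := by simp [power]
        rw [h7] at hRs
        calc _ = rMin S q * ((∑ k, z.2.1 k / (nz S q k +
              interf S q k (power (Function.update x q z)) + z.2.1 k)) * ⨅ k, nz S q k) := by ring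
          _ ≤ rMin S q * ∑ k, z.2.1 k := mul_le_mul_of_nonneg_left h5 (rMin_pos S q).le
          _ ≤ 1 * R := by linarith
      have hI := S.Imax_pos q
      -- The price enters as `lam + price`; being nonnegative, it can be discarded.
      have h7 : lam * S.Imax q ≤ 1 / (rMin S q * ⨅ k, nz S q k) := by
        rw [e1, h] at hb
        have := mul_nonneg hprice hI.le
        linarith
      refine le_trans ?_ (le_lamMax S q)
      rw [← le_div_iff₀ hI] at h7
      refine h7.trans (le_of_eq ?_)
      rw [div_div, mul_comm (S.Imax q)]
  · have h1 := hvi y ⟨hy.1, hlow.trans_le hy.2⟩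
    rw [hfd, hgd] at h1
    simp only [lagrDeriv, Function.update_self] at h1 ⊢
    linarith

end Existence

end CogRadio
end

noncomputable section
namespace CogRadio

/-! ### Weights, fixed points and asynchronous iterations -/

/-- A nonnegative matrix with row sums, or column sums, below one contracts some weighted maximum
norm. -/
theorem exists_weights {n : ℕ} {b : Fin n → Fin n → ℝ} (hb : ∀ q r, 0 ≤ b q r)
    (h : (∀ q, ∑ r ∈ Finset.univ.erase q, b q r < 1) ∨
      ∀ r, ∑ q ∈ Finset.univ.erase r, b q r < 1) :
    ∃ w : Fin n → ℝ, (∀ q, 0 < w q) ∧ ∃ κ : ℝ, 0 ≤ κ ∧ κ < 1 ∧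
      ∀ q, ∑ r ∈ Finset.univ.erase q, b q r * w r ≤ κ * w q := by
  suffices hw : ∃ w : Fin n → ℝ, (∀ q, 0 < w q) ∧
      ∀ q, ∑ r ∈ Finset.univ.erase q, b q r * w r < w q by
    obtain ⟨w, hw, hlt⟩ := hw
    have hs : ∀ q, 0 ≤ ∑ r ∈ Finset.univ.erase q, b q r * w r := fun q =>
      Finset.sum_nonneg fun r _ => mul_nonneg (hb q r) (hw r).le
    rcases isEmpty_or_nonempty (Fin n) with hE | hE
    · exact ⟨w, hw, 0, le_rfl, one_pos, fun q => hE.elim q⟩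
    · refine ⟨w, hw, ⨆ q, (∑ r ∈ Finset.univ.erase q, b q r * w r) / w q, ?_, ?_, fun q => ?_⟩
      · exact Real.iSup_nonneg fun q => div_nonneg (hs q) (hw q).le
      · obtain ⟨q, hq⟩ := exists_eq_ciSup_of_finite
          (f := fun q => (∑ r ∈ Finset.univ.erase q, b q r * w r) / w q)
        rw [← hq, div_lt_one (hw q)]
        exact hlt q
      · rw [← div_le_iff₀ (hw q)]
        exact le_iSup_of_fin (fun q => (∑ r ∈ Finset.univ.erase q, b q r * w r) / w q) q
  rcases h with h | h
  -- Row sums below one are the inequality for constant weights.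
  · exact ⟨fun _ => 1, fun _ => one_pos, fun q => by simpa using h q⟩
  · obtain ⟨δ, hδ0, hδ1, hδ⟩ : ∃ δ : ℝ, 0 ≤ δ ∧ δ < 1 ∧
        ∀ r, ∑ q ∈ Finset.univ.erase r, b q r ≤ δ := by
      rcases isEmpty_or_nonempty (Fin n) with hE | hE
      · exact ⟨0, le_rfl, one_pos, fun q => hE.elim q⟩
      · refine ⟨⨆ r, ∑ q ∈ Finset.univ.erase r, b q r, Real.iSup_nonneg fun r =>
          Finset.sum_nonneg fun q _ => hb q r, ?_, le_iSup_of_fin _⟩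
        obtain ⟨r, hr⟩ := exists_eq_ciSup_of_finite
          (f := fun r => ∑ q ∈ Finset.univ.erase r, b q r)
        rw [← hr]; exact h r
    let T : (Fin n → ℝ) → Fin n → ℝ := fun v q => ∑ r ∈ Finset.univ.erase q, b q r * v r
    have hT0 : ∀ v : Fin n → ℝ, (∀ q, 0 ≤ v q) → ∀ q, 0 ≤ T v q := fun v hv q =>
      Finset.sum_nonneg fun r _ => mul_nonneg (hb q r) (hv r)
    -- Column sums below one mean contraction of the sum of the entries, so the iterates of the
    -- all-ones vector decay geometrically.
    have hTs : ∀ v : Fin n → ℝ, (∀ q, 0 ≤ v q) → ∑ q, T v q ≤ δ * ∑ q, v q := by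
      intro v hv
      have e : ∑ q, T v q = ∑ r, (∑ q ∈ Finset.univ.erase r, b q r) * v r := by
        have e1 : ∀ q, T v q = ∑ r, if r ≠ q then b q r * v r else 0 := by
          intro q
          rw [← Finset.sum_filter]
          refine Finset.sum_congr ?_ fun _ _ => rfl
          ext r; simp
        have e2 : ∀ r, (∑ q ∈ Finset.univ.erase r, b q r) * v r =
            ∑ q, if r ≠ q then b q r * v r else 0 := by
          intro r
          rw [← Finset.sum_filter, Finset.sum_mul]
          refine Finset.sum_congr ?_ fun _ _ => rfl
          ext q; simp [eq_comm]
        simp only [e1, e2]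
        exact Finset.sum_comm
      rw [e, Finset.mul_sum]
      exact Finset.sum_le_sum fun r _ => mul_le_mul_of_nonneg_right (hδ r) (hv r)
    let u : ℕ → Fin n → ℝ := fun j => T^[j] fun _ => 1
    have hu1 : ∀ j, u (j + 1) = T (u j) := fun j => Function.iterate_succ_apply' _ _ _
    have hu0 : ∀ j q, 0 ≤ u j q := by
      intro j
      induction j with
      | zero => intro q; exact zero_le_one
      | succ j ih => rw [hu1]; exact hT0 _ ih
    have hus : ∀ j, ∑ q, u j q ≤ δ ^ j * n := by
      intro j
      induction j with
      | zero => simp [u]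
      | succ j ih =>
        rw [hu1, pow_succ]
        calc _ ≤ δ * ∑ q, u j q := hTs _ (hu0 j)
          _ ≤ δ * (δ ^ j * n) := mul_le_mul_of_nonneg_left ih hδ0
          _ = _ := by ring
    obtain ⟨m, hm⟩ : ∃ m : ℕ, δ ^ m * n < 1 := by
      have := (tendsto_pow_atTop_nhds_zero_of_lt_one hδ0 hδ1).mul_const (n : ℝ)
      rw [zero_mul] at this
      exact (this.eventually (gt_mem_nhds one_pos)).exists
    have hum : ∀ q, u (m + 1) q < 1 := by
      intro q
      have h1 := Finset.single_le_sum (fun q _ => hu0 (m + 1) q) (Finset.mem_univ q)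
      have h2 := hus (m + 1)
      have h3 : δ ^ (m + 1) * n ≤ δ ^ m * n :=
        mul_le_mul_of_nonneg_right (pow_le_pow_of_le_one hδ0 hδ1.le (Nat.le_succ m))
          (Nat.cast_nonneg n)
      linarith
    -- The weight is a truncated Neumann series. Applying `T` replaces its first term `u 0 = 1` by
    -- `u (m + 1) < 1`, so the vector strictly decreases.
    refine ⟨fun q => ∑ j ∈ Finset.range (m + 1), u j q, fun q => ?_, fun q => ?_⟩
    · have h1 := Finset.single_le_sum (f := fun j => u j q) (fun j _ => hu0 j q)
        (Finset.mem_range.2 (Nat.succ_pos m))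
      exact lt_of_lt_of_le one_pos h1
    · have e : ∑ r ∈ Finset.univ.erase q, b q r * ∑ j ∈ Finset.range (m + 1), u j r =
          ∑ j ∈ Finset.range (m + 1), u (j + 1) q := by
        simp only [Finset.mul_sum]
        rw [Finset.sum_comm]
        exact Finset.sum_congr rfl fun j _ => by rw [hu1]
      rw [e]
      have h1 := Finset.sum_range_succ' (fun j => u j q) (m + 1)
      rw [Finset.sum_range_succ] at h1
      have h2 : u 0 q = 1 := rfl
      have h3 := hum q
      linarith

section BlockContraction

variable {ι V : Type*} [Fintype ι] [NormedAddCommGroup V]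

/-- A self-map of a product set which contracts, with factor `κ`, the boxes defined by the
gauges `n q` and the weights `w q`. -/
structure BoxContraction (Y : ι → Set V) (B : (ι → V) → ι → V) (n : ι → V → ℝ) (w : ι → ℝ)
    (κ C : ℝ) : Prop where
  maps : ∀ x, (∀ q, x q ∈ Y q) → ∀ q, B x q ∈ Y q
  gauge_le : ∀ q v, n q v ≤ C * ‖v‖
  norm_le : ∀ q v, ‖v‖ ≤ C * n q v
  C_nonneg : 0 ≤ C
  w_pos : ∀ q, 0 < w q
  κ_nonneg : 0 ≤ κ
  κ_lt : κ < 1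
  contract : ∀ x, (∀ q, x q ∈ Y q) → ∀ y, (∀ q, y q ∈ Y q) → ∀ M, 0 ≤ M →
    (∀ q, n q (x q - y q) ≤ w q * M) → ∀ q, n q (B x q - B y q) ≤ κ * (w q * M)

namespace BoxContraction

variable {Y : ι → Set V} {B : (ι → V) → ι → V} {n : ι → V → ℝ} {w : ι → ℝ} {κ C : ℝ}
  (h : BoxContraction Y B n w κ C)

include h

/-- The gauges are only assumed comparable with the norm. No triangle inequality for them is used:
limits are taken in the norm, contraction in the boxes. -/
theorem exists_bound : ∃ K, 0 ≤ K ∧ (∀ v : ι → V, ∀ q, n q (v q) ≤ w q * (K * ‖v‖)) ∧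
    ∀ (v : ι → V) (M : ℝ), 0 ≤ M → (∀ q, n q (v q) ≤ w q * M) → ‖v‖ ≤ K * M := by
  have hsum : ∀ q, w q ≤ ∑ r, w r := fun q =>
    Finset.single_le_sum (fun r _ => (h.w_pos r).le) (Finset.mem_univ q)
  have hsum' : ∀ q, (w q)⁻¹ ≤ ∑ r, (w r)⁻¹ := fun q =>
    Finset.single_le_sum (f := fun r => (w r)⁻¹) (fun r _ => (inv_pos.2 (h.w_pos r)).le)
      (Finset.mem_univ q)
  have hs : 0 ≤ ∑ r, w r := Finset.sum_nonneg fun r _ => (h.w_pos r).le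
  have hs' : 0 ≤ ∑ r, (w r)⁻¹ := Finset.sum_nonneg fun r _ => (inv_pos.2 (h.w_pos r)).le
  refine ⟨C * ∑ r, (w r)⁻¹ + C * ∑ r, w r, add_nonneg (mul_nonneg h.C_nonneg hs')
    (mul_nonneg h.C_nonneg hs), fun v q => ?_, fun v M hM hv => ?_⟩
  · have h1 := h.gauge_le q (v q)
    have h2 := mul_le_mul_of_nonneg_left (norm_le_pi_norm v q) h.C_nonneg
    have h3 : 1 ≤ w q * ∑ r, (w r)⁻¹ := by
      have := mul_le_mul_of_nonneg_left (hsum' q) (h.w_pos q).le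
      rwa [mul_inv_cancel₀ (h.w_pos q).ne'] at this
    have h4 : 0 ≤ C * ‖v‖ := mul_nonneg h.C_nonneg (norm_nonneg _)
    have h5 := mul_le_mul_of_nonneg_right h3 h4
    have h6 : 0 ≤ w q * ((C * ∑ r, w r) * ‖v‖) :=
      mul_nonneg (h.w_pos q).le (mul_nonneg (mul_nonneg h.C_nonneg hs) (norm_nonneg _))
    linarith
  · have hnn : 0 ≤ (C * ∑ r, (w r)⁻¹) * M := mul_nonneg (mul_nonneg h.C_nonneg hs') hM
    have h0 : 0 ≤ (C * ∑ r, w r) * M := mul_nonneg (mul_nonneg h.C_nonneg hs) hM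
    rw [add_mul]
    refine (pi_norm_le_iff_of_nonneg (by linarith)).2 fun q => ?_
    have h1 := h.norm_le q (v q)
    have h2 := mul_le_mul_of_nonneg_left (hv q) h.C_nonneg
    have h3 := mul_le_mul_of_nonneg_left (mul_le_mul_of_nonneg_right (hsum q) hM) h.C_nonneg
    linarith

theorem fixedPoint_unique {x y : ι → V} (hx : ∀ q, x q ∈ Y q) (hy : ∀ q, y q ∈ Y q)
    (hBx : B x = x) (hBy : B y = y) : x = y := by
  obtain ⟨K, hK, h1, h2⟩ := h.exists_bound
  set M := K * ‖x - y‖ with hM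
  have hM0 : 0 ≤ M := mul_nonneg hK (norm_nonneg _)
  have hk : ∀ k : ℕ, ∀ q, n q (x q - y q) ≤ w q * (κ ^ k * M) := by
    intro k
    induction k with
    | zero => intro q; simpa using h1 (x - y) q
    | succ k ih =>
      intro q
      have := h.contract x hx y hy _ (mul_nonneg (pow_nonneg h.κ_nonneg k) hM0) ih q
      rw [hBx, hBy] at this
      refine this.trans (le_of_eq ?_)
      rw [pow_succ]; ring
  have hlim : Tendsto (fun k : ℕ => K * (κ ^ k * M)) atTop (𝓝 (K * (0 * M))) :=
    ((tendsto_pow_atTop_nhds_zero_of_lt_one h.κ_nonneg h.κ_lt).mul_const M).const_mul K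
  rw [zero_mul, mul_zero] at hlim
  have hle : ‖x - y‖ ≤ 0 := ge_of_tendsto hlim (Eventually.of_forall fun k =>
    h2 (x - y) _ (mul_nonneg (pow_nonneg h.κ_nonneg k) hM0) (hk k))
  exact sub_eq_zero.1 (norm_le_zero_iff.1 hle)

theorem exists_fixedPoint [CompleteSpace V] (hY : ∀ q, IsClosed (Y q)) {x₀ : ι → V}
    (hx₀ : ∀ q, x₀ q ∈ Y q) : ∃ x, (∀ q, x q ∈ Y q) ∧ B x = x := by
  obtain ⟨K, hK, h1, h2⟩ := h.exists_bound
  let x : ℕ → ι → V := fun k => B^[k] x₀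
  have hxs : ∀ k, x (k + 1) = B (x k) := fun k => Function.iterate_succ_apply' _ _ _
  have hxY : ∀ k q, x k q ∈ Y q := by
    intro k
    induction k with
    | zero => exact hx₀
    | succ k ih => rw [hxs]; exact h.maps _ ih
  set M := K * ‖x 0 - x 1‖ with hM
  have hM0 : 0 ≤ M := mul_nonneg hK (norm_nonneg _)
  have hMk : ∀ k : ℕ, 0 ≤ κ ^ k * M := fun k => mul_nonneg (pow_nonneg h.κ_nonneg k) hM0
  have hk : ∀ k : ℕ, ∀ q, n q (x k q - x (k + 1) q) ≤ w q * (κ ^ k * M) := by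
    intro k
    induction k with
    | zero => intro q; simpa using h1 (x 0 - x 1) q
    | succ k ih =>
      intro q
      have := h.contract _ (hxY k) _ (hxY (k + 1)) _ (hMk k) ih q
      rw [← hxs, ← hxs] at this
      refine this.trans (le_of_eq ?_)
      rw [pow_succ]; ring
  have hc : CauchySeq x := by
    refine cauchySeq_of_le_geometric κ (K * M) h.κ_lt fun k => ?_
    rw [dist_eq_norm]
    refine (h2 _ _ (hMk k) (hk k)).trans (le_of_eq ?_)
    ring
  obtain ⟨y, hy⟩ := cauchySeq_tendsto_of_complete hc
  have hyY : ∀ q, y q ∈ Y q := fun q =>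
    (hY q).mem_of_tendsto ((continuous_apply q).continuousAt.tendsto.comp hy)
      (Eventually.of_forall fun k => hxY k q)
  refine ⟨y, hyY, ?_⟩
  -- Continuity of `B` is available only within the product of the `Y q`, which contains the
  -- iterates and, by closedness, their limit.
  have hB : Tendsto (fun k => B (x k)) atTop (𝓝 (B y)) := by
    rw [tendsto_iff_norm_sub_tendsto_zero] at hy ⊢
    have hlim : Tendsto (fun k => K * (κ * (K * ‖x k - y‖))) atTop (𝓝 (K * (κ * (K * 0)))) :=
      ((hy.const_mul K).const_mul κ).const_mul K
    simp only [mul_zero] at hlim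
    refine squeeze_zero (fun _ => norm_nonneg _) (fun k => ?_) hlim
    refine h2 _ _ (mul_nonneg h.κ_nonneg (mul_nonneg hK (norm_nonneg _))) fun q => ?_
    have := h.contract _ (hxY k) _ hyY _ (mul_nonneg hK (norm_nonneg _)) (h1 (x k - y)) q
    refine this.trans (le_of_eq ?_)
    ring
  have hB' : Tendsto (fun k => B (x k)) atTop (𝓝 y) := by
    simp only [← hxs]
    exact (tendsto_add_atTop_iff_nat 1).2 hy
  exact tendsto_nhds_unique hB hB'

/-- Convergence of totally asynchronous iterations. -/
theorem tendsto_async {xs : ι → V} (hxs : ∀ q, xs q ∈ Y q) (hB : B xs = xs)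
    {U : ι → Set ℕ} {d : ι → ι → ℕ → ℕ} {x : ℕ → ι → V} (hU : ∀ q, (U q).Infinite)
    (hd : ∀ q r k, d q r k ≤ k) (hdt : ∀ q r, Tendsto (d q r) atTop atTop)
    (h0 : ∀ q, x 0 q ∈ Y q)
    (hrun : ∀ k q, (k ∈ U q → x (k + 1) q = B (fun r => x (d q r k) r) q) ∧
      (k ∉ U q → x (k + 1) q = x k q)) : Tendsto x atTop (𝓝 xs) := by
  obtain ⟨K, hK, h1, h2⟩ := h.exists_bound
  have hY : ∀ k, ∀ q, x k q ∈ Y q := by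
    intro k
    induction k using Nat.strong_induction_on with
    | _ k ih =>
      rcases k with _ | k
      · exact h0
      · intro q
        by_cases hq : k ∈ U q
        · rw [(hrun k q).1 hq]
          exact h.maps _ (fun r => ih _ (Nat.lt_succ_of_le (hd q r k)) r) q
        · rw [(hrun k q).2 hq]
          exact ih k (Nat.lt_succ_self k) q
  have hκ := h.κ_nonneg
  set M := K * ‖x 0 - xs‖ with hM
  have hM0 : 0 ≤ M := mul_nonneg hK (norm_nonneg _)
  -- an update with information from the box of radius `R` leads to the box of radius `κ * R`
  have hstep : ∀ R, 0 ≤ R → ∀ k q, k ∈ U q → (∀ r, n r (x (d q r k) r - xs r) ≤ w r * R) →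
      n q (x (k + 1) q - xs q) ≤ w q * (κ * R) := by
    intro R hR k q hkq hr
    have := h.contract (fun r => x (d q r k) r) (fun r => hY _ r) xs hxs R hR hr q
    rw [hB, ← (hrun k q).1 hkq] at this
    linarith
  have hbase : ∀ k q, n q (x k q - xs q) ≤ w q * M := by
    intro k
    induction k using Nat.strong_induction_on with
    | _ k ih =>
      rcases k with _ | k
      · exact h1 (x 0 - xs)
      · intro q
        by_cases hq : k ∈ U q
        · refine (hstep M hM0 k q hq fun r => ih _ (Nat.lt_succ_of_le (hd q r k)) r).trans ?_
          refine mul_le_mul_of_nonneg_left ?_ (h.w_pos q).le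
          exact mul_le_of_le_one_left hM0 h.κ_lt.le
        · rw [(hrun k q).2 hq]
          exact ih k (Nat.lt_succ_self k) q
  -- Once all strategies are in box `j`, all available information eventually comes from that
  -- period. The next update of each user then enters box `j + 1`, and neither later updates nor
  -- idle times leave it.
  have hbox : ∀ j : ℕ, ∃ k₀, ∀ k ≥ k₀, ∀ q, n q (x k q - xs q) ≤ w q * (κ ^ j * M) := by
    intro j
    induction j with
    | zero => exact ⟨0, fun k _ q => by simpa using hbase k q⟩
    | succ j ih =>
      obtain ⟨k₀, hk₀⟩ := ih
      have hR : 0 ≤ κ ^ j * M := mul_nonneg (pow_nonneg hκ j) hM0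
      obtain ⟨k₁, hk₁⟩ : ∃ k₁, ∀ k ≥ k₁, ∀ q r, k₀ ≤ d q r k := by
        have : ∀ᶠ k in atTop, ∀ q r, k₀ ≤ d q r k :=
          eventually_all.2 fun q => eventually_all.2 fun r => (hdt q r).eventually_ge_atTop k₀
        exact eventually_atTop.1 this
      have hupd : ∀ k ≥ k₁, ∀ q, k ∈ U q →
          n q (x (k + 1) q - xs q) ≤ w q * (κ ^ (j + 1) * M) := by
        intro k hk q hq
        have := hstep _ hR k q hq fun r => hk₀ _ (hk₁ k hk q r) r
        rwa [← mul_assoc κ, ← pow_succ'] at this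
      choose m hm hmk using fun q => (hU q).exists_gt k₁
      have hq : ∀ q, ∀ k ≥ m q + 1, n q (x k q - xs q) ≤ w q * (κ ^ (j + 1) * M) := by
        intro q k hk
        induction k, hk using Nat.le_induction with
        | base => exact hupd _ (hmk q).le q (hm q)
        | succ k hk ih =>
          by_cases hkq : k ∈ U q
          · exact hupd k ((hmk q).le.trans ((Nat.le_succ _).trans hk)) q hkq
          · rw [(hrun k q).2 hkq]; exact ih
      have : ∀ᶠ k in atTop, ∀ q, m q + 1 ≤ k :=
        eventually_all.2 fun q => eventually_ge_atTop (m q + 1)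
      obtain ⟨k₂, hk₂⟩ := eventually_atTop.1 this
      exact ⟨k₂, fun k hk q => hq q k (hk₂ k hk q)⟩
  rw [tendsto_iff_norm_sub_tendsto_zero, Metric.tendsto_atTop]
  intro ε hε
  have hlim : Tendsto (fun k : ℕ => K * (κ ^ k * M)) atTop (𝓝 (K * (0 * M))) :=
    ((tendsto_pow_atTop_nhds_zero_of_lt_one h.κ_nonneg h.κ_lt).mul_const M).const_mul K
  rw [zero_mul, mul_zero] at hlim
  obtain ⟨j, hj⟩ := (hlim.eventually (gt_mem_nhds hε)).exists
  obtain ⟨k₀, hk₀⟩ := hbox j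
  refine ⟨k₀, fun k hk => ?_⟩
  rw [Real.dist_eq, sub_zero, abs_of_nonneg (norm_nonneg _)]
  exact (h2 (x k - xs) _ (mul_nonneg (pow_nonneg hκ j) hM0) (hk₀ k hk)).trans_lt hj

end BoxContraction

end BlockContraction

end CogRadio
end

/-! ### Lipschitz estimate for the best response -/

noncomputable section
namespace CogRadio

variable {Q N : ℕ} {S : System Q N}

/-! ### The gauges `userNorm` -/

theorem userNorm_le_mul_norm (pref : Fin Q → Fin N → ℝ) {c : ℝ} (hc : 0 ≤ c) (t : ℝ) (q : Fin Q)
    (z : Strategy N) : userNorm S pref c t q z ≤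
      Real.sqrt (rho S pref q t * (1 + (N + 1)) +
        c * ((1 - 1 / (Q : ℝ)) / Real.sqrt (S.f q)) ^ 2) * ‖z‖ := by
  have hρ := rho_nonneg (S := S) pref q t
  have hsq : ∀ a : ℝ, |a| ≤ ‖z‖ → a ^ 2 ≤ ‖z‖ ^ 2 := fun a ha => by
    rw [← sq_abs]; exact pow_le_pow_left₀ (abs_nonneg a) ha 2
  have h1 : z.1 ^ 2 ≤ ‖z‖ ^ 2 := hsq _ (norm_fst_le z)
  have h2 : z.2.2 ^ 2 ≤ ‖z‖ ^ 2 := hsq _ ((norm_snd_le z.2).trans (norm_snd_le z))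
  have h3 : ∑ k, z.2.1 k ^ 2 ≤ N * ‖z‖ ^ 2 := by
    have := Finset.sum_le_card_nsmul Finset.univ (fun k => z.2.1 k ^ 2) (‖z‖ ^ 2) fun k _ =>
      hsq _ (((norm_le_pi_norm z.2.1 k).trans (norm_fst_le z.2)).trans (norm_snd_le z))
    simpa using this
  refine abs_le_of_sq_le_sq' ?_ (by positivity) |>.2
  rw [userNorm_sq pref hc, mul_pow, mul_pow (Real.sqrt _) ‖z‖, Real.sq_sqrt (by positivity), add_mul]
  refine add_le_add ?_ ?_
  · rw [mul_assoc]
    exact mul_le_mul_of_nonneg_left (by linarith) hρ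
  · rw [mul_assoc]
    exact mul_le_mul_of_nonneg_left (mul_le_mul_of_nonneg_left h1 (sq_nonneg _)) hc

theorem norm_le_mul_userNorm {pref : Fin Q → Fin N → ℝ} {c t : ℝ} (hc : 0 ≤ c) {q : Fin Q}
    (hρ : 0 < rho S pref q t) (z : Strategy N) :
    ‖z‖ ≤ (Real.sqrt (rho S pref q t))⁻¹ * userNorm S pref c t q z := by
  have hs := Real.sqrt_pos.2 hρ
  have hn := userNorm_nonneg (S := S) pref c t q z
  have hsum : 0 ≤ ∑ k, z.2.1 k ^ 2 := Finset.sum_nonneg fun k _ => sq_nonneg _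
  have key : ∀ a : ℝ, a ^ 2 ≤ z.1 ^ 2 + (∑ k, z.2.1 k ^ 2 + z.2.2 ^ 2) →
      |a| ≤ (Real.sqrt (rho S pref q t))⁻¹ * userNorm S pref c t q z := by
    intro a ha
    rw [inv_mul_eq_div, le_div_iff₀ hs, mul_comm]
    refine abs_le_of_sq_le_sq' ?_ hn |>.2
    rw [mul_pow, Real.sq_sqrt hρ.le, sq_abs, userNorm_sq pref hc]
    have := mul_le_mul_of_nonneg_left ha hρ.le
    have : 0 ≤ c * ((1 - 1 / (Q : ℝ)) / Real.sqrt (S.f q) * z.1) ^ 2 := by positivity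
    linarith
  have h0 : 0 ≤ (Real.sqrt (rho S pref q t))⁻¹ * userNorm S pref c t q z := by positivity
  refine norm_prod_le_iff.2 ⟨key _ ?_, norm_prod_le_iff.2
    ⟨(pi_norm_le_iff_of_nonneg h0).2 fun k => key _ ?_, key _ ?_⟩⟩
  · linarith [sq_nonneg z.2.2]
  · have := Finset.single_le_sum (f := fun k => z.2.1 k ^ 2) (fun k _ => sq_nonneg _)
      (Finset.mem_univ k)
    linarith [sq_nonneg z.2.2, sq_nonneg z.1]
  · linarith [sq_nonneg z.1]

theorem userNorm_sub_comm (pref : Fin Q → Fin N → ℝ) {c : ℝ} (hc : 0 ≤ c) (t : ℝ) (q : Fin Q)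
    (z z' : Strategy N) : userNorm S pref c t q (z - z') = userNorm S pref c t q (z' - z) := by
  rw [← Real.sqrt_sq (userNorm_nonneg pref c t q (z - z')),
    ← Real.sqrt_sq (userNorm_nonneg pref c t q (z' - z)), userNorm_sq pref hc, userNorm_sq pref hc]
  have : z - z' = -(z' - z) := (neg_sub _ _).symm
  rw [this]
  generalize z' - z = w
  simp [mul_neg]

/-! ### Lipschitz bounds for best responses -/

section BestResponse

variable [Nonempty (Fin N)] {pref : Fin Q → Fin N → ℝ} (hpref : ∀ q, pref q ∈ powerSet S q)
  (hpref0 : ∀ q, pref q ≠ 0) (hprefI : ∀ q, ∑ k, gw S q k * pref q k ≤ 2 * S.Imax q)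
  {c price t : ℝ} (hc : 0 ≤ c) (hprice : 0 ≤ price) (ht : price ≤ t)
  (hfeas : ∀ q, (Xset S q).Nonempty) (hrho : ∀ q, 0 < rhoLow S q t)

include hpref hpref0 hprefI hprice ht hfeas hrho in
theorem rhoLow_le_rho_of_feasible (q : Fin Q) : rhoLow S q t ≤ rho S pref q t := by
  choose z hz using hfeas
  have hY : ∀ r, r ≠ q → z r ∈ Yset S r := fun r _ => (hz r).1
  have h1 := ref_mem hpref hpref0 hprefI (hprice.trans ht) (hz q).1
  refine rhoLow_le_rho (hrho q) (hprice.trans ht)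
    (x := Function.update z q ((z q).1, pref q, (z q).2.2)) (update_mem_Yjoint hY h1.2.1) ?_
  simpa using h1.2

include hpref hpref0 hprefI hc hprice ht hrho in
/-- Two best responses differ by at most the mixed difference of the payoffs. -/
theorem userNorm_sq_le_mixed {q : Fin Q} {x x' : Profile Q N}
    (hx : ∀ r, r ≠ q → x r ∈ Yset S r) (hx' : ∀ r, r ≠ q → x' r ∈ Yset S r) {z z' : Strategy N}
    (hz : z ∈ bestResponses S c price q x) (hz' : z' ∈ bestResponses S c price q x') :
    userNorm S pref c t q (z' - z) ^ 2 ≤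
      theta S c q (Function.update x q z) - theta S c q (Function.update x q z') -
        theta S c q (Function.update x' q z) + theta S c q (Function.update x' q z') := by
  have hY := bestResponses_subset_Yhat hpref hpref0 hprefI hprice ht hx hz
  have hY' := bestResponses_subset_Yhat hpref hpref0 hprefI hprice ht hx' hz'
  obtain ⟨l, hl, hcomp, hvi⟩ :=
    exists_multiplier_of_bestResponse hpref hpref0 hprefI hprice ht hx hz
  obtain ⟨l', hl', hcomp', hvi'⟩ :=
    exists_multiplier_of_bestResponse hpref hpref0 hprefI hprice ht hx' hz'
  -- Each Lagrangian carries the multiplier of its own problem, and is expanded at its own solution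
  -- and evaluated at the other one. The halves of the squared gauge add up to one.
  have h1 := lagr_strongly_convex hc (hrho q) (update_mem_Yjoint hx hY.1)
    (by simpa using hY) hY' hl ⟨hprice, ht⟩
  have h2 := lagr_strongly_convex hc (hrho q) (update_mem_Yjoint hx' hY'.1)
    (by simpa using hY') hY hl' ⟨hprice, ht⟩
  rw [Function.update_self, Function.update_idem] at h1 h2
  have h3 := hvi _ hY'
  have h4 := hvi' _ hY
  have h5 := globalI_sub S q (x := Function.update x q z') (y := Function.update x q z)
    fun r hr => by simp [hr]
  have h6 := globalI_sub S q (x := Function.update x' q z) (y := Function.update x' q z')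
    fun r hr => by simp [hr]
  rw [userNorm_sub_comm pref hc t q z z'] at h2
  simp only [Function.update_self] at h5 h6
  simp only [lagr, Function.update_self] at h1 h2
  -- Feasibility does not depend on the other users, so `z'` is feasible for the first problem and
  -- `z` for the second. Complementarity removes the other two multiplier terms.
  have h7 := mul_nonpos_of_nonneg_of_nonpos hl.1 hz'.1.2
  have h8 := mul_nonpos_of_nonneg_of_nonpos hl'.1 hz.1.2
  have e5 : price * globalI S (Function.update x q z') = price * globalI S (Function.update x q z) +
      price * (localI S q z' - localI S q z) := by rw [← h5]; ring
  have e6 : price * globalI S (Function.update x' q z) =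
      price * globalI S (Function.update x' q z') +
      price * (localI S q z - localI S q z') := by rw [← h6]; ring
  rw [e5] at h1
  rw [e6] at h2
  linarith

include hpref hpref0 hprefI hc hprice ht hfeas hrho in
-- For equal opponents the mixed difference vanishes, and positivity of `rho` makes the gauge
-- definite.
theorem bestResponses_unique {q : Fin Q} {x : Profile Q N} (hx : ∀ r, r ≠ q → x r ∈ Yset S r)
    {z z' : Strategy N} (hz : z ∈ bestResponses S c price q x)
    (hz' : z' ∈ bestResponses S c price q x) : z' = z := by
  have h1 := userNorm_sq_le_mixed hpref hpref0 hprefI hc hprice ht hrho hx hx hz hz'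
  have h2 : userNorm S pref c t q (z' - z) = 0 := by
    have h3 := sq_nonneg (userNorm S pref c t q (z' - z))
    exact pow_eq_zero_iff two_ne_zero |>.1 (le_antisymm (by linarith) h3)
  have h4 := norm_le_mul_userNorm hc ((hrho q).trans_le
    (rhoLow_le_rho_of_feasible hpref hpref0 hprefI hprice ht hfeas hrho q)) (z' - z)
  rw [h2, mul_zero] at h4
  exact sub_eq_zero.1 (norm_le_zero_iff.1 h4)

include hpref hpref0 hprefI hc hprice ht hfeas hrho in
theorem userNorm_bestResponse_sub_le {q : Fin Q} {x x' : Profile Q N} (hx : x ∈ Yjoint S)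
    (hx' : x' ∈ Yjoint S) {z z' : Strategy N} (hz : z ∈ bestResponses S c price q x)
    (hz' : z' ∈ bestResponses S c price q x') :
    userNorm S pref c t q (z - z') ≤
      ∑ r ∈ Finset.univ.erase q, betaCoef S pref c t q r * userNorm S pref c t r (x r - x' r) := by
  have hrl := rhoLow_le_rho_of_feasible hpref hpref0 hprefI hprice ht hfeas hrho
  have hxq : ∀ r, r ≠ q → x r ∈ Yset S r := fun r _ => hx r
  have hxq' : ∀ r, r ≠ q → x' r ∈ Yset S r := fun r _ => hx' r
  have hY := bestResponses_subset_Yhat hpref hpref0 hprefI hprice ht hxq hz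
  have hY' := bestResponses_subset_Yhat hpref hpref0 hprefI hprice ht hxq' hz'
  have h1 := userNorm_sq_le_mixed hpref hpref0 hprefI hc hprice ht hrho hxq hxq' hz hz'
  set V := Function.update x' q z with hV
  set u : Profile Q N := Pi.single q (z' - z) with hu
  -- The mixed difference lives on the parallelogram spanned by `u`, which moves user `q`, and `v`,
  -- which moves all the others at once. It stays in the convex sets, and linearity in `v` splits
  -- the derivative by user.
  set v : Profile Q N := ∑ r ∈ Finset.univ.erase q, Pi.single r (x r - x' r) with hv
  have hvr : ∀ r, v r = if r = q then 0 else x r - x' r := by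
    intro r
    rw [hv, Finset.sum_apply]
    by_cases hr : r = q
    · subst hr
      rw [if_pos rfl]
      exact Finset.sum_eq_zero fun s hs => by simp [(Finset.ne_of_mem_erase hs).symm]
    · rw [if_neg hr, Finset.sum_eq_single r (fun s _ hs => by simp [hs.symm])
        (fun h => absurd (Finset.mem_erase.2 ⟨hr, Finset.mem_univ r⟩) h)]
      simp
  have e1 : V + u = Function.update x' q z' := by
    funext r
    by_cases hr : r = q
    · subst hr; simp [hV, hu]
    · simp [hV, hu, hr]
  have e2 : V + v = Function.update x q z := by
    funext r
    rw [Pi.add_apply, hvr]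
    by_cases hr : r = q
    · subst hr; simp [hV]
    · simp [hV, hr]
  have e3 : V + u + v = Function.update x q z' := by
    funext r
    rw [e1, Pi.add_apply, hvr]
    by_cases hr : r = q
    · subst hr; simp
    · simp [hr]
  have hmem : ∀ s ∈ Set.Icc (0 : ℝ) 1, ∀ s' ∈ Set.Icc (0 : ℝ) 1,
      V + s • u + s' • v ∈ Yjoint S ∧ (V + s • u + s' • v) q ∈ YhatSet S pref q t := by
    intro s hs s' hs'
    have hq : (V + s • u + s' • v) q ∈ YhatSet S pref q t := by
      have : (V + s • u + s' • v) q = z + s • (z' - z) := by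
        simp only [Pi.add_apply, Pi.smul_apply, hvr, hV, hu]
        simp
      rw [this]
      exact (convex_YhatSet pref q t).add_smul_sub_mem hY hY' hs
    refine ⟨mem_Yjoint_of hq.1 fun r hr => ?_, hq⟩
    have : (V + s • u + s' • v) r = x' r + s' • (x r - x' r) := by
      simp only [Pi.add_apply, Pi.smul_apply, hvr, hV, hu]
      simp [hr]
    rw [this]
    exact (convex_Yset S r).add_smul_sub_mem (hx' r) (hx r) hs'
  obtain ⟨s, hs, s', hs', hmv⟩ := exists_mixed_difference_eq (F := theta S c q) (x := V) (u := u)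
    (v := v) fun s hs s' hs' =>
      (regularAt_of_mem_Yhat (hmem s hs s' hs').1 (hmem s hs s' hs').2).contDiffAt_theta c
  rw [e3, e1, e2] at hmv
  set y := V + s • u + s' • v with hy
  have hyreg := regularAt_of_mem_Yhat (hmem s hs s' hs').1 (hmem s hs s' hs').2
  have h2 : |fderiv ℝ (fderiv ℝ (theta S c q)) y u v| ≤ ∑ r ∈ Finset.univ.erase q,
      betaCoef S pref c t q r *
        (userNorm S pref c t q (z' - z) * userNorm S pref c t r (x r - x' r)) := by
    rw [hv, map_sum]
    refine (Finset.abs_sum_le_sum_abs _ _).trans (Finset.sum_le_sum fun r hr => ?_)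
    rw [← pd2_eq_fderiv (hyreg.contDiffAt_theta c)]
    exact abs_pd2_theta_le_betaCoef hc (Finset.ne_of_mem_erase hr) (hrho q) (hrho r) (hrl q)
      (hrl r) (hmem s hs s' hs').1 (hmem s hs s' hs').2 _ _
  have h3 : userNorm S pref c t q (z' - z) ^ 2 ≤ userNorm S pref c t q (z' - z) *
      ∑ r ∈ Finset.univ.erase q, betaCoef S pref c t q r *
        userNorm S pref c t r (x r - x' r) := by
    have h4 : ∑ r ∈ Finset.univ.erase q, betaCoef S pref c t q r *
        (userNorm S pref c t q (z' - z) * userNorm S pref c t r (x r - x' r)) =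
        userNorm S pref c t q (z' - z) * ∑ r ∈ Finset.univ.erase q, betaCoef S pref c t q r *
        userNorm S pref c t r (x r - x' r) := by
      rw [Finset.mul_sum]
      exact Finset.sum_congr rfl fun r _ => by ring
    rw [h4] at h2
    have h5 := neg_abs_le (fderiv ℝ (fderiv ℝ (theta S c q)) y u v)
    linarith
  rw [userNorm_sub_comm pref hc]
  -- One factor of the squared gauge is divided out; if it is zero, nonnegativity of the right side
  -- suffices.
  rcases (userNorm_nonneg (S := S) pref c t q (z' - z)).eq_or_lt with h0 | h0
  · rw [← h0]
    refine Finset.sum_nonneg fun r _ => mul_nonneg (Real.sSup_nonneg ?_)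
      (userNorm_nonneg pref c t r _)
    rintro m ⟨y, _, _, rfl⟩
    exact specNorm_nonneg _
  · rw [sq] at h3
    exact le_of_mul_le_mul_left h3 h0

end BestResponse

theorem betaCoef_nonneg (pref : Fin Q → Fin N → ℝ) (c t : ℝ) (q r : Fin Q) :
    0 ≤ betaCoef S pref c t q r := by
  refine Real.sSup_nonneg ?_
  rintro m ⟨y, _, _, rfl⟩
  exact specNorm_nonneg _

theorem betaUp_nonneg (pref : Fin Q → Fin N → ℝ) (c t : ℝ) (q r : Fin Q) :
    0 ≤ betaUp S pref c t q r := specNorm_nonneg _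

end CogRadio

end

open CogRadio in
theorem corollary3 {Q N : ℕ} (hN : 0 < N) (S : System Q N) (c price t : ℝ)
    (hc : 0 ≤ c) (hprice : 0 ≤ price) (ht : price ≤ t)
    -- every user has a feasible strategy
    (hfeas : ∀ q, (Xset S q).Nonempty)
    -- the reference power allocations
    (pref : Fin Q → Fin N → ℝ) (hpref : ∀ q, pref q ∈ powerSet S q) (hpref0 : ∀ q, pref q ≠ 0)
    (hprefI : ∀ q, ∑ k, gw S q k * pref q k ≤ 2 * S.Imax q)
    -- the matrices whose inverses define `betaUp` are invertible
    (hrho : ∀ q, 0 < rhoLow S q t)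
    (hMUI : LowReceived S pref c t ∨ LowTransmitted S pref c t) :
    -- the coefficients `betaUp` bound the off-diagonal entries of `Γ(t)`
    (∀ q r, q ≠ r → |Gam S pref c t q r| ≤ betaUp S pref c t q r) ∧
    -- every user has a unique optimal solution, which is nontrivial
    (∀ q (x : Profile Q N), (∀ r, r ≠ q → x r ∈ Yset S r) →
      ∃ z, bestResponses S c price q x = {z} ∧ z.2.1 ≠ 0) ∧
    -- the best-response map
    ∀ B : Profile Q N → Profile Q N,
      (∀ x ∈ Yjoint S, ∀ q, B x q ∈ bestResponses S c price q x) →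
      IsBlockContraction S pref c t B ∧
      ∃ xs ∈ Yjoint S, (∀ y ∈ Yjoint S, B y = y ↔ y = xs) ∧
        (∀ y, IsNash S c price y ↔ y = xs) ∧
        -- asynchronous convergence
        ∀ (U : Fin Q → Set ℕ) (d : Fin Q → Fin Q → ℕ → ℕ) (x : ℕ → Profile Q N),
          IsSchedule U d → x 0 ∈ Yjoint S → IsAsyncRun B U d x →
          Tendsto x atTop (𝓝 xs) := by
  have : Nonempty (Fin N) := ⟨⟨0, hN⟩⟩
  have hrl := rhoLow_le_rho_of_feasible hpref hpref0 hprefI hprice ht hfeas hrho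
  have hρ : ∀ q, 0 < rho S pref q t := fun q => (hrho q).trans_le (hrl q)
  have hbeta : ∀ q r, r ≠ q → betaCoef S pref c t q r ≤ betaUp S pref c t q r := fun q r hqr =>
    betaCoef_le_betaUp hc hqr (hrho q) (hrho r) (hrl q) (hrl r)
  have huniq : ∀ q (x : Profile Q N), (∀ r, r ≠ q → x r ∈ Yset S r) →
      ∀ z ∈ bestResponses S c price q x, ∀ z' ∈ bestResponses S c price q x, z' = z :=
    fun q x hx z hz z' hz' =>
      bestResponses_unique hpref hpref0 hprefI hc hprice ht hfeas hrho hx hz hz'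
  refine ⟨fun q r hqr => ?_, fun q x hx => ?_, fun B hB => ?_⟩
  · rw [Gam, Matrix.of_apply, if_neg hqr.symm, abs_neg, abs_of_nonneg (betaCoef_nonneg ..)]
    exact hbeta q r hqr.symm
  · obtain ⟨z, hz⟩ := bestResponses_nonempty (c := c) hpref hpref0 hprefI hprice ht hx (hfeas q)
    refine ⟨z, Set.eq_singleton_iff_unique_mem.2 ⟨hz, huniq q x hx z hz⟩, fun h0 => ?_⟩
    have h1 := (bestResponses_subset_Yhat hpref hpref0 hprefI hprice ht hx hz).2
    have h2 := powLow_pos (S := S) pref q t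
    simp only [h0, Pi.zero_apply, Finset.sum_const_zero] at h1
    linarith
  -- The weights come from the explicit coefficients `betaUp`; since these dominate `betaCoef`, the
  -- same weights serve for the true coupling.
  · obtain ⟨w, hw, κ, hκ0, hκ1, hwκ⟩ := exists_weights (b := betaUp S pref c t)
      (betaUp_nonneg pref c t) hMUI
    have hcon : ∀ x ∈ Yjoint S, ∀ y ∈ Yjoint S, ∀ M, 0 ≤ M →
        (∀ q, userNorm S pref c t q (x q - y q) ≤ w q * M) →
        ∀ q, userNorm S pref c t q (B x q - B y q) ≤ κ * (w q * M) := by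
      intro x hx y hy M hM hxy q
      refine (userNorm_bestResponse_sub_le hpref hpref0 hprefI hc hprice ht hfeas hrho hx hy
        (hB x hx q) (hB y hy q)).trans ?_
      calc _ ≤ ∑ r ∈ Finset.univ.erase q, betaUp S pref c t q r * (w r * M) :=
            Finset.sum_le_sum fun r hr => mul_le_mul (hbeta q r (Finset.ne_of_mem_erase hr))
              (hxy r) (userNorm_nonneg ..) (betaUp_nonneg ..)
        _ = (∑ r ∈ Finset.univ.erase q, betaUp S pref c t q r * w r) * M := by
            rw [Finset.sum_mul]
            exact Finset.sum_congr rfl fun r _ => by ring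
        _ ≤ (κ * w q) * M := mul_le_mul_of_nonneg_right (hwκ q) hM
        _ = _ := by ring
    set a : Fin Q → ℝ := fun q => Real.sqrt (rho S pref q t * (1 + (N + 1)) +
        c * ((1 - 1 / (Q : ℝ)) / Real.sqrt (S.f q)) ^ 2) with ha
    set b : Fin Q → ℝ := fun q => (Real.sqrt (rho S pref q t))⁻¹ with hb
    have ha0 : ∀ q, 0 ≤ a q := fun q => Real.sqrt_nonneg _
    have hb0 : ∀ q, 0 ≤ b q := fun q => inv_nonneg.2 (Real.sqrt_nonneg _)
    have haC : ∀ q, a q ≤ ∑ r, (a r + b r) := fun q =>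
      (le_add_of_nonneg_right (hb0 q)).trans (Finset.single_le_sum
        (f := fun r => a r + b r) (fun r _ => add_nonneg (ha0 r) (hb0 r)) (Finset.mem_univ q))
    have hbC : ∀ q, b q ≤ ∑ r, (a r + b r) := fun q =>
      (le_add_of_nonneg_left (ha0 q)).trans (Finset.single_le_sum
        (f := fun r => a r + b r) (fun r _ => add_nonneg (ha0 r) (hb0 r)) (Finset.mem_univ q))
    have hbox : BoxContraction (Yset S) B (userNorm S pref c t) w κ (∑ r, (a r + b r)) :=
      { maps := fun x hx q => (hB x hx q).1.1
        gauge_le := fun q v => (userNorm_le_mul_norm pref hc t q v).trans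
          (mul_le_mul_of_nonneg_right (haC q) (norm_nonneg _))
        norm_le := fun q v => (norm_le_mul_userNorm hc (hρ q) v).trans
          (mul_le_mul_of_nonneg_right (hbC q) (userNorm_nonneg ..))
        C_nonneg := Finset.sum_nonneg fun r _ => add_nonneg (ha0 r) (hb0 r)
        w_pos := hw
        κ_nonneg := hκ0
        κ_lt := hκ1
        contract := hcon }
    refine ⟨⟨hρ, w, hw, κ, hκ0, hκ1, fun x hx y hy => ?_⟩, ?_⟩
    · have hM : 0 ≤ blockNorm S pref c t w (x - y) :=
        Real.iSup_nonneg fun q => div_nonneg (userNorm_nonneg ..) (hw q).le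
      refine Real.iSup_le (fun q => ?_) (mul_nonneg hκ0 hM)
      rw [div_le_iff₀ (hw q)]
      have := hcon x hx y hy _ hM (fun q => by
        rw [← div_le_iff₀' (hw q)]
        exact le_iSup_of_fin (fun q => userNorm S pref c t q ((x - y) q) / w q) q) q
      refine this.trans (le_of_eq ?_)
      ring
    · choose x₀ hx₀ using hfeas
      obtain ⟨xs, hxs, hfix⟩ := hbox.exists_fixedPoint (isClosed_Yset S) (x₀ := x₀)
        fun q => (hx₀ q).1
      have hfixuniq : ∀ y ∈ Yjoint S, B y = y ↔ y = xs := fun y hy =>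
        ⟨fun h => hbox.fixedPoint_unique hy hxs h hfix, fun h => by rw [h, hfix]⟩
      refine ⟨xs, hxs, hfixuniq, fun y => ⟨fun hy => ?_, ?_⟩, fun U d x hUd hx0 hrun => ?_⟩
      -- An equilibrium is automatically feasible, and uniqueness of best responses makes it a fixed
      -- point of `B`.
      · have hyY : y ∈ Yjoint S := fun q => (hy q).1.1
        refine (hfixuniq y hyY).1 (funext fun q => ?_)
        exact huniq q y (fun r _ => hyY r) _ (hy q) _ (hB y hyY q)
      · rintro rfl q
        have := hB y hxs q
        rwa [hfix] at this
      · exact hbox.tendsto_async hxs hfix hUd.1 hUd.2.1 hUd.2.2 hx0 hrun
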